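/- **Theorem 2.5.** Let $N\ge 2$, let $T=\{x\in\mathbb R^N: 1<|x|<2\}$, and let $2<p<2^*$, where $2^*=\frac{2N}{N-2}$ if $N\ge3$ and $2^*=+\infty$ if $N=2$. There is exactly one positive function $W\in C^2(\mathbb R)$ such that $$-W''+W=W^{p-1}\ \text{ in }\mathbb R,\qquad W(r)\to0\ \text{ as }|r|\to+\infty,\qquad W(0)=\max_{\mathbb R}W .$$ Every positive $C^2$ solution on $\mathbb R$ of the equation that tends to $0$ as $|r|\to+\infty$ is a translate of $W$, and $W\in H^1(\mathbb R)$. Let $\lambda_n\to+\infty$ and, for each $n$, let $u_n$ be a positive (weak) solution in $H^1_{0,\mathrm{rad}}(T)$, the space of radially symmetric functions in $H^1_0(T)$, of $$-\Delta u_n+\lambda_n u_n=|u_n|^{p-2}u_n\ \text{ in }T,\qquad u_n=0\ \text{ on }\partial T,$$ written $u_n=u_n(r)$, $r=|x|\in[1,2]$, through its continuous representative. Let $\bar r_n\in[1,2]$ be a maximum point of $u_n(r)$, and for $n$ with $\lambda_n>0$ put $$\omega_n(r)=\lambda_n^{\frac1{2-p}}\,u_n\!\Big(\frac{r}{\sqrt{\lambda_n}}+\bar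 r_n\Big),\qquad r\in\big(\sqrt{\lambda_n}(1-\bar r_n),\sqrt{\lambda_n}(2-\bar r_n)\big),$$ extended by $0$ to $\mathbb R$. Then, along a subsequence, $\omega_n\to W$ in $H^1(\mathbb R)$. -/

import Mathlib

open MeasureTheory Filter Topology Set
open scoped ContDiff Gradient

section Sobolev

variable {E : Type*} [NormedAddCommGroup E] [InnerProductSpace ℝ E] [CompleteSpace E]
  [MeasureSpace E]

/-- `φ ∈ C_c^∞(Ω)`. -/
def IsTestFunction (Ω : Set E) (φ : E → ℝ) : Prop :=
  ContDiff ℝ ∞ φ ∧ HasCompactSupport φ ∧ tsupport φ ⊆ Ω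

/-- `u ∈ H¹(Ω)` with weak gradient `g`: both are square integrable on `Ω`, and
`∫_Ω u ∇φ = - ∫_Ω φ g` for all `φ ∈ C_c^∞(Ω)`. -/
structure HasH1Gradient (Ω : Set E) (u : E → ℝ) (g : E → E) : Prop where
  memLp : MemLp u 2 (volume.restrict Ω)
  memLp_grad : MemLp g 2 (volume.restrict Ω)
  integral_eq : ∀ φ : E → ℝ, IsTestFunction Ω φ →
    ∫ x in Ω, u x • ∇ φ x = - ∫ x in Ω, φ x • g x

/-- `u ∈ H¹(Ω)`. -/
def MemH1 (Ω : Set E) (u : E → ℝ) : Prop :=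
  ∃ g : E → E, HasH1Gradient Ω u g

/-- `v n → u` in `H¹(Ω)`: all functions lie in `H¹(Ω)`, and the functions and their weak
gradients converge in `L²(Ω)`. -/
def TendstoH1 (Ω : Set E) (v : ℕ → E → ℝ) (u : E → ℝ) : Prop :=
  ∃ (G : ℕ → E → E) (g : E → E),
    (∀ n, HasH1Gradient Ω (v n) (G n)) ∧ HasH1Gradient Ω u g ∧
    Tendsto (fun n => eLpNorm (fun x => v n x - u x) 2 (volume.restrict Ω)) atTop (𝓝 0) ∧
    Tendsto (fun n => eLpNorm (fun x => G n x - g x) 2 (volume.restrict Ω)) atTop (𝓝 0)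

/-- `u ∈ H¹₀(Ω)`, the closure of `C_c^∞(Ω)` in `H¹(Ω)`. -/
def MemH10 (Ω : Set E) (u : E → ℝ) : Prop :=
  ∃ φ : ℕ → E → ℝ, (∀ k, IsTestFunction Ω (φ k)) ∧ TendstoH1 Ω φ u

/-- `u ∈ H¹(Ω)` solves `-Δu + lam u = |u|^{p-2} u` weakly in `Ω`. -/
def IsWeakSolution (Ω : Set E) (p lam : ℝ) (u : E → ℝ) : Prop :=
  ∃ g : E → E, HasH1Gradient Ω u g ∧
    ∀ φ : E → ℝ, IsTestFunction Ω φ →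
      ∫ x in Ω, (inner ℝ (g x) (∇ φ x) + lam * u x * φ x) =
        ∫ x in Ω, |u x| ^ (p - 2) * u x * φ x

end Sobolev

/-- The annulus `T = {x ∈ ℝ^N : 1 < |x| < 2}`. -/
def annulus (N : ℕ) : Set (EuclideanSpace ℝ (Fin N)) :=
  {x | 1 < ‖x‖ ∧ ‖x‖ < 2}

/-- `u` is a positive solution, in `H¹_{0,rad}(T)`, of `-Δu + lam u = |u|^{p-2} u` in `T`,
`u = 0` on `∂T`. -/
structure IsPositiveRadialSolution (N : ℕ) (p lam : ℝ)
    (u : EuclideanSpace ℝ (Fin N) → ℝ) : Prop where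
  memH10 : MemH10 (annulus N) u
  radial : ∃ f : ℝ → ℝ, ∀ᵐ x ∂(volume.restrict (annulus N)), u x = f ‖x‖
  pos : ∀ᵐ x ∂(volume.restrict (annulus N)), 0 < u x
  weak : IsWeakSolution (annulus N) p lam u

/-- `U` is the continuous representative on `[1, 2]` of the radial function `u` on the annulus,
written as a function of `r = |x|`: the function `u(r)`. -/
def IsRadialProfile (N : ℕ) (u : EuclideanSpace ℝ (Fin N) → ℝ) (U : ℝ → ℝ) : Prop :=
  ContinuousOn U (Icc 1 2) ∧ ∀ᵐ x ∂(volume.restrict (annulus N)), u x = U ‖x‖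

/-- `ω(r) = lam^{1/(2-p)} U(r/√lam + rbar)` for `r ∈ (√lam (1 - rbar), √lam (2 - rbar))`,
extended by zero to `ℝ`. -/
noncomputable def rescaled (p lam rbar : ℝ) (U : ℝ → ℝ) : ℝ → ℝ :=
  (Ioo (√lam * (1 - rbar)) (√lam * (2 - rbar))).indicator
    (fun r => lam ^ (1 / (2 - p)) * U (r / √lam + rbar))

/-- `W` is a positive `C²` solution of `-W'' + W = W^{p-1}` on `ℝ` that vanishes at `±∞`. -/
structure IsDecayingPositiveSolution (p : ℝ) (W : ℝ → ℝ) : Prop where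
  contDiff : ContDiff ℝ 2 W
  pos : ∀ r, 0 < W r
  eqn : ∀ r, - deriv (deriv W) r + W r = W r ^ (p - 1)
  decay : Tendsto W (cocompact ℝ) (𝓝 0)

/-! The equation on the line is conservative: `W'^2/2 - W^2/2 + W^p/p` is constant, and decay forces
the constant to be `0`. Hence every decaying positive solution has height `(p/2)^{1/(p-2)}` at a
critical point, which fixes its Cauchy data there. Uniqueness for the Cauchy problem makes it a
translate of the explicit function `groundState p`.

For the convergence, the weak equation is first reduced to the radial equation `U'' + ((N-1)/r) U' =
lam U - U^{p-1}` on `(1, 2)`, with `U(1) = U(2) = 0` and `U > 0` inside. Read as mechanics, the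
first-order term is friction: the energy `U'^2/2 - lam U^2/2 + U^p/p` decreases in `r` and equals
`U'(2)^2/2` at the right end, so it is nonnegative throughout. Away from the maximum point, in
either direction, the rescaled profile is a `HalfBump`: it starts at rest, has nonnegative energy,
descends monotonically to `0`, and feels a damping of order `lam^{-1/2}` whose product with the
length stays at most `N - 1`.

The main point is the height. Rescale by the maximum `M`, so that the bump has height `1` and the
linear coefficient is `μ = lam / M^{p-2}`. Nonnegative energy at the top gives `μ ≤ 2/p`. If `μ`
were smaller than `2/p` by a fixed amount, the energy would stay positive and the trajectory would
reach `0` in bounded time on both sides (`HalfBump.exists_length_le`). The two sides together have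
length `κ = M^{(p-2)/2}`, which tends to infinity with `lam`. So `μ → 2/p`
(`IsRadialODESolution.exists_abs_height_le`), which says that `ω_n(0) → W(0)`.

With the scaling by `lam`, Gronwall then gives locally uniform convergence of the bump and of its
velocity (`exists_gronwall_groundState`). Uniform tail bounds upgrade this to `L²`: the speed is
bounded, which controls the tail of `w'^2` by the height at which the tail begins, and where `w` is
small nonnegative energy gives `|w'| ≥ w/2`, which controls the tail of `w^2`. Both are assembled in
`HalfBump.tendsto_groundState`. -/

/-! ### The explicit ground state: equation, decay, membership in `H¹` -/

/-- The explicit positive solution `(p/2)^{1/(p-2)} cosh(((p-2)/2) r)^{-2/(p-2)}` of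
`-W'' + W = W^{p-1}`. -/
noncomputable def groundState (p r : ℝ) : ℝ :=
  (p / 2) ^ (1 / (p - 2)) * Real.cosh ((p - 2) / 2 * r) ^ (-(2 / (p - 2)))

lemma groundState_pos {p : ℝ} (hp : 2 < p) (r : ℝ) : 0 < groundState p r := by
  have := Real.cosh_pos ((p - 2) / 2 * r)
  unfold groundState
  positivity

lemma groundState_zero (p : ℝ) : groundState p 0 = (p / 2) ^ (1 / (p - 2)) := by
  simp [groundState]

lemma groundState_neg (p r : ℝ) : groundState p (-r) = groundState p r := by
  simp [groundState]

/-- The exponent `-2/(p-2)` is chosen so that this power is `(p/2) sech²`. The nonlinearity thereby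
becomes polynomial in `tanh`, and checking the equation reduces to algebra. -/
lemma groundState_rpow {p : ℝ} (hp : 2 < p) (r : ℝ) :
    groundState p r ^ (p - 2) = p / 2 * (1 - Real.tanh ((p - 2) / 2 * r) ^ 2) := by
  have hc := Real.cosh_pos ((p - 2) / 2 * r)
  have h2 : p - 2 ≠ 0 := by linarith
  unfold groundState
  rw [Real.mul_rpow (by positivity) (by positivity), ← Real.rpow_mul (by positivity),
    ← Real.rpow_mul hc.le, one_div_mul_cancel h2, Real.rpow_one, neg_mul, div_mul_cancel₀ _ h2,
    Real.rpow_neg hc.le, Real.tanh_eq_sinh_div_cosh, Real.rpow_two, div_pow]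
  have := Real.cosh_sq ((p - 2) / 2 * r)
  rw [show (1:ℝ) - Real.sinh ((p - 2) / 2 * r) ^ 2 / Real.cosh ((p - 2) / 2 * r) ^ 2 =
    (Real.cosh ((p - 2) / 2 * r) ^ 2 - Real.sinh ((p - 2) / 2 * r) ^ 2) /
      Real.cosh ((p - 2) / 2 * r) ^ 2 by field_simp, this]
  simp

lemma groundState_hasDerivAt {p : ℝ} (hp : 2 < p) (r : ℝ) :
    HasDerivAt (groundState p) (-(groundState p r * Real.tanh ((p - 2) / 2 * r))) r := by
  have hc := Real.cosh_pos ((p - 2) / 2 * r)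
  have h2 : p - 2 ≠ 0 := by linarith
  have h1 : HasDerivAt (fun r => (p - 2) / 2 * r) ((p - 2) / 2) r := by
    simpa using (hasDerivAt_id r).const_mul ((p - 2) / 2)
  have := ((h1.cosh).rpow_const (p := -(2 / (p - 2))) (Or.inl hc.ne')).const_mul
    ((p / 2) ^ (1 / (p - 2)))
  refine this.congr_deriv ?_
  rw [Real.rpow_sub_one hc.ne', Real.tanh_eq_sinh_div_cosh, groundState]
  field_simp

lemma groundState_deriv_hasDerivAt {p : ℝ} (hp : 2 < p) (r : ℝ) :
    HasDerivAt (fun r => -(groundState p r * Real.tanh ((p - 2) / 2 * r)))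
      (groundState p r - groundState p r ^ (p - 1)) r := by
  have hc := Real.cosh_pos ((p - 2) / 2 * r)
  have hW := groundState_pos hp r
  have h1 : HasDerivAt (fun r => (p - 2) / 2 * r) ((p - 2) / 2) r := by
    simpa using (hasDerivAt_id r).const_mul ((p - 2) / 2)
  have h3 : HasDerivAt (fun r => Real.tanh ((p - 2) / 2 * r))
      ((p - 2) / 2 * (1 - Real.tanh ((p - 2) / 2 * r) ^ 2)) r := by
    have := h1.sinh.div h1.cosh hc.ne'
    simp_rw [Real.tanh_eq_sinh_div_cosh]
    refine this.congr_deriv ?_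
    field_simp
  refine ((groundState_hasDerivAt hp r).mul h3).neg.congr_deriv ?_
  rw [show p - 1 = (p - 2) + 1 by ring, Real.rpow_add_one hW.ne', groundState_rpow hp]
  ring

lemma groundState_continuous {p : ℝ} (hp : 2 < p) : Continuous (groundState p) :=
  continuous_iff_continuousAt.2 fun r => (groundState_hasDerivAt hp r).continuousAt

lemma deriv_groundState {p : ℝ} (hp : 2 < p) :
    deriv (groundState p) = fun r => -(groundState p r * Real.tanh ((p - 2) / 2 * r)) :=
  funext fun r => (groundState_hasDerivAt hp r).deriv

lemma continuous_deriv_groundState {p : ℝ} (hp : 2 < p) : Continuous (deriv (groundState p)) := by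
  rw [deriv_groundState hp]
  exact continuous_iff_continuousAt.2 fun r => (groundState_deriv_hasDerivAt hp r).continuousAt

lemma groundState_contDiff (p : ℝ) : ContDiff ℝ 2 (groundState p) := by
  have h1 : ContDiff ℝ 2 (fun r => Real.cosh ((p - 2) / 2 * r)) :=
    Real.contDiff_cosh.comp (contDiff_const.mul contDiff_id)
  exact contDiff_const.mul (h1.rpow_const_of_ne fun r => (Real.cosh_pos _).ne')

lemma abs_deriv_groundState_le {p : ℝ} (hp : 2 < p) (r : ℝ) :
    |deriv (groundState p) r| ≤ groundState p r := by
  rw [deriv_groundState hp, abs_neg, abs_mul, abs_of_pos (groundState_pos hp r)]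
  refine mul_le_of_le_one_right (groundState_pos hp r).le ?_
  exact (Real.abs_tanh_lt_one _).le

lemma groundState_le_apply_zero {p : ℝ} (hp : 2 < p) (r : ℝ) : groundState p r ≤ groundState p 0 := by
  rw [groundState_zero, groundState]
  refine mul_le_of_le_one_right (by positivity) ?_
  exact Real.rpow_le_one_of_one_le_of_nonpos (Real.one_le_cosh _)
    (by have : 0 < 2 / (p - 2) := div_pos two_pos (by linarith)
        linarith)

/-- From `cosh t ≥ e^{|t|}/2`: the factor `(p-2)/2` inside the hyperbolic cosine cancels against the
exponent, leaving decay rate exactly `1`. -/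
lemma groundState_le_exp {p : ℝ} (hp : 2 < p) (r : ℝ) :
    groundState p r ≤ groundState p 0 * 2 ^ (2 / (p - 2)) * Real.exp (-|r|) := by
  have h2 : 0 < p - 2 := by linarith
  have hm : 0 < 2 / (p - 2) := by positivity
  rw [groundState_zero, groundState, mul_assoc]
  gcongr
  have h : Real.exp ((p - 2) / 2 * |r|) / 2 ≤ Real.cosh ((p - 2) / 2 * r) := by
    rw [← Real.cosh_abs, abs_mul, abs_of_pos (show 0 < (p - 2) / 2 by positivity), Real.cosh_eq]
    have := Real.exp_pos (-((p - 2) / 2 * |r|))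
    linarith
  calc Real.cosh ((p - 2) / 2 * r) ^ (-(2 / (p - 2)))
      ≤ (Real.exp ((p - 2) / 2 * |r|) / 2) ^ (-(2 / (p - 2))) :=
        Real.rpow_le_rpow_of_nonpos (by positivity) h (by linarith)
    _ = _ := by
        rw [Real.div_rpow (by positivity) (by positivity), ← Real.exp_mul,
          Real.rpow_neg (by norm_num : (0:ℝ) ≤ 2), div_inv_eq_mul, mul_comm]
        congr 2
        field_simp

/-- An integrable majorant for the square, obtained from `e^{|r|} ≥ 1 + |r|`. -/
lemma groundState_sq_le {p : ℝ} (hp : 2 < p) (r : ℝ) :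
    groundState p r ^ 2 ≤ (groundState p 0 * 2 ^ (2 / (p - 2))) ^ 2 * (1 + r ^ 2)⁻¹ := by
  have h0 := groundState_pos hp r
  have h00 := groundState_pos hp 0
  calc groundState p r ^ 2 ≤ (groundState p 0 * 2 ^ (2 / (p - 2)) * Real.exp (-|r|)) ^ 2 := by
        gcongr
        exact groundState_le_exp hp r
    _ = (groundState p 0 * 2 ^ (2 / (p - 2))) ^ 2 * (Real.exp |r| ^ 2)⁻¹ := by
        rw [mul_pow, Real.exp_neg, inv_pow]
    _ ≤ _ := by
        gcongr
        have := Real.add_one_le_exp |r|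
        have h3 : (|r| + 1) ^ 2 ≤ Real.exp |r| ^ 2 := by gcongr
        nlinarith [abs_nonneg r, sq_abs r]

lemma groundState_tendsto {p : ℝ} (hp : 2 < p) :
    Tendsto (groundState p) (cocompact ℝ) (𝓝 0) := by
  have h : Tendsto (fun r : ℝ => groundState p 0 * 2 ^ (2 / (p - 2)) * Real.exp (-|r|))
      (cocompact ℝ) (𝓝 (groundState p 0 * 2 ^ (2 / (p - 2)) * 0)) := by
    refine Tendsto.const_mul _ (Real.tendsto_exp_neg_atTop_nhds_zero.comp ?_)
    exact tendsto_norm_cocompact_atTop (E := ℝ)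
  rw [mul_zero] at h
  exact squeeze_zero (fun r => (groundState_pos hp r).le) (groundState_le_exp hp) h

lemma groundState_memLp {p : ℝ} (hp : 2 < p) : MemLp (groundState p) 2 volume := by
  refine (memLp_two_iff_integrable_sq (groundState_continuous hp).aestronglyMeasurable).2 ?_
  refine Integrable.mono' (integrable_inv_one_add_sq.const_mul
    ((groundState p 0 * 2 ^ (2 / (p - 2))) ^ 2))
    ((groundState_continuous hp).pow 2).aestronglyMeasurable (ae_of_all _ fun r => ?_)
  rw [Real.norm_eq_abs, abs_of_nonneg (sq_nonneg _)]
  exact groundState_sq_le hp r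

lemma deriv_groundState_memLp {p : ℝ} (hp : 2 < p) : MemLp (deriv (groundState p)) 2 volume :=
  (groundState_memLp hp).mono (continuous_deriv_groundState hp).aestronglyMeasurable
    (ae_of_all _ fun r => by
      rw [Real.norm_eq_abs, Real.norm_eq_abs, abs_of_pos (groundState_pos hp r)]
      exact abs_deriv_groundState_le hp r)

lemma groundState_isDecayingPositiveSolution {p : ℝ} (hp : 2 < p) :
    IsDecayingPositiveSolution p (groundState p) where
  contDiff := groundState_contDiff p
  pos := groundState_pos hp
  eqn r := by
    rw [deriv_groundState hp, (groundState_deriv_hasDerivAt hp r).deriv]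
    ring
  decay := groundState_tendsto hp

/-- A `C¹` function on `ℝ` that is square integrable together with its derivative has the
derivative as weak gradient. -/
lemma hasH1Gradient_univ_of_hasDerivAt {u u' : ℝ → ℝ} (hu : ∀ x, HasDerivAt u (u' x) x)
    (hu' : Continuous u') (h : MemLp u 2 volume) (h' : MemLp u' 2 volume) :
    HasH1Gradient (univ : Set ℝ) u u' where
  memLp := by simpa using h
  memLp_grad := by simpa using h'
  integral_eq φ hφ := by
    obtain ⟨h1, h2, -⟩ := hφ
    have hd : Differentiable ℝ φ := h1.differentiable (by simp)
    have hcu : Continuous u := continuous_iff_continuousAt.2 fun x => (hu x).continuousAt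
    have hcd : Continuous (deriv φ) := h1.continuous_deriv (by simp)
    simp only [Measure.restrict_univ, gradient_eq_deriv', smul_eq_mul]
    rw [integral_mul_deriv_eq_deriv_mul_of_integrable (fun x _ => hu x)
      (fun x _ => (hd x).hasDerivAt)]
    · simp_rw [mul_comm]
    · exact (hcu.mul hcd).integrable_of_hasCompactSupport h2.deriv.mul_left
    · exact (hu'.mul h1.continuous).integrable_of_hasCompactSupport h2.mul_left
    · exact (hcu.mul h1.continuous).integrable_of_hasCompactSupport h2.mul_left

lemma groundState_hasH1Gradient {p : ℝ} (hp : 2 < p) :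
    HasH1Gradient (univ : Set ℝ) (groundState p) (deriv (groundState p)) :=
  hasH1Gradient_univ_of_hasDerivAt
    (fun x => by rw [deriv_groundState hp]; exact groundState_hasDerivAt hp x)
    (continuous_deriv_groundState hp) (groundState_memLp hp) (deriv_groundState_memLp hp)

/-! ### Stability of the ground state and classification of decaying solutions on the line -/

lemma abs_rpow_sub_rpow_le {q B x y : ℝ} (hq : 1 ≤ q) (hx : x ∈ Icc 0 B) (hy : y ∈ Icc 0 B) :
    |x ^ q - y ^ q| ≤ q * B ^ (q - 1) * |x - y| := by
  have := (convex_Icc (0:ℝ) B).norm_image_sub_le_of_norm_hasDerivWithin_le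
    (f := fun x : ℝ => x ^ q) (f' := fun x => q * x ^ (q - 1)) (C := q * B ^ (q - 1)) (x := y) (y := x)
    (fun x _ => (Real.hasDerivAt_rpow_const (Or.inr hq)).hasDerivWithinAt)
    (fun x hx => by
      rw [Real.norm_eq_abs, abs_of_nonneg (mul_nonneg (by linarith) (Real.rpow_nonneg hx.1 _))]
      exact mul_le_mul_of_nonneg_left (Real.rpow_le_rpow hx.1 hx.2 (by linarith)) (by linarith)) hy hx
  simpa [Real.norm_eq_abs] using this

/-- Approximate solutions of `w'' = w - w^{p-1}` that start near the summit of the ground state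
stay near it on bounded intervals. -/
lemma exists_gronwall_groundState {p : ℝ} (hp : 2 < p) {B : ℝ} (hB : groundState p 0 ≤ B) (R : ℝ) :
    ∃ C, 0 < C ∧ ∀ (b ε : ℝ) (w w₁ f : ℝ → ℝ), b ≤ R → 0 ≤ ε →
      ContinuousOn w (Icc 0 b) → ContinuousOn w₁ (Icc 0 b) →
      (∀ s ∈ Ico 0 b, HasDerivAt w (w₁ s) s) → (∀ s ∈ Ico 0 b, HasDerivAt w₁ (f s) s) →
      (∀ s ∈ Ico 0 b, |f s - (w s - w s ^ (p - 1))| ≤ ε) →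
      (∀ s ∈ Ico 0 b, w s ∈ Icc 0 B) → |w 0 - groundState p 0| ≤ ε → w₁ 0 = 0 →
      ∀ s ∈ Icc 0 b, |w s - groundState p s| ≤ C * ε ∧
        |w₁ s - deriv (groundState p) s| ≤ C * ε := by
  have hB0 : 0 < B := (groundState_pos hp 0).trans_le hB
  -- Lipschitz constant, in the sup norm on phase space, of the field `(x, y) ↦ (y, x - x^{p-1})`
  -- over `0 ≤ x ≤ B`: the power contributes `(p-1) B^{p-2}`, the linear term `1`.
  set K : ℝ := 1 + (p - 1) * B ^ (p - 2) with hK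
  have hKpos : 0 < K := by
    have : 0 ≤ (p - 1) * B ^ (p - 2) := mul_nonneg (by linarith) (by positivity)
    linarith
  have hK1 : 1 ≤ K := by
    have : 0 ≤ (p - 1) * B ^ (p - 2) := mul_nonneg (by linarith) (by positivity)
    linarith
  -- The two terms of the Gronwall bound at time `|R|`: one for the initial error `ε`, one for the
  -- defect `ε` in the equation.
  refine ⟨Real.exp (K * |R|) + 1 / K * Real.exp (K * |R|), by positivity, ?_⟩
  intro b ε w w₁ f hbR hε hw hw₁ hd hd₁ hf hwB h0 h1 s hs
  have key := dist_le_of_approx_trajectories_ODE_of_mem (E := ℝ × ℝ)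
    (v := fun _ y => (y.2, y.1 - y.1 ^ (p - 1))) (s := fun _ => Icc 0 B ×ˢ univ)
    (K := ⟨K, hKpos.le⟩) (f := fun s => (w s, w₁ s)) (f' := fun s => (w₁ s, f s))
    (g := fun s => (groundState p s, deriv (groundState p) s))
    (g' := fun s => (deriv (groundState p) s, groundState p s - groundState p s ^ (p - 1)))
    (a := 0) (b := b) (εf := ε) (εg := 0) (δ := ε) ?_ (hw.prodMk hw₁) ?_ ?_ ?_ ?_ ?_ ?_ ?_ ?_ s hs
  · have hbd : gronwallBound ε K (ε + 0) (s - 0) ≤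
        (Real.exp (K * |R|) + 1 / K * Real.exp (K * |R|)) * ε := by
      rw [gronwallBound_of_K_ne_0 hKpos.ne']
      have hsR : s - 0 ≤ |R| := by have := le_abs_self R; linarith [hs.2]
      have he : Real.exp (K * (s - 0)) ≤ Real.exp (K * |R|) := by gcongr
      have : ε / K * (Real.exp (K * (s - 0)) - 1) ≤ ε / K * Real.exp (K * |R|) := by
        gcongr; linarith
      have h3 : ε * Real.exp (K * (s - 0)) ≤ ε * Real.exp (K * |R|) := by gcongr
      simp only [add_zero]
      calc _ ≤ ε * Real.exp (K * |R|) + ε / K * Real.exp (K * |R|) := add_le_add h3 this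
        _ = _ := by ring
    have := key.trans hbd
    rw [Prod.dist_eq, max_le_iff, Real.dist_eq, Real.dist_eq] at this
    exact this
  · intro t _
    refine LipschitzOnWith.of_dist_le_mul fun x hx y hy => ?_
    rw [Prod.dist_eq, Prod.dist_eq]
    simp only [Real.dist_eq]
    have hx1 := hx.1
    have hy1 := hy.1
    have ha : |x.1 - y.1| ≤ max |x.1 - y.1| |x.2 - y.2| := le_max_left _ _
    have hb : |x.2 - y.2| ≤ max |x.1 - y.1| |x.2 - y.2| := le_max_right _ _
    refine max_le (hb.trans (le_mul_of_one_le_left (by positivity) hK1)) ?_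
    have h2 := abs_rpow_sub_rpow_le (q := p - 1) (by linarith) hx1 hy1
    rw [show p - 1 - 1 = p - 2 by ring] at h2
    have h3 : |x.1 - x.1 ^ (p - 1) - (y.1 - y.1 ^ (p - 1))| ≤ K * |x.1 - y.1| := by
      rw [show x.1 - x.1 ^ (p - 1) - (y.1 - y.1 ^ (p - 1)) =
        (x.1 - y.1) - (x.1 ^ (p - 1) - y.1 ^ (p - 1)) by ring]
      refine (abs_sub _ _).trans ?_
      rw [hK]
      linarith
    exact h3.trans (mul_le_mul_of_nonneg_left ha hKpos.le)
  · exact fun t ht => ((hd t ht).prodMk (hd₁ t ht)).hasDerivWithinAt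
  · intro t ht
    rw [Prod.dist_eq]
    simp only [dist_self, Real.dist_eq]
    exact max_le hε (hf t ht)
  · exact fun t ht => ⟨hwB t ht, mem_univ _⟩
  · exact ((groundState_continuous hp).prodMk (continuous_deriv_groundState hp)).continuousOn
  · intro t ht
    have h1 := groundState_hasDerivAt hp t
    have h2 := groundState_deriv_hasDerivAt hp t
    rw [← deriv_groundState hp] at h2
    exact (h1.differentiableAt.hasDerivAt.prodMk h2).hasDerivWithinAt
  · intro t ht
    simp
  · exact fun t ht => ⟨⟨(groundState_pos hp t).le, (groundState_le_apply_zero hp t).trans hB⟩, mem_univ _⟩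
  · rw [Prod.dist_eq, Real.dist_eq, Real.dist_eq]
    refine max_le h0 ?_
    simp [h1, deriv_groundState hp, hε]

namespace IsDecayingPositiveSolution

variable {p : ℝ} {V : ℝ → ℝ}

lemma hasDerivAt (hV : IsDecayingPositiveSolution p V) (r : ℝ) : HasDerivAt V (deriv V r) r :=
  ((hV.contDiff.differentiable (by norm_num)) r).hasDerivAt

lemma hasDerivAt_deriv (hV : IsDecayingPositiveSolution p V) (r : ℝ) :
    HasDerivAt (deriv V) (V r - V r ^ (p - 1)) r := by
  have h : ContDiff ℝ 1 (deriv V) := by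
    have := hV.contDiff
    rw [show (2 : WithTop ℕ∞) = 1 + 1 by norm_num, contDiff_succ_iff_deriv] at this
    exact this.2.2
  have h2 := ((h.differentiable (by norm_num)) r).hasDerivAt
  refine h2.congr_deriv ?_
  linarith [hV.eqn r]

/-- The conserved energy of a decaying solution vanishes. -/
lemma energy_eq_zero (hp : 2 < p) (hV : IsDecayingPositiveSolution p V) (r : ℝ) :
    deriv V r ^ 2 / 2 - V r ^ 2 / 2 + V r ^ p / p = 0 := by
  set E : ℝ → ℝ := fun r => deriv V r ^ 2 / 2 - V r ^ 2 / 2 + V r ^ p / p with hE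
  have hder : ∀ r, HasDerivAt E 0 r := by
    intro r
    have h1 := hV.hasDerivAt r
    have h2 := hV.hasDerivAt_deriv r
    refine ((((h2.pow 2).div_const 2).sub ((h1.pow 2).div_const 2)).add
      ((h1.rpow_const (p := p) (Or.inr (by linarith))).div_const p)).congr_deriv ?_
    have : p ≠ 0 := by linarith
    field_simp
    ring
  have hconst : ∀ x, E x = E r := fun x =>
    is_const_of_deriv_eq_zero (fun x => (hder x).differentiableAt) (fun x => (hder x).deriv) x r
  -- Decay is assumed for `V` only. The mean value theorem on `[n, n+1]` yields points tending to
  -- infinity along which `V'` tends to `0` as well, and this suffices to evaluate the constant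
  -- energy.
  have hmvt : ∀ n : ℕ, ∃ c ∈ Ioo (n : ℝ) (n + 1), deriv V c = V (n + 1) - V n := by
    intro n
    obtain ⟨c, hc, h⟩ := exists_hasDerivAt_eq_slope V (deriv V) (show (n : ℝ) < n + 1 by linarith)
      (fun x _ => (hV.hasDerivAt x).continuousAt.continuousWithinAt) (fun x _ => hV.hasDerivAt x)
    exact ⟨c, hc, by simpa using h⟩
  choose c hc hcd using hmvt
  have hVtop : Tendsto V atTop (𝓝 0) := hV.decay.mono_left atTop_le_cocompact
  have hn : Tendsto (fun n : ℕ => (n : ℝ)) atTop atTop := tendsto_natCast_atTop_atTop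
  have hctop : Tendsto c atTop atTop := tendsto_atTop_mono (fun n => (hc n).1.le) hn
  have hVc : Tendsto (fun n => V (c n)) atTop (𝓝 0) := hVtop.comp hctop
  have hd : Tendsto (fun n => deriv V (c n)) atTop (𝓝 0) := by
    simp_rw [hcd]
    simpa using (hVtop.comp (tendsto_atTop_add_const_right _ (1:ℝ) hn)).sub (hVtop.comp hn)
  have hlim : Tendsto (fun n => E (c n)) atTop (𝓝 (0 ^ 2 / 2 - 0 ^ 2 / 2 + 0 ^ p / p)) := by
    refine (((hd.pow 2).div_const 2).sub ((hVc.pow 2).div_const 2)).add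
      ((hVc.rpow_const (Or.inr (by linarith))).div_const p)
  rw [Real.zero_rpow (by linarith)] at hlim
  simp_rw [hconst] at hlim
  simpa using tendsto_nhds_unique tendsto_const_nhds hlim

/-- At a critical point a decaying positive solution has the height of the ground state. -/
lemma eq_groundState_zero (hp : 2 < p) (hV : IsDecayingPositiveSolution p V) {a : ℝ}
    (ha : deriv V a = 0) : V a = groundState p 0 := by
  have h := hV.energy_eq_zero hp a
  have hpos := hV.pos a
  have hp0 : (p : ℝ) ≠ 0 := by linarith
  rw [ha, show p = (p - 2) + 2 by ring, Real.rpow_add hpos, Real.rpow_two] at h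
  have h2 : V a ^ (p - 2) = p / 2 := by
    have : V a ^ 2 ≠ 0 := by positivity
    field_simp at h
    simp only [sub_add_cancel] at h
    have h3 : V a ^ 2 * (2 * V a ^ (p - 2) - p) = 0 := by
      field_simp at h
      linarith
    rcases mul_eq_zero.1 h3 with h4 | h4
    · exact absurd h4 this
    · linarith
  rw [groundState_zero, ← h2, ← Real.rpow_mul hpos.le, mul_one_div_cancel (by linarith),
    Real.rpow_one]

/-- A decaying positive solution is the translate of the ground state to any critical point. -/
lemma eq_groundState_sub (hp : 2 < p) (hV : IsDecayingPositiveSolution p V) {a : ℝ}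
    (ha : deriv V a = 0) (r : ℝ) : V r = groundState p (r - a) := by
  have hVa := hV.eq_groundState_zero hp ha
  have hcont : Continuous V := hV.contDiff.continuous
  have hcont' : Continuous (deriv V) :=
    continuous_iff_continuousAt.2 fun r => (hV.hasDerivAt_deriv r).continuousAt
  obtain ⟨B, hB⟩ : ∃ B, ∀ x ∈ Icc (a - |r - a|) (a + |r - a|), V x ≤ B := by
    obtain ⟨B, hB⟩ := (isCompact_Icc.image hcont).bddAbove
    exact ⟨B, fun x hx => hB (mem_image_of_mem _ hx)⟩
  set B' := max B (groundState p 0)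
  -- The stability estimate with error `0` is uniqueness for the Cauchy problem. It is stated
  -- forward in time, so the left side of `a` is handled through the reflected trajectory `s ↦ V (a
  -- - s)`.
  obtain ⟨C, -, hC⟩ := exists_gronwall_groundState hp (le_max_right B (groundState p 0)) |r - a|
  have hright : V (a + |r - a|) = groundState p |r - a| := by
    have h := hC |r - a| 0 (fun s => V (a + s)) (fun s => deriv V (a + s))
      (fun s => V (a + s) - V (a + s) ^ (p - 1)) le_rfl le_rfl
      (by fun_prop) (by fun_prop)
      (fun s _ => by simpa using (hV.hasDerivAt (a + s)).comp_const_add a s)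
      (fun s _ => by simpa using (hV.hasDerivAt_deriv (a + s)).comp_const_add a s)
      (by simp) (fun s hs => ⟨(hV.pos _).le, (hB _ ⟨by linarith [hs.1, abs_nonneg (r - a)],
        by linarith [hs.2]⟩).trans (le_max_left _ _)⟩) (by simp [hVa]) (by simp [ha])
      |r - a| (right_mem_Icc.2 (abs_nonneg _))
    have := abs_nonpos_iff.1 (h.1.trans_eq (mul_zero C))
    linarith
  have hleft : V (a - |r - a|) = groundState p |r - a| := by
    have h := hC |r - a| 0 (fun s => V (a - s)) (fun s => -deriv V (a - s))
      (fun s => V (a - s) - V (a - s) ^ (p - 1)) le_rfl le_rfl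
      (by fun_prop) (by fun_prop)
      (fun s _ => by simpa using (hV.hasDerivAt (a - s)).comp_const_sub a s)
      (fun s _ => ((hV.hasDerivAt_deriv (a - s)).comp_const_sub a s).neg.congr_deriv (neg_neg _))
      (by simp) (fun s hs => ⟨(hV.pos _).le, (hB _ ⟨by linarith [hs.2],
        by linarith [hs.1, abs_nonneg (r - a)]⟩).trans (le_max_left _ _)⟩) (by simp [hVa])
      (by simp [ha]) |r - a| (right_mem_Icc.2 (abs_nonneg _))
    have := abs_nonpos_iff.1 (h.1.trans_eq (mul_zero C))
    linarith
  rcases abs_cases (r - a) with ⟨h, -⟩ | ⟨h, -⟩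
  · rw [h] at hright
    rw [← hright]
    ring_nf
  · rw [h, groundState_neg] at hleft
    rw [← hleft]
    ring_nf

lemma exists_deriv_eq_zero (hV : IsDecayingPositiveSolution p V) : ∃ a, deriv V a = 0 := by
  obtain ⟨a, ha⟩ := hV.contDiff.continuous.exists_forall_ge' 0
    (hV.decay.eventually_le_const (hV.pos 0))
  exact ⟨a, IsLocalMax.deriv_eq_zero (Eventually.of_forall ha)⟩

end IsDecayingPositiveSolution

/-! ### Half bumps: damped descent from a maximum to zero -/

lemma antitoneOn_Icc_of_hasDerivAt {f f' : ℝ → ℝ} {a b : ℝ} (hf : ContinuousOn f (Icc a b))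
    (h : ∀ x ∈ Ioo a b, HasDerivAt f (f' x) x) (h' : ∀ x ∈ Ioo a b, f' x ≤ 0) :
    AntitoneOn f (Icc a b) := by
  refine antitoneOn_of_deriv_nonpos (convex_Icc a b) hf ?_ ?_ <;> rw [interior_Icc]
  · exact fun x hx => (h x hx).differentiableAt.differentiableWithinAt
  · exact fun x hx => by rw [(h x hx).deriv]; exact h' x hx

lemma monotoneOn_Icc_of_hasDerivAt {f f' : ℝ → ℝ} {a b : ℝ} (hf : ContinuousOn f (Icc a b))
    (h : ∀ x ∈ Ioo a b, HasDerivAt f (f' x) x) (h' : ∀ x ∈ Ioo a b, 0 ≤ f' x) :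
    MonotoneOn f (Icc a b) := by
  refine monotoneOn_of_deriv_nonneg (convex_Icc a b) hf ?_ ?_ <;> rw [interior_Icc]
  · exact fun x hx => (h x hx).differentiableAt.differentiableWithinAt
  · exact fun x hx => by rw [(h x hx).deriv]; exact h' x hx

/-- The mechanical energy of a trajectory of `w'' = μ w - w^{p-1}` at position `x` and
velocity `y`. -/
noncomputable def energy (p μ x y : ℝ) : ℝ := y ^ 2 / 2 - μ * x ^ 2 / 2 + x ^ p / p

lemma hasDerivAt_energy {p μ m k s : ℝ} {w w₁ : ℝ → ℝ} (hp : 2 < p) (hw : HasDerivAt w m s)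
    (hw₁ : HasDerivAt w₁ k s) :
    HasDerivAt (fun s => energy p μ (w s) (w₁ s))
      (w₁ s * k - μ * w s * m + w s ^ (p - 1) * m) s := by
  unfold energy
  refine ((((hw₁.pow 2).div_const 2).sub (((hw.pow 2).const_mul μ).div_const 2)).add
    ((hw.rpow_const (p := p) (Or.inr (by linarith))).div_const p)).congr_deriv ?_
  have : p ≠ 0 := by linarith
  field_simp
  ring

lemma continuousOn_energy {p μ : ℝ} {w w₁ : ℝ → ℝ} {t : Set ℝ} (hp : 2 < p)
    (hw : ContinuousOn w t) (hw₁ : ContinuousOn w₁ t) :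
    ContinuousOn (fun s => energy p μ (w s) (w₁ s)) t :=
  (((hw₁.pow 2).div_const 2).sub (((continuousOn_const).mul (hw.pow 2)).div_const 2)).add
    ((hw.rpow_const fun _ _ => Or.inr (by linarith)).div_const p)

lemma rpow_eq_rpow_sub_two_mul_sq {p x : ℝ} (hx : 0 < x) : x ^ p = x ^ (p - 2) * x ^ 2 := by
  rw [← Real.rpow_two, ← Real.rpow_add hx]
  ring_nf

lemma rpow_sub_one_eq_rpow_sub_two_mul {p x : ℝ} (hx : 0 < x) :
    x ^ (p - 1) = x ^ (p - 2) * x := by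
  rw [← Real.rpow_add_one hx.ne']
  ring_nf

/-- `w` runs on `[0, b]` from a maximum at `0` down to `0`, with velocity `w₁`, subject to
`w'' = μ w - w^{p-1} + d w'` with `|d| ≤ ε`, and has nonnegative energy. -/
structure HalfBump (p μ ε b : ℝ) (w w₁ d : ℝ → ℝ) : Prop where
  two_lt : 2 < p
  mu_pos : 0 < μ
  length_pos : 0 < b
  continuousOn : ContinuousOn w (Icc 0 b)
  continuousOn_vel : ContinuousOn w₁ (Icc 0 b)
  hasDerivAt : ∀ s ∈ Ico 0 b, HasDerivAt w (w₁ s) s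
  hasDerivAt_vel : ∀ s ∈ Ico 0 b, HasDerivAt w₁ (μ * w s - w s ^ (p - 1) + d s * w₁ s) s
  abs_damping_le : ∀ s ∈ Ico 0 b, |d s| ≤ ε
  vel_zero : w₁ 0 = 0
  end_eq_zero : w b = 0
  pos : ∀ s ∈ Ico 0 b, 0 < w s
  energy_nonneg : ∀ s ∈ Ico 0 b, 0 ≤ energy p μ (w s) (w₁ s)

namespace HalfBump

variable {p μ ε b : ℝ} {w w₁ d : ℝ → ℝ}

lemma eps_nonneg (h : HalfBump p μ ε b w w₁ d) : 0 ≤ ε :=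
  (abs_nonneg _).trans (h.abs_damping_le 0 (left_mem_Ico.2 h.length_pos))

lemma zero_pos (h : HalfBump p μ ε b w w₁ d) : 0 < w 0 := h.pos 0 (left_mem_Ico.2 h.length_pos)

lemma nonneg (h : HalfBump p μ ε b w w₁ d) {s : ℝ} (hs : s ∈ Icc 0 b) : 0 ≤ w s := by
  rcases hs.2.eq_or_lt with rfl | h'
  · exact h.end_eq_zero.ge
  · exact (h.pos s ⟨hs.1, h'⟩).le

/-- At zero velocity the energy is `w^2 (w^{p-2}/p - μ/2)`, so its sign bounds the height from
below. -/
lemma mu_le_of_vel_eq_zero (h : HalfBump p μ ε b w w₁ d) {s : ℝ} (hs : s ∈ Ico 0 b)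
    (h0 : w₁ s = 0) : p / 2 * μ ≤ w s ^ (p - 2) := by
  have hE := h.energy_nonneg s hs
  have hw := h.pos s hs
  have hp := h.two_lt
  rw [energy, h0, rpow_eq_rpow_sub_two_mul_sq hw] at hE
  have h1 : 0 ≤ w s ^ 2 * (w s ^ (p - 2) / p - μ / 2) := by
    linear_combination hE
  have h2 := nonneg_of_mul_nonneg_right h1 (by positivity)
  have h3 : μ / 2 ≤ w s ^ (p - 2) / p := by linarith
  rw [le_div_iff₀ (by linarith)] at h3
  linarith

/-- At rest the damping drops out, and `w^{p-2} ≥ (p/2) μ > μ` makes the nonlinear term dominate. -/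
lemma acc_neg_of_vel_eq_zero (h : HalfBump p μ ε b w w₁ d) {s : ℝ} (hs : s ∈ Ico 0 b)
    (h0 : w₁ s = 0) : μ * w s - w s ^ (p - 1) + d s * w₁ s < 0 := by
  have h1 := h.mu_le_of_vel_eq_zero hs h0
  have hw := h.pos s hs
  have hp := h.two_lt
  have hμ := h.mu_pos
  rw [h0, rpow_sub_one_eq_rpow_sub_two_mul hw]
  have : μ < w s ^ (p - 2) := by nlinarith
  nlinarith

/-- A barrier argument: the velocity starts at `0` and has strictly negative derivative whenever it
vanishes, so it cannot cross to positive values. -/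
lemma vel_nonpos (h : HalfBump p μ ε b w w₁ d) {s : ℝ} (hs : s ∈ Icc 0 b) : w₁ s ≤ 0 :=
  image_le_of_deriv_right_lt_deriv_boundary (B := fun _ => 0) (B' := fun _ => 0) h.continuousOn_vel
    (fun x hx => (h.hasDerivAt_vel x hx).hasDerivWithinAt) h.vel_zero.le
    (fun _ => hasDerivAt_const _ _) (fun _ hx hx0 => h.acc_neg_of_vel_eq_zero hx hx0) hs

lemma antitoneOn (h : HalfBump p μ ε b w w₁ d) : AntitoneOn w (Icc 0 b) :=
  antitoneOn_Icc_of_hasDerivAt h.continuousOn (fun x hx => h.hasDerivAt x (Ioo_subset_Ico_self hx))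
    fun _ hx => h.vel_nonpos (Ioo_subset_Icc_self hx)

lemma le_apply_zero (h : HalfBump p μ ε b w w₁ d) {s : ℝ} (hs : s ∈ Icc 0 b) : w s ≤ w 0 :=
  h.antitoneOn (left_mem_Icc.2 h.length_pos.le) hs hs.1

lemma hasDerivAt_energy (h : HalfBump p μ ε b w w₁ d) {s : ℝ} (hs : s ∈ Ico 0 b) :
    HasDerivAt (fun s => energy p μ (w s) (w₁ s)) (d s * w₁ s ^ 2) s :=
  (_root_.hasDerivAt_energy h.two_lt (h.hasDerivAt s hs) (h.hasDerivAt_vel s hs)).congr_deriv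
    (by ring)

lemma continuousOn_energy (h : HalfBump p μ ε b w w₁ d) :
    ContinuousOn (fun s => energy p μ (w s) (w₁ s)) (Icc 0 b) :=
  _root_.continuousOn_energy h.two_lt h.continuousOn h.continuousOn_vel

lemma sq_vel_le_energy (h : HalfBump p μ ε b w w₁ d) {s : ℝ} (hs : s ∈ Icc 0 b) :
    w₁ s ^ 2 ≤ 2 * (energy p μ (w s) (w₁ s) + μ * w 0 ^ 2 / 2) := by
  have h1 : w s ^ 2 ≤ w 0 ^ 2 := pow_le_pow_left₀ (h.nonneg hs) (h.le_apply_zero hs) 2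
  have h2 : 0 ≤ w s ^ p / p :=
    div_nonneg (Real.rpow_nonneg (h.nonneg hs) _) (by linarith [h.two_lt])
  have h3 := mul_le_mul_of_nonneg_left h1 h.mu_pos.le
  unfold energy
  linarith

/-- A bound for the speed. -/
lemma sq_vel_le (h : HalfBump p μ ε b w w₁ d) {s : ℝ} (hs : s ∈ Icc 0 b) :
    w₁ s ^ 2 ≤ 2 / p * w 0 ^ p * Real.exp (2 * (ε * b)) := by
  -- The shifted energy `E + μ w(0)^2/2` dominates `w'^2/2`, while `E' = d w'^2 ≤ ε w'^2`. It
  -- therefore grows at rate at most `2ε`, and the exponential weight makes it nonincreasing.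
  set F : ℝ → ℝ := fun s => (energy p μ (w s) (w₁ s) + μ * w 0 ^ 2 / 2) * Real.exp (-(2 * ε) * s)
  have hF : AntitoneOn F (Icc 0 b) := by
    refine antitoneOn_Icc_of_hasDerivAt (f' := fun s =>
      (d s * w₁ s ^ 2 - 2 * ε * (energy p μ (w s) (w₁ s) + μ * w 0 ^ 2 / 2)) *
        Real.exp (-(2 * ε) * s)) ?_ ?_ ?_
    · exact (h.continuousOn_energy.add continuousOn_const).mul (by fun_prop)
    · intro s hs
      have h1 := (h.hasDerivAt_energy (Ioo_subset_Ico_self hs)).add_const (μ * w 0 ^ 2 / 2)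
      have h2 : HasDerivAt (fun s : ℝ => Real.exp (-(2 * ε) * s))
          (Real.exp (-(2 * ε) * s) * (-(2 * ε))) s := by
        simpa using ((hasDerivAt_id s).const_mul (-(2 * ε))).exp
      refine (h1.mul h2).congr_deriv ?_
      ring
    · intro s hs
      have h1 := (abs_le.1 (h.abs_damping_le s (Ioo_subset_Ico_self hs))).2
      have h2 := h.sq_vel_le_energy (Ioo_subset_Icc_self hs)
      have h3 := mul_le_mul_of_nonneg_left h2 h.eps_nonneg
      have h4 := mul_le_mul_of_nonneg_right h1 (sq_nonneg (w₁ s))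
      exact mul_nonpos_of_nonpos_of_nonneg (by linarith) (Real.exp_pos _).le
  have h0 := hF (left_mem_Icc.2 h.length_pos.le) hs hs.1
  have hF0 : F 0 = w 0 ^ p / p := by
    simp only [F, energy, h.vel_zero]
    simp
  have hle := h.sq_vel_le_energy hs
  have hFs : energy p μ (w s) (w₁ s) + μ * w 0 ^ 2 / 2 = F s * Real.exp (2 * ε * s) := by
    simp only [F]
    rw [mul_assoc, ← Real.exp_add]
    ring_nf
    simp
  rw [hFs] at hle
  have he : Real.exp (2 * ε * s) ≤ Real.exp (2 * (ε * b)) := by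
    have := mul_le_mul_of_nonneg_left hs.2 h.eps_nonneg
    exact Real.exp_le_exp.2 (by linarith)
  have hw0 := h.zero_pos
  have hp : 0 < p := by linarith [h.two_lt]
  have h5 : F s * Real.exp (2 * ε * s) ≤ w 0 ^ p / p * Real.exp (2 * (ε * b)) := by
    rw [← hF0]
    refine mul_le_mul h0 he (Real.exp_pos _).le ?_
    rw [hF0]
    positivity
  calc _ ≤ _ := hle
    _ ≤ 2 * (w 0 ^ p / p * Real.exp (2 * (ε * b))) := by linarith
    _ = _ := by ring

lemma abs_vel_le (h : HalfBump p μ ε b w w₁ d) {S : ℝ} (hS : 0 ≤ S)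
    (hS' : 2 / p * w 0 ^ p * Real.exp (2 * (ε * b)) ≤ S ^ 2) {s : ℝ} (hs : s ∈ Icc 0 b) :
    |w₁ s| ≤ S :=
  abs_le_of_sq_le_sq ((h.sq_vel_le hs).trans hS') hS

/-- The energy changes at rate at most `ε w'^2 ≤ ε S |w'|`, and the total variation of the monotone
`w` is at most `w 0`. Given `S`, the drift bound thus does not grow with the length `b`. -/
lemma abs_energy_sub_le (h : HalfBump p μ ε b w w₁ d) {S : ℝ} (hS : 0 ≤ S)
    (hS' : 2 / p * w 0 ^ p * Real.exp (2 * (ε * b)) ≤ S ^ 2) {s : ℝ} (hs : s ∈ Icc 0 b) :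
    |energy p μ (w s) (w₁ s) - energy p μ (w 0) (w₁ 0)| ≤ ε * S * w 0 := by
  have hbd : ∀ s ∈ Ioo 0 b, |d s * w₁ s ^ 2| ≤ -(ε * S * w₁ s) := by
    intro s hs
    have h1 := h.abs_damping_le s (Ioo_subset_Ico_self hs)
    have h2 := h.abs_vel_le hS hS' (Ioo_subset_Icc_self hs)
    have h3 := h.vel_nonpos (Ioo_subset_Icc_self hs)
    rw [abs_of_nonpos h3] at h2
    rw [abs_mul, abs_of_nonneg (sq_nonneg (w₁ s))]
    have h4 : w₁ s ^ 2 ≤ S * (-w₁ s) := by nlinarith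
    calc _ ≤ ε * (S * (-w₁ s)) := mul_le_mul h1 h4 (sq_nonneg _) h.eps_nonneg
      _ = _ := by ring
  have h1 : AntitoneOn (fun s => energy p μ (w s) (w₁ s) + ε * S * w s) (Icc 0 b) :=
    antitoneOn_Icc_of_hasDerivAt
      (h.continuousOn_energy.add (continuousOn_const.mul h.continuousOn))
      (fun s hs => (h.hasDerivAt_energy (Ioo_subset_Ico_self hs)).add
        ((h.hasDerivAt s (Ioo_subset_Ico_self hs)).const_mul (ε * S)))
      (fun s hs => by linarith [(abs_le.1 (hbd s hs)).2])
  have h2 : MonotoneOn (fun s => energy p μ (w s) (w₁ s) - ε * S * w s) (Icc 0 b) :=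
    monotoneOn_Icc_of_hasDerivAt
      (h.continuousOn_energy.sub (continuousOn_const.mul h.continuousOn))
      (fun s hs => (h.hasDerivAt_energy (Ioo_subset_Ico_self hs)).sub
        ((h.hasDerivAt s (Ioo_subset_Ico_self hs)).const_mul (ε * S)))
      (fun s hs => by linarith [(abs_le.1 (hbd s hs)).1])
  have h3 := h1 (left_mem_Icc.2 h.length_pos.le) hs hs.1
  have h4 := h2 (left_mem_Icc.2 h.length_pos.le) hs hs.1
  have h5 : 0 ≤ ε * S * w s := mul_nonneg (mul_nonneg h.eps_nonneg hS) (h.nonneg hs)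
  simp only at h3 h4
  rw [abs_le]
  constructor <;> linarith

/-- A normalised half bump with energy bounded below has bounded length. -/
lemma exists_length_le {p δ : ℝ} (hp : 2 < p) (hδ : 0 < δ) (c : ℝ) :
    ∃ L ε₀, 0 < ε₀ ∧ ∀ (μ ε b : ℝ) (w w₁ d : ℝ → ℝ), HalfBump p μ ε b w w₁ d → w 0 = 1 →
      ε * b ≤ c → ε ≤ ε₀ → δ ≤ 1 / p - μ / 2 → b ≤ L := by
  have hp0 : 0 < p := by linarith
  -- Constants: `S` bounds the speed; `x₀` is the height with `x₀^p/p = δ/4`; `k` is a lower bound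
  -- for the undamped downward acceleration at high positions; `κ` is a minimal descent speed at low
  -- positions; `T` is the time in which the parabola `1 - (k/4) s²` falls to `0`.
  set S : ℝ := √(2 / p * Real.exp (2 * c)) with hSdef
  have hS : 0 < S := Real.sqrt_pos.2 (by positivity)
  set x₀ : ℝ := (p * δ / 4) ^ (1 / p) with hx₀def
  have hx₀ : 0 < x₀ := by positivity
  have hx₀p : x₀ ^ p = p * δ / 4 := by
    rw [hx₀def, ← Real.rpow_mul (by positivity), one_div_mul_cancel hp0.ne', Real.rpow_one]
  set k : ℝ := x₀ ^ (p - 1) * (1 - 2 / p) with hk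
  have hk0 : 0 < k := by
    have : 2 / p < 1 := by rw [div_lt_one hp0]; exact hp
    have : 0 < 1 - 2 / p := by linarith
    positivity
  set κ : ℝ := √(δ / 2) with hκ
  have hκ0 : 0 < κ := Real.sqrt_pos.2 (by positivity)
  set T : ℝ := 2 / √k with hT
  have hT0 : 0 < T := by have := Real.sqrt_pos.2 hk0; positivity
  -- The threshold for `ε` keeps the energy drift below `δ/2` and the damping acceleration below
  -- `k/2`.
  refine ⟨T + 1 / κ, min (δ / 2) (k / 2) / S, by positivity, ?_⟩
  intro μ ε b w w₁ d h hw0 hεb hε hδμ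
  have hεS : ε * S ≤ min (δ / 2) (k / 2) := (le_div_iff₀ hS).1 hε
  have hSS : 2 / p * w 0 ^ p * Real.exp (2 * (ε * b)) ≤ S ^ 2 := by
    rw [hSdef, Real.sq_sqrt (by positivity), hw0, Real.one_rpow, mul_one]
    gcongr
  have hE0 : energy p μ (w 0) (w₁ 0) = 1 / p - μ / 2 := by
    rw [energy, hw0, h.vel_zero, Real.one_rpow]; ring
  have hE : ∀ s ∈ Icc 0 b, δ / 2 ≤ energy p μ (w s) (w₁ s) := by
    intro s hs
    have h1 := (abs_le.1 (h.abs_energy_sub_le hS.le hSS hs)).1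
    rw [hE0, hw0] at h1
    have := hεS.trans (min_le_left _ _)
    linarith
  -- Below `x₀`, or where `w^{p-2} < (p/2) μ`, the sum `w^p/p - μ w²/2` is at most `δ/4`. As the
  -- energy is at least `δ/2`, the kinetic part is at least `δ/4`.
  have hlow : ∀ s ∈ Ico 0 b, ¬ (x₀ ≤ w s ∧ p / 2 * μ ≤ w s ^ (p - 2)) → w₁ s ≤ -κ := by
    intro s hs hnot
    have hws := h.pos s hs
    have h1 := hE s (Ico_subset_Icc_self hs)
    have hsq : δ / 2 ≤ w₁ s ^ 2 := by
      unfold energy at h1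
      by_cases hx : x₀ ≤ w s
      · have h2 : w s ^ (p - 2) < p / 2 * μ := by
          by_contra hc
          exact hnot ⟨hx, not_lt.1 hc⟩
        rw [rpow_eq_rpow_sub_two_mul_sq hws] at h1
        have h3 : w s ^ (p - 2) * w s ^ 2 / p ≤ μ * w s ^ 2 / 2 := by
          rw [div_le_iff₀ hp0]
          have := mul_le_mul_of_nonneg_right h2.le (sq_nonneg (w s))
          linarith
        linarith
      · have h2 : w s ^ p ≤ p * δ / 4 := by
          rw [← hx₀p]
          exact Real.rpow_le_rpow hws.le (not_le.1 hx).le hp0.le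
        have h3 : w s ^ p / p ≤ δ / 4 := by
          rw [div_le_iff₀ hp0]; linarith
        have h4 : 0 ≤ μ * w s ^ 2 / 2 := by have := h.mu_pos; positivity
        linarith
    have h2 : κ ≤ |w₁ s| := by
      rw [hκ, ← Real.sqrt_sq_eq_abs]
      exact Real.sqrt_le_sqrt hsq
    rw [abs_of_nonpos (h.vel_nonpos (Ico_subset_Icc_self hs))] at h2
    linarith
  by_contra hcon
  rw [not_le] at hcon
  have hTb : T < b := by
    have : 0 < 1 / κ := by positivity
    linarith
  have hTmem : T ∈ Icc 0 b := ⟨hT0.le, hTb.le⟩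
  -- If the position were still high at time `T`, it would be high on all of `[0, T]` by
  -- monotonicity. The acceleration would be at most `-k + k/2 = -k/2` there, whence `w T ≤ 1 -
  -- (k/4) T² = 0 < x₀`.
  have hTnot : ¬ (x₀ ≤ w T ∧ p / 2 * μ ≤ w T ^ (p - 2)) := by
    rintro ⟨hx, hm⟩
    have hup : ∀ s ∈ Icc 0 T, x₀ ≤ w s ∧ p / 2 * μ ≤ w s ^ (p - 2) := by
      intro s hs
      have h1 := h.antitoneOn (show s ∈ Icc 0 b from ⟨hs.1, hs.2.trans hTb.le⟩) hTmem hs.2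
      exact ⟨hx.trans h1, hm.trans (Real.rpow_le_rpow (hx₀.le.trans hx) h1 (by linarith))⟩
    have hsub : Icc 0 T ⊆ Icc 0 b := Icc_subset_Icc_right hTb.le
    have hacc : AntitoneOn (fun s => w₁ s + k / 2 * s) (Icc 0 T) := by
      refine antitoneOn_Icc_of_hasDerivAt (f' := fun s => (μ * w s - w s ^ (p - 1) + d s * w₁ s)
        + k / 2) ((h.continuousOn_vel.mono hsub).add (by fun_prop)) ?_ ?_
      · intro s hs
        exact ((h.hasDerivAt_vel s ⟨hs.1.le, hs.2.trans hTb⟩).add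
          ((hasDerivAt_id s).const_mul (k / 2))).congr_deriv (by rw [mul_one])
      · intro s hs
        have hsb : s ∈ Ico 0 b := ⟨hs.1.le, hs.2.trans hTb⟩
        have hws := h.pos s hsb
        obtain ⟨h1, h2⟩ := hup s (Ioo_subset_Icc_self hs)
        have h3 : |d s * w₁ s| ≤ k / 2 := by
          rw [abs_mul]
          exact (mul_le_mul (h.abs_damping_le s hsb) (h.abs_vel_le hS.le hSS (Ico_subset_Icc_self hsb))
            (abs_nonneg _) h.eps_nonneg).trans (hεS.trans (min_le_right _ _))
        have h4 : μ * w s ≤ 2 / p * w s ^ (p - 1) := by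
          rw [rpow_sub_one_eq_rpow_sub_two_mul hws, ← mul_assoc]
          refine mul_le_mul_of_nonneg_right ?_ hws.le
          rw [div_mul_eq_mul_div, le_div_iff₀ hp0]
          linarith
        have h5 : k ≤ w s ^ (p - 1) * (1 - 2 / p) := by
          rw [hk]
          refine mul_le_mul_of_nonneg_right (Real.rpow_le_rpow hx₀.le h1 (by linarith)) ?_
          have : 2 / p < 1 := by rw [div_lt_one hp0]; exact hp
          linarith
        have := (abs_le.1 h3).2
        linarith
    have hpos : AntitoneOn (fun s => w s + k / 4 * s ^ 2) (Icc 0 T) := by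
      refine antitoneOn_Icc_of_hasDerivAt (f' := fun s => w₁ s + k / 2 * s)
        ((h.continuousOn.mono hsub).add (by fun_prop)) ?_ ?_
      · intro s hs
        refine ((h.hasDerivAt s ⟨hs.1.le, hs.2.trans hTb⟩).add
          ((hasDerivAt_pow 2 s).const_mul (k / 4))).congr_deriv ?_
        norm_num
        ring
      · intro s hs
        have := hacc (left_mem_Icc.2 hT0.le) (Ioo_subset_Icc_self hs) hs.1.le
        simpa [h.vel_zero] using this
    have h1 := hpos (left_mem_Icc.2 hT0.le) (right_mem_Icc.2 hT0.le) hT0.le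
    have h2 : k / 4 * T ^ 2 = 1 := by
      rw [hT, div_pow, Real.sq_sqrt hk0.le]
      field_simp
      norm_num
    simp only [h2, hw0] at h1
    norm_num at h1
    linarith
  -- After `T` the position stays low, so it descends at speed at least `κ` from a height at most
  -- `1`; the remaining time is at most `1/κ`.
  have hlin : AntitoneOn (fun s => w s + κ * s) (Icc T b) := by
    refine antitoneOn_Icc_of_hasDerivAt (f' := fun s => w₁ s + κ)
      ((h.continuousOn.mono (Icc_subset_Icc_left hT0.le)).add (by fun_prop)) ?_ ?_
    · intro s hs
      exact ((h.hasDerivAt s ⟨hT0.le.trans hs.1.le, hs.2⟩).add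
        ((hasDerivAt_id s).const_mul κ)).congr_deriv (by rw [mul_one])
    · intro s hs
      have hsb : s ∈ Ico 0 b := ⟨hT0.le.trans hs.1.le, hs.2⟩
      have := hlow s hsb fun hc => hTnot <| by
        have h1 := h.antitoneOn hTmem (Ico_subset_Icc_self hsb) hs.1.le
        exact ⟨hc.1.trans h1, hc.2.trans (Real.rpow_le_rpow (h.pos s hsb).le h1 (by linarith))⟩
      linarith
  have h1 := hlin (left_mem_Icc.2 hTb.le) (right_mem_Icc.2 hTb.le) hTb.le
  simp only [h.end_eq_zero] at h1
  have h2 := h.le_apply_zero hTmem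
  have h3 : κ * (b - T) ≤ 1 := by linarith
  have h4 : 1 / κ < b - T := by linarith
  rw [div_lt_iff₀ hκ0] at h4
  linarith

/-- The primitive against which both tail integrals are compared: a pointwise bound by a multiple of
`-w'` integrates to a multiple of `w R`. -/
lemma integral_vel (h : HalfBump p μ ε b w w₁ d) {R : ℝ} (hR : R ∈ Icc 0 b) :
    ∫ s in R..b, -w₁ s = w R := by
  have hsub : Icc R b ⊆ Icc 0 b := Icc_subset_Icc_left hR.1
  rw [intervalIntegral.integral_neg, intervalIntegral.integral_eq_sub_of_hasDerivAt_of_le hR.2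
    (h.continuousOn.mono hsub) (fun s hs => h.hasDerivAt s ⟨hR.1.trans hs.1.le, hs.2⟩)
    ((h.continuousOn_vel.mono hsub).intervalIntegrable_of_Icc hR.2), h.end_eq_zero]
  ring

lemma integral_sq_vel_le (h : HalfBump p μ ε b w w₁ d) {S : ℝ} (hS : 0 ≤ S)
    (hS' : 2 / p * w 0 ^ p * Real.exp (2 * (ε * b)) ≤ S ^ 2) {R : ℝ} (hR : R ∈ Icc 0 b) :
    ∫ s in R..b, w₁ s ^ 2 ≤ S * w R := by
  have hsub : Icc R b ⊆ Icc 0 b := Icc_subset_Icc_left hR.1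
  have hc := h.continuousOn_vel.mono hsub
  rw [← h.integral_vel hR, ← intervalIntegral.integral_const_mul]
  refine intervalIntegral.integral_mono_on hR.2 ((hc.pow 2).intervalIntegrable_of_Icc hR.2)
    ((continuousOn_const.mul hc.neg).intervalIntegrable_of_Icc hR.2) fun s hs => ?_
  have h1 := h.abs_vel_le hS hS' (hsub hs)
  have h2 := h.vel_nonpos (hsub hs)
  rw [abs_of_nonpos h2] at h1
  nlinarith

/-- When `w^{p-2} ≤ 3/4`, nonnegative energy gives `w'^2 ≥ w²/4`, because `(3/4)/p ≤ 3/8`. Hence `w²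
≤ 2 w |w'| ≤ 2 w(R) |w'|` beyond `R`. -/
lemma integral_sq_le (h : HalfBump p 1 ε b w w₁ d) {R : ℝ} (hR : R ∈ Icc 0 b)
    (hwR : w R ^ (p - 2) ≤ 3 / 4) :
    ∫ s in R..b, w s ^ 2 ≤ 2 * w R * w R := by
  have hsub : Icc R b ⊆ Icc 0 b := Icc_subset_Icc_left hR.1
  have hp := h.two_lt
  have hc := h.continuousOn_vel.mono hsub
  have hc' := h.continuousOn.mono hsub
  conv_rhs => rw [← h.integral_vel hR, ← intervalIntegral.integral_const_mul]
  refine intervalIntegral.integral_mono_on_of_le_Ioo hR.2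
    ((hc'.pow 2).intervalIntegrable_of_Icc hR.2)
    ((continuousOn_const.mul hc.neg).intervalIntegrable_of_Icc hR.2) fun s hs => ?_
  have hsb : s ∈ Ico 0 b := ⟨hR.1.trans hs.1.le, hs.2⟩
  rw [h.integral_vel hR]
  have h1 := h.antitoneOn hR (Ico_subset_Icc_self hsb) hs.1.le
  have hE := h.energy_nonneg s hsb
  have hws := h.pos s hsb
  have h2 := h.vel_nonpos (Ico_subset_Icc_self hsb)
  have h3 : w s ^ (p - 2) ≤ 3 / 4 := (Real.rpow_le_rpow hws.le h1 (by linarith)).trans hwR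
  rw [energy, rpow_eq_rpow_sub_two_mul_sq hws] at hE
  have h4 : w s ^ (p - 2) * w s ^ 2 / p ≤ 3 / 8 * w s ^ 2 := by
    rw [div_le_iff₀ (by linarith)]
    have := mul_le_mul_of_nonneg_right h3 (sq_nonneg (w s))
    nlinarith [sq_nonneg (w s)]
  have h5 : w s / 2 ≤ -w₁ s := by
    refine le_of_sq_le_sq ?_ (by linarith)
    nlinarith
  nlinarith

end HalfBump

/-! ### Convergence of half bumps to the ground state in `H¹` of a half line -/

lemma tendsto_setIntegral_Ioi_zero {F : ℝ → ℝ} (hF : IntegrableOn F (Ioi 0)) :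
    Tendsto (fun R => ∫ s in Ioi R, F s) atTop (𝓝 0) := by
  have h1 : Tendsto (fun R => ∫ s in (0:ℝ)..R, F s) atTop (𝓝 (∫ s in Ioi 0, F s)) :=
    intervalIntegral_tendsto_integral_Ioi 0 hF tendsto_id
  have h2 := (tendsto_const_nhds (x := ∫ s in Ioi 0, F s)).sub h1
  rw [sub_self] at h2
  refine h2.congr' ?_
  filter_upwards [eventually_ge_atTop 0] with R hR
  rw [intervalIntegral.integral_of_le hR, ← Ioc_union_Ioi_eq_Ioi hR, setIntegral_union
    (Ioc_disjoint_Ioi le_rfl) measurableSet_Ioi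
    (hF.mono_set Ioc_subset_Ioi_self) (hF.mono_set (Ioi_subset_Ioi hR))]
  ring

/-- `L²` convergence on a half line from locally uniform convergence and uniformly small tails. -/
lemma tendsto_integral_sq_sub {g : ℕ → ℝ → ℝ} {f : ℝ → ℝ} {b : ℕ → ℝ}
    (hf : Continuous f) (hf2 : IntegrableOn (fun s => f s ^ 2) (Ioi 0))
    (hg : ∀ n, ContinuousOn (g n) (Icc 0 (b n)))
    (hloc : ∀ R η : ℝ, 0 < η → ∀ᶠ n in atTop, R < b n ∧ ∀ s ∈ Icc 0 R, |g n s - f s| ≤ η)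
    (htail : ∀ η : ℝ, 0 < η → ∃ R₀, ∀ R, R₀ ≤ R → ∀ᶠ n in atTop, ∫ s in R..b n, g n s ^ 2 ≤ η) :
    (∀ n, IntegrableOn (fun s => ((Iio (b n)).indicator (g n) s - f s) ^ 2) (Ioi 0)) ∧
    Tendsto (fun n => ∫ s in Ioi 0, ((Iio (b n)).indicator (g n) s - f s) ^ 2) atTop (𝓝 0) := by
  have hgm : ∀ n, MemLp ((Iio (b n)).indicator (g n)) 2 (volume.restrict (Ioi 0)) := by
    intro n
    rw [memLp_indicator_iff_restrict measurableSet_Iio, Measure.restrict_restrict measurableSet_Iio]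
    have h1 : Iio (b n) ∩ Ioi 0 ⊆ Icc 0 (b n) := fun s hs => ⟨le_of_lt hs.2, le_of_lt hs.1⟩
    have h2 : AEStronglyMeasurable (g n) (volume.restrict (Iio (b n) ∩ Ioi 0)) :=
      ((hg n).aestronglyMeasurable measurableSet_Icc).mono_set h1
    refine (memLp_two_iff_integrable_sq h2).2 ?_
    exact (((hg n).pow 2).integrableOn_Icc).mono_set h1
  have hfm : MemLp f 2 (volume.restrict (Ioi 0)) :=
    (memLp_two_iff_integrable_sq hf.aestronglyMeasurable).2 hf2
  have hint : ∀ n, IntegrableOn (fun s => ((Iio (b n)).indicator (g n) s - f s) ^ 2) (Ioi 0) :=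
    fun n => ((hgm n).sub hfm).integrable_sq
  refine ⟨hint, ?_⟩
  have hgint : ∀ n, IntegrableOn (fun s => ((Iio (b n)).indicator (g n) s) ^ 2) (Ioi 0) :=
    fun n => (hgm n).integrable_sq
  rw [Metric.tendsto_nhds]
  intro η hη
  -- Budget: `η/4` from `[0, R]`, and `2·η/8 + 2·η/8` from the tails of `g n` and `f` via `(x - y)²
  -- ≤ 2x² + 2y²`; the total stays below `η`.
  obtain ⟨R₀, hR₀⟩ := htail (η / 8) (by positivity)
  have hft := (tendsto_setIntegral_Ioi_zero hf2).eventually_le_const (show 0 < η / 8 by positivity)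
  obtain ⟨R, hfR, hRR, hR⟩ := (hft.and ((eventually_ge_atTop R₀).and (eventually_gt_atTop 0))).exists
  set θ : ℝ := √(η / (4 * R)) with hθ
  have hθ0 : 0 < θ := Real.sqrt_pos.2 (by positivity)
  filter_upwards [hR₀ R hRR, hloc R θ hθ0] with n hn1 hn2
  obtain ⟨hRb, hn2⟩ := hn2
  rw [Real.dist_eq, sub_zero, abs_of_nonneg (integral_nonneg fun s => sq_nonneg _),
    ← Ioc_union_Ioi_eq_Ioi hR.le, setIntegral_union
    (Ioc_disjoint_Ioi le_rfl) measurableSet_Ioi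
    ((hint n).mono_set Ioc_subset_Ioi_self) ((hint n).mono_set (Ioi_subset_Ioi hR.le))]
  have h1 : ∫ s in Ioc 0 R, ((Iio (b n)).indicator (g n) s - f s) ^ 2 ≤ η / 4 := by
    calc _ ≤ ∫ s in Ioc 0 R, θ ^ 2 := by
          refine setIntegral_mono_on ((hint n).mono_set Ioc_subset_Ioi_self)
            (by simp) measurableSet_Ioc fun s hs => ?_
          rw [indicator_of_mem (show s ∈ Iio (b n) from hs.2.trans_lt hRb), ← sq_abs]
          exact pow_le_pow_left₀ (abs_nonneg _) (hn2 s (Ioc_subset_Icc_self hs)) 2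
      _ = η / 4 := by
          rw [setIntegral_const, hθ, Real.sq_sqrt (by positivity)]
          simp [hR.le]
          field_simp
  have h2 : ∫ s in Ioi R, ((Iio (b n)).indicator (g n) s) ^ 2 ≤ η / 8 := by
    have : ∫ s in Ioi R, ((Iio (b n)).indicator (g n) s) ^ 2 = ∫ s in R..b n, g n s ^ 2 := by
      rw [intervalIntegral.integral_of_le hRb.le, integral_Ioc_eq_integral_Ioo, ← Ioi_inter_Iio,
        ← setIntegral_indicator measurableSet_Iio]
      refine setIntegral_congr_fun measurableSet_Ioi fun s _ => ?_
      by_cases hs : s ∈ Iio (b n) <;> simp [hs]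
    rw [this]
    exact hn1
  have h3 : ∫ s in Ioi R, ((Iio (b n)).indicator (g n) s - f s) ^ 2 ≤ η / 2 := by
    have hi1 := ((hgint n).mono_set (Ioi_subset_Ioi hR.le))
    have hi2 := (hf2.mono_set (Ioi_subset_Ioi hR.le))
    calc _ ≤ ∫ s in Ioi R, (2 * ((Iio (b n)).indicator (g n) s) ^ 2 + 2 * f s ^ 2) := by
          refine setIntegral_mono_on ((hint n).mono_set (Ioi_subset_Ioi hR.le))
            ((hi1.const_mul 2).add (hi2.const_mul 2)) measurableSet_Ioi fun s _ => ?_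
          nlinarith [sq_nonneg ((Iio (b n)).indicator (g n) s + f s)]
      _ = 2 * (∫ s in Ioi R, ((Iio (b n)).indicator (g n) s) ^ 2) +
            2 * ∫ s in Ioi R, f s ^ 2 := by
          rw [integral_add (hi1.const_mul 2) (hi2.const_mul 2), integral_const_mul,
            integral_const_mul]
      _ ≤ η / 2 := by linarith
  linarith

/-- Half bumps with vanishing damping, total damping bounded, and starting height converging to
that of the ground state converge to the ground state in `H¹(0, ∞)`. -/
lemma HalfBump.tendsto_groundState {p c : ℝ} (hp : 2 < p) {ε b : ℕ → ℝ} {w w₁ d : ℕ → ℝ → ℝ}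
    (h : ∀ n, HalfBump p 1 (ε n) (b n) (w n) (w₁ n) (d n)) (hε : Tendsto ε atTop (𝓝 0))
    (hεb : ∀ n, ε n * b n ≤ c) (hw0 : Tendsto (fun n => w n 0) atTop (𝓝 (groundState p 0))) :
    ((∀ n, IntegrableOn (fun s => ((Iio (b n)).indicator (w n) s - groundState p s) ^ 2) (Ioi 0)) ∧
    Tendsto (fun n => ∫ s in Ioi 0, ((Iio (b n)).indicator (w n) s - groundState p s) ^ 2)
      atTop (𝓝 0)) ∧
    ((∀ n, IntegrableOn (fun s => ((Iio (b n)).indicator (w₁ n) s - deriv (groundState p) s) ^ 2)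
      (Ioi 0)) ∧
    Tendsto (fun n => ∫ s in Ioi 0,
      ((Iio (b n)).indicator (w₁ n) s - deriv (groundState p) s) ^ 2) atTop (𝓝 0)) := by
  have hp0 : 0 < p := by linarith
  set B : ℝ := groundState p 0 + 1 with hB
  have hG0 := groundState_pos hp 0
  have hB0 : 0 < B := by linarith
  set S : ℝ := √(2 / p * B ^ p * Real.exp (2 * c)) with hSdef
  have hS0 : 0 ≤ S := Real.sqrt_nonneg _
  have hwB : ∀ᶠ n in atTop, w n 0 ≤ B := hw0.eventually_le_const (by linarith)
  have hSS : ∀ᶠ n in atTop, 2 / p * w n 0 ^ p * Real.exp (2 * (ε n * b n)) ≤ S ^ 2 := by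
    filter_upwards [hwB] with n hn
    rw [hSdef, Real.sq_sqrt (by positivity)]
    have := (h n).zero_pos
    have := hεb n
    gcongr
  have hmain : ∀ R η : ℝ, 0 < η → ∀ᶠ n in atTop, R < b n ∧ ∀ s ∈ Icc 0 R,
      |w n s - groundState p s| ≤ η ∧ |w₁ n s - deriv (groundState p) s| ≤ η := by
    intro R η hη
    obtain ⟨C, hC0, hC⟩ := exists_gronwall_groundState hp (show groundState p 0 ≤ B by linarith) |R|
    -- The damping term, at most `ε n * S`, is treated as a defect in the undamped equation; `e n`
    -- also absorbs the initial height error.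
    set e : ℕ → ℝ := fun n => max (ε n * S) |w n 0 - groundState p 0| with he
    have het : Tendsto (fun n => C * e n) atTop (𝓝 0) := by
      have h1 : Tendsto (fun n => |w n 0 - groundState p 0|) atTop (𝓝 0) := by
        simpa using (hw0.sub_const (groundState p 0)).abs
      have h2 : Tendsto (fun n => ε n * S) atTop (𝓝 0) := by simpa using hε.mul_const S
      simpa using (h2.max h1).const_mul C
    have key : ∀ᶠ n in atTop, ∀ s ∈ Icc 0 (min (b n) |R|),
        |w n s - groundState p s| ≤ C * e n ∧ |w₁ n s - deriv (groundState p) s| ≤ C * e n := by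
      filter_upwards [hwB, hSS] with n hn1 hn2
      have hsub : Icc 0 (min (b n) |R|) ⊆ Icc 0 (b n) := Icc_subset_Icc_right (min_le_left _ _)
      have hsub' : Ico 0 (min (b n) |R|) ⊆ Ico 0 (b n) := Ico_subset_Ico_right (min_le_left _ _)
      refine hC (min (b n) |R|) (e n) (w n) (w₁ n)
        (fun s => 1 * w n s - w n s ^ (p - 1) + d n s * w₁ n s) (min_le_right _ _)
        ((abs_nonneg _).trans (le_max_right _ _)) ((h n).continuousOn.mono hsub)
        ((h n).continuousOn_vel.mono hsub) (fun s hs => (h n).hasDerivAt s (hsub' hs))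
        (fun s hs => (h n).hasDerivAt_vel s (hsub' hs)) ?_ ?_ (le_max_right _ _) (h n).vel_zero
      · intro s hs
        have h1 := (h n).abs_damping_le s (hsub' hs)
        have h2 := (h n).abs_vel_le hS0 hn2 (Ico_subset_Icc_self (hsub' hs))
        rw [show 1 * w n s - w n s ^ (p - 1) + d n s * w₁ n s - (w n s - w n s ^ (p - 1)) =
          d n s * w₁ n s by ring, abs_mul]
        exact (mul_le_mul h1 h2 (abs_nonneg _) (h n).eps_nonneg).trans (le_max_left _ _)
      · exact fun s hs => ⟨((h n).pos s (hsub' hs)).le,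
          ((h n).le_apply_zero (Ico_subset_Icc_self (hsub' hs))).trans hn1⟩
    -- The ground state is bounded away from `0` on `[0, |R|]`. A bump that is closer to it than
    -- this bound cannot vanish there, which forces `b n > |R|`.
    obtain ⟨m, hm0, hm⟩ : ∃ m, 0 < m ∧ ∀ s ∈ Icc 0 |R|, m ≤ groundState p s := by
      obtain ⟨x, -, hx⟩ := isCompact_Icc.exists_isMinOn (nonempty_Icc.2 (abs_nonneg R))
        (groundState_continuous hp).continuousOn
      exact ⟨groundState p x, groundState_pos hp x, fun s hs => hx hs⟩
    filter_upwards [key, het.eventually_lt_const (show 0 < min η m from lt_min hη hm0)] with n h1 h2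
    have hb : |R| < b n := by
      by_contra hcon
      rw [not_lt] at hcon
      have hbm : min (b n) |R| = b n := min_eq_left hcon
      have h3 := (h1 (b n) (by rw [hbm]; exact right_mem_Icc.2 (h n).length_pos.le)).1
      rw [(h n).end_eq_zero, zero_sub, abs_neg, abs_of_pos (groundState_pos hp _)] at h3
      have h4 := hm (b n) ⟨(h n).length_pos.le, hcon⟩
      have := h2.trans_le (min_le_right _ _)
      linarith
    refine ⟨(le_abs_self R).trans_lt hb, fun s hs => ?_⟩
    have h3 := h1 s ⟨hs.1, by rw [min_eq_right hb.le]; exact hs.2.trans (le_abs_self R)⟩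
    have h4 := (h2.trans_le (min_le_left _ _)).le
    exact ⟨h3.1.trans h4, h3.2.trans h4⟩
  have hGtop : Tendsto (groundState p) atTop (𝓝 0) :=
    (groundState_tendsto hp).mono_left atTop_le_cocompact
  have hsmall : ∀ τ : ℝ, 0 < τ → ∃ R₀, 0 ≤ R₀ ∧ ∀ R, R₀ ≤ R → ∀ᶠ n in atTop,
      R < b n ∧ w n R ≤ τ := by
    intro τ hτ
    obtain ⟨R₀, hR₀⟩ := eventually_atTop.1
      (hGtop.eventually_le_const (show 0 < τ / 2 by positivity))
    refine ⟨max R₀ 0, le_max_right _ _, fun R hR => ?_⟩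
    filter_upwards [hmain R (τ / 2) (by positivity)] with n hn
    have h1 := (hn.2 R (right_mem_Icc.2 ((le_max_right _ _).trans hR))).1
    have h2 := hR₀ R ((le_max_left _ _).trans hR)
    exact ⟨hn.1, by linarith [(abs_le.1 h1).2]⟩
  refine ⟨tendsto_integral_sq_sub (groundState_continuous hp)
      (groundState_memLp hp).integrable_sq.integrableOn (fun n => (h n).continuousOn)
      (fun R η hη => (hmain R η hη).mono fun n hn => ⟨hn.1, fun s hs => (hn.2 s hs).1⟩) ?_,
    tendsto_integral_sq_sub (continuous_deriv_groundState hp)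
      (deriv_groundState_memLp hp).integrable_sq.integrableOn (fun n => (h n).continuousOn_vel)
      (fun R η hη => (hmain R η hη).mono fun n hn => ⟨hn.1, fun s hs => (hn.2 s hs).2⟩) ?_⟩
  · intro η hη
    -- The first entry gives `w^{p-2} ≤ 3/4`, as the tail bound requires; the second makes `2 τ² ≤
    -- η`.
    set τ : ℝ := min ((3 / 4) ^ (1 / (p - 2))) (√(η / 2)) with hτ
    have hτ0 : 0 < τ := lt_min (by positivity) (Real.sqrt_pos.2 (by positivity))
    obtain ⟨R₀, hR0, hR₀⟩ := hsmall τ hτ0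
    refine ⟨R₀, fun R hR => ?_⟩
    filter_upwards [hR₀ R hR] with n hn
    have hRm : R ∈ Icc 0 (b n) := ⟨hR0.trans hR, hn.1.le⟩
    have hw := (h n).nonneg hRm
    refine ((h n).integral_sq_le hRm ?_).trans ?_
    · have := Real.rpow_le_rpow hw (hn.2.trans (min_le_left _ _)) (show 0 ≤ p - 2 by linarith)
      rwa [← Real.rpow_mul (by norm_num), one_div_mul_cancel (by linarith), Real.rpow_one] at this
    · have h1 := pow_le_pow_left₀ hw (hn.2.trans (min_le_right _ _)) 2
      rw [Real.sq_sqrt (by positivity)] at h1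
      nlinarith
  · intro η hη
    obtain ⟨R₀, hR0, hR₀⟩ := hsmall (η / (S + 1)) (by positivity)
    refine ⟨R₀, fun R hR => ?_⟩
    filter_upwards [hR₀ R hR, hSS] with n hn hn2
    have hRm : R ∈ Icc 0 (b n) := ⟨hR0.trans hR, hn.1.le⟩
    have hw := (h n).nonneg hRm
    refine ((h n).integral_sq_vel_le hS0 hn2 hRm).trans ?_
    have := (le_div_iff₀ (show 0 < S + 1 by linarith)).1 hn.2
    nlinarith

/-! ### Test functions on an interval and very weak solutions of `(q U')' = K` -/

namespace IsTestFunction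

variable {a b : ℝ} {φ ψ : ℝ → ℝ}

lemma eq_zero_of_notMem (h : IsTestFunction (Ioo a b) φ) {x : ℝ} (hx : x ∉ Ioo a b) : φ x = 0 :=
  image_eq_zero_of_notMem_tsupport fun h' => hx (h.2.2 h')

lemma mul_left (h : IsTestFunction (Ioo a b) φ) (hψ : ContDiff ℝ ∞ ψ) :
    IsTestFunction (Ioo a b) (fun x => ψ x * φ x) :=
  ⟨hψ.mul h.1, h.2.1.mul_left, (tsupport_mul_subset_right).trans h.2.2⟩

lemma sub (h : IsTestFunction (Ioo a b) φ) (h' : IsTestFunction (Ioo a b) ψ) :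
    IsTestFunction (Ioo a b) (fun x => φ x - ψ x) :=
  ⟨h.1.sub h'.1, h.2.1.sub h'.2.1, (tsupport_sub φ ψ).trans (union_subset h.2.2 h'.2.2)⟩

lemma deriv (h : IsTestFunction (Ioo a b) φ) : IsTestFunction (Ioo a b) (deriv φ) :=
  ⟨(contDiff_infty_iff_deriv.1 h.1).2, h.2.1.deriv, tsupport_deriv_subset.trans h.2.2⟩

lemma hasDerivAt (h : IsTestFunction (Ioo a b) φ) (x : ℝ) : HasDerivAt φ (_root_.deriv φ x) x :=
  (h.1.differentiable (by simp) x).hasDerivAt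

/-- Although `q` may vanish outside the interval, the quotient is smooth: off the support of `φ` it
is locally `0`. -/
lemma div (h : IsTestFunction (Ioo a b) φ) {q : ℝ → ℝ} (hq : ContDiff ℝ ∞ q)
    (hq0 : ∀ x ∈ Ioo a b, q x ≠ 0) : IsTestFunction (Ioo a b) (fun x => (q x)⁻¹ * φ x) := by
  refine ⟨contDiff_iff_contDiffAt.2 fun x => ?_, h.2.1.mul_left,
    (tsupport_mul_subset_right).trans h.2.2⟩
  by_cases hx : x ∈ tsupport φ
  · exact (hq.contDiffAt.inv (hq0 x (h.2.2 hx))).mul h.1.contDiffAt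
  · refine (contDiffAt_const (c := (0:ℝ))).congr_of_eventuallyEq ?_
    filter_upwards [(isClosed_tsupport φ).isOpen_compl.mem_nhds hx] with y hy
    rw [image_eq_zero_of_notMem_tsupport hy, mul_zero]

lemma exists_subset_Icc (h : IsTestFunction (Ioo a b) φ) (hab : a < b) :
    ∃ a' b', a < a' ∧ b' < b ∧ tsupport φ ⊆ Icc a' b' := by
  rcases (tsupport φ).eq_empty_or_nonempty with he | hne
  -- For empty support the end points are swapped, making `Icc b a` empty.
  · refine ⟨b, a, hab, hab, by simp [he]⟩
  · obtain ⟨x, hx, hx'⟩ := h.2.1.isCompact.exists_isMinOn hne continuousOn_id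
    obtain ⟨y, hy, hy'⟩ := h.2.1.isCompact.exists_isMaxOn hne continuousOn_id
    exact ⟨x, y, (h.2.2 hx).1, (h.2.2 hy).2, fun z hz => ⟨hx' hz, hy' hz⟩⟩

/-- A test function of mean zero is the derivative of a test function. -/
lemma exists_deriv_eq (h : IsTestFunction (Ioo a b) φ) (hab : a < b)
    (h0 : ∫ x in a..b, φ x = 0) : ∃ η, IsTestFunction (Ioo a b) η ∧ _root_.deriv η = φ := by
  have hφ := h.1.continuous
  set η : ℝ → ℝ := fun x => ∫ t in a..x, φ t with hη
  have hd : ∀ x, HasDerivAt η (φ x) x := fun x => hφ.integral_hasStrictDerivAt a x |>.hasDerivAt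
  have hdη : _root_.deriv η = φ := funext fun x => (hd x).deriv
  obtain ⟨a', b', ha', hb', hsub⟩ := h.exists_subset_Icc hab
  have hz : ∀ t, t ∉ Icc a' b' → φ t = 0 := fun t ht =>
    image_eq_zero_of_notMem_tsupport fun h' => ht (hsub h')
  have hη0 : Function.support η ⊆ Icc a' b' := by
    intro x hx
    by_contra hcon
    refine hx ?_
    rw [mem_Icc, not_and_or, not_le, not_le] at hcon
    rcases hcon with hc | hc
    · refine (intervalIntegral.integral_congr (g := fun _ => 0) fun t ht => ?_).trans (by simp)
      refine hz t fun ht' => ?_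
      have h1 := ht.2
      rcases le_max_iff.1 h1 with h2 | h2 <;> linarith [ht'.1]
    · have h1 : η x = ∫ t in a..b, φ t := by
        have h2 := intervalIntegral.integral_add_adjacent_intervals
          (hφ.intervalIntegrable (μ := volume) a x) (hφ.intervalIntegrable x b)
        have h3 : ∫ t in x..b, φ t = 0 := by
          refine (intervalIntegral.integral_congr (g := fun _ => 0) fun t ht => ?_).trans (by simp)
          refine hz t fun ht' => ?_
          have h1 := ht.1
          rcases min_le_iff.1 h1 with h2 | h2 <;> linarith [ht'.2]
        rw [← h2, h3, add_zero]
      rw [h1, h0]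
  have hts : tsupport η ⊆ Icc a' b' := closure_minimal hη0 isClosed_Icc
  refine ⟨η, ⟨contDiff_infty_iff_deriv.2 ⟨fun x => (hd x).differentiableAt, by rw [hdη]; exact h.1⟩,
    HasCompactSupport.of_support_subset_isCompact isCompact_Icc hη0,
    hts.trans (Icc_subset_Ioo ha' hb')⟩, hdη⟩

/-- Integration by parts against a test function. -/
lemma integral_mul_deriv (h : IsTestFunction (Ioo a b) φ) {u u' : ℝ → ℝ}
    (hu : ∀ x, HasDerivAt u (u' x) x) (hu' : Continuous u') :
    ∫ x in a..b, u x * _root_.deriv φ x = -∫ x in a..b, u' x * φ x := by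
  have hd := (contDiff_infty_iff_deriv.1 h.1).2.continuous
  rw [intervalIntegral.integral_mul_deriv_eq_deriv_mul (fun x _ => hu x)
    (fun x _ => h.hasDerivAt x) (hu'.intervalIntegrable _ _) (hd.intervalIntegrable _ _),
    h.eq_zero_of_notMem right_notMem_Ioo, h.eq_zero_of_notMem left_notMem_Ioo]
  simp

end IsTestFunction

lemma exists_isTestFunction_integral_eq_one {a b : ℝ} (hab : a < b) :
    ∃ ψ, IsTestFunction (Ioo a b) ψ ∧ ∫ x in a..b, ψ x = 1 := by
  set f : ContDiffBump ((a + b) / 2) := ⟨(b - a) / 8, (b - a) / 4, by linarith, by linarith⟩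
  have hsub : Metric.closedBall ((a + b) / 2) ((b - a) / 4) ⊆ Ioo a b := by
    rw [Real.closedBall_eq_Icc]
    exact Icc_subset_Ioo (by linarith) (by linarith)
  have hts : tsupport (f.normed volume) ⊆ Ioo a b := by
    rw [f.tsupport_normed_eq]
    exact hsub
  refine ⟨f.normed volume, ⟨f.contDiff_normed, f.hasCompactSupport_normed, hts⟩, ?_⟩
  rw [intervalIntegral.integral_of_le hab.le, setIntegral_eq_integral_of_forall_compl_eq_zero,
    f.integral_normed]
  intro x hx
  exact image_eq_zero_of_notMem_tsupport fun h => hx (Ioo_subset_Ioc_self (hts h))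

/-- The fundamental lemma of the calculus of variations. -/
lemma eq_zero_of_forall_integral_mul_eq_zero {a b : ℝ} {D : ℝ → ℝ} (hab : a < b)
    (hD : Continuous D) (h : ∀ ψ, IsTestFunction (Ioo a b) ψ → ∫ x in a..b, D x * ψ x = 0) :
    ∀ x ∈ Ioo a b, D x = 0 := by
  have hae : ∀ᵐ x, x ∈ Ioo a b → D x = 0 := by
    refine isOpen_Ioo.ae_eq_zero_of_integral_contDiff_smul_eq_zero
      (hD.locallyIntegrable.locallyIntegrableOn _) fun ψ h1 h2 h3 => ?_
    have h4 := h ψ ⟨h1, h2, h3⟩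
    rw [intervalIntegral.integral_of_le hab.le, setIntegral_eq_integral_of_forall_compl_eq_zero] at h4
    · simpa [mul_comm] using h4
    · intro x hx
      rw [image_eq_zero_of_notMem_tsupport fun h => hx (Ioo_subset_Ioc_self (h3 h)), mul_zero]
  have h2 : D =ᵐ[volume.restrict (Ioo a b)] fun _ => 0 :=
    (ae_restrict_iff' measurableSet_Ioo).2 hae
  exact Measure.eqOn_open_of_ae_eq h2 isOpen_Ioo hD.continuousOn continuousOn_const

/-- The lemma of du Bois-Reymond. -/
lemma exists_eq_const_of_forall_integral_mul_deriv_eq_zero {a b : ℝ} {D : ℝ → ℝ} (hab : a < b)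
    (hD : Continuous D)
    (h : ∀ ψ, IsTestFunction (Ioo a b) ψ → ∫ x in a..b, D x * deriv ψ x = 0) :
    ∃ c, ∀ x ∈ Ioo a b, D x = c := by
  obtain ⟨ψ₀, hψ₀, hψ₀1⟩ := exists_isTestFunction_integral_eq_one hab
  -- Subtracting `m ψ₀`, where `m` is the integral of `ψ`, gives a function of mean zero, hence the
  -- derivative of a test function. This identifies the constant as the `ψ₀`-average of `D`.
  refine ⟨∫ x in a..b, D x * ψ₀ x, fun x hx => ?_⟩
  refine sub_eq_zero.1 (eq_zero_of_forall_integral_mul_eq_zero (D := fun x => D x -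
    ∫ x in a..b, D x * ψ₀ x) hab (by fun_prop) (fun ψ hψ => ?_) x hx)
  have hc := hψ.1.continuous
  have hc₀ := hψ₀.1.continuous
  set m := ∫ x in a..b, ψ x with hm
  obtain ⟨η, hη, hηd⟩ := (hψ.sub (hψ₀.mul_left (contDiff_const (c := m)))).exists_deriv_eq hab (by
    rw [intervalIntegral.integral_sub (hc.intervalIntegrable _ _)
      ((by fun_prop : Continuous fun x => m * ψ₀ x).intervalIntegrable _ _),
      intervalIntegral.integral_const_mul, hψ₀1, mul_one, sub_self])
  have h1 := h η hη
  rw [hηd] at h1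
  have h2 : ∫ x in a..b, D x * (ψ x - m * ψ₀ x) =
      (∫ x in a..b, D x * ψ x) - m * ∫ x in a..b, D x * ψ₀ x := by
    rw [← intervalIntegral.integral_const_mul, ← intervalIntegral.integral_sub
      ((hD.fun_mul hc).intervalIntegrable _ _)
      ((by fun_prop : Continuous fun x => m * (D x * ψ₀ x)).intervalIntegrable _ _)]
    congr 1
    ext x
    ring
  simp_rw [sub_mul]
  rw [intervalIntegral.integral_sub ((hD.fun_mul hc).intervalIntegrable _ _)
    ((by fun_prop : Continuous fun x => (∫ x in a..b, D x * ψ₀ x) * ψ x).intervalIntegrable _ _),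
    intervalIntegral.integral_const_mul, ← hm]
  linarith

/-- A continuous very weak solution of `(q U')' = K` on an interval is a classical one, up to the
boundary. -/
lemma exists_flux_of_forall_integral_eq {a b : ℝ} {q U K : ℝ → ℝ} (hab : a < b)
    (hq : ContDiff ℝ ∞ q) (hq0 : ∀ x ∈ Icc a b, q x ≠ 0) (hU : ContinuousOn U (Icc a b))
    (hK : ContinuousOn K (Icc a b))
    (h : ∀ η, IsTestFunction (Ioo a b) η →
      ∫ x in a..b, U x * deriv (fun y => q y * deriv η y) x = ∫ x in a..b, K x * η x) :
    ∃ Y, ContinuousOn Y (Icc a b) ∧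
      ∀ x ∈ Ioo a b, HasDerivAt U (Y x / q x) x ∧ HasDerivAt Y (K x) x := by
  have hIcc : ∀ x ∈ uIcc a b, x ∈ Icc a b := fun x hx => by rwa [uIcc_of_le hab.le] at hx
  -- Continuous extension to the whole line lets primitives be differentiated at every point, end
  -- points included.
  have hext : ∀ {F : ℝ → ℝ}, ContinuousOn F (Icc a b) → ∃ G : ℝ → ℝ, Continuous G ∧
      ∀ x ∈ Icc a b, G x = F x := fun {F} hF =>
    ⟨IccExtend hab.le ((Icc a b).domRestrict F), (continuousOn_iff_continuous_domRestrict.1 hF).Icc_extend',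
      fun x hx => by rw [IccExtend_of_mem _ _ hx]; rfl⟩
  obtain ⟨V, hV, hVU⟩ := hext hU
  obtain ⟨L, hL, hLK⟩ := hext hK
  obtain ⟨ρ, hρ, hρq⟩ := hext (hq.continuous.continuousOn.inv₀ hq0)
  have hρq' : ∀ x ∈ Icc a b, ρ x * q x = 1 := fun x hx => by
    rw [hρq x hx]; exact inv_mul_cancel₀ (hq0 x hx)
  set P : ℝ → ℝ := fun x => ∫ t in a..x, L t with hPdef
  have hP : ∀ x, HasDerivAt P (L x) x := fun x => (hL.integral_hasStrictDerivAt a x).hasDerivAt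
  have hPc : Continuous P := continuous_iff_continuousAt.2 fun x => (hP x).continuousAt
  set Z : ℝ → ℝ := fun x => ∫ t in a..x, ρ t * P t with hZdef
  have hZ : ∀ x, HasDerivAt Z (ρ x * P x) x := fun x =>
    ((hρ.mul hPc).integral_hasStrictDerivAt a x).hasDerivAt
  have hZc : Continuous Z := continuous_iff_continuousAt.2 fun x => (hZ x).continuousAt
  set R : ℝ → ℝ := fun x => ∫ t in a..x, ρ t with hRdef
  have hR : ∀ x, HasDerivAt R (ρ x) x := fun x => (hρ.integral_hasStrictDerivAt a x).hasDerivAt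
  have hRc : Continuous R := continuous_iff_continuousAt.2 fun x => (hR x).continuousAt
  -- `Z` is a particular solution: `q Z' = P` and `P' = K` on `[a, b]`. The difference `D` solves
  -- the homogeneous equation very weakly, so it should be a constant minus a multiple of `R = ∫
  -- 1/q`.
  set D : ℝ → ℝ := fun x => V x - Z x with hDdef
  have hDc : Continuous D := hV.sub hZc
  have hD : ∀ η, IsTestFunction (Ioo a b) η →
      ∫ x in a..b, D x * deriv (fun y => q y * deriv η y) x = 0 := by
    intro η hη
    have hqη := hη.deriv.mul_left hq
    have hcd := hqη.deriv.1.continuous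
    have h1 : ∫ x in a..b, V x * deriv (fun y => q y * deriv η y) x = ∫ x in a..b, L x * η x := by
      have h2 := h η hη
      rw [intervalIntegral.integral_congr (g := fun x => U x * deriv (fun y => q y * deriv η y) x)
        (fun x hx => by simp only [hVU x (hIcc x hx)]), h2]
      exact intervalIntegral.integral_congr fun x hx => by simp only [hLK x (hIcc x hx)]
    have h2 : ∫ x in a..b, Z x * deriv (fun y => q y * deriv η y) x = ∫ x in a..b, L x * η x := by
      rw [hqη.integral_mul_deriv hZ (hρ.mul hPc), intervalIntegral.integral_congr
        (g := fun x => P x * deriv η x), hη.integral_mul_deriv hP hL, neg_neg]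
      intro x hx
      have := hρq' x (hIcc x hx)
      simp only
      linear_combination P x * deriv η x * this
    simp_rw [hDdef, sub_mul]
    rw [intervalIntegral.integral_sub ((hV.fun_mul hcd).intervalIntegrable _ _)
      ((hZc.fun_mul hcd).intervalIntegrable _ _), h1, h2, sub_self]
  obtain ⟨ψ₀, hψ₀, hψ₀1⟩ := exists_isTestFunction_integral_eq_one hab
  set c := ∫ x in a..b, D x * deriv (fun y => q y * ψ₀ y) x with hc
  -- The homogeneous equation only tests against `η'`. Correcting `ψ` by `m ψ₀` reaches all test
  -- functions at the cost of `c m`, and `c R` compensates this since `∫ R (q ψ)' = -m`.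
  have hDψ : ∀ ψ, IsTestFunction (Ioo a b) ψ →
      ∫ x in a..b, (D x + c * R x) * deriv (fun y => q y * ψ y) x = 0 := by
    intro ψ hψ
    have hcψ := hψ.1.continuous
    have hcψ₀ := hψ₀.1.continuous
    set m := ∫ x in a..b, ψ x with hm
    obtain ⟨η, hη, hηd⟩ := (hψ.sub (hψ₀.mul_left (contDiff_const (c := m)))).exists_deriv_eq hab (by
      rw [intervalIntegral.integral_sub (hcψ.intervalIntegrable _ _)
        ((by fun_prop : Continuous fun x => m * ψ₀ x).intervalIntegrable _ _),
        intervalIntegral.integral_const_mul, hψ₀1, mul_one, sub_self])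
    have hqψ := hψ.mul_left hq
    have hqψ₀ := hψ₀.mul_left hq
    have hcd := hqψ.deriv.1.continuous
    have hcd₀ := hqψ₀.deriv.1.continuous
    have h1 := hD η hη
    rw [hηd, show (fun y => q y * (ψ y - m * ψ₀ y)) =
      (fun y => q y * ψ y) - (fun y => m * (q y * ψ₀ y)) by ext y; simp only [Pi.sub_apply]; ring] at h1
    have h2 : ∀ x, deriv ((fun y => q y * ψ y) - (fun y => m * (q y * ψ₀ y))) x =
        deriv (fun y => q y * ψ y) x - m * deriv (fun y => q y * ψ₀ y) x := fun x =>
      ((hqψ.hasDerivAt x).sub ((hqψ₀.hasDerivAt x).const_mul m)).deriv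
    simp_rw [h2] at h1
    have h3 : ∫ x in a..b, D x * (deriv (fun y => q y * ψ y) x - m * deriv (fun y => q y * ψ₀ y) x)
        = (∫ x in a..b, D x * deriv (fun y => q y * ψ y) x) - m * c := by
      rw [hc, ← intervalIntegral.integral_const_mul, ← intervalIntegral.integral_sub
        ((hDc.fun_mul hcd).intervalIntegrable _ _)
        ((by fun_prop : Continuous fun x => m * (D x * deriv (fun y => q y * ψ₀ y) x)).intervalIntegrable _ _)]
      congr 1
      ext x
      ring
    have h4 : ∫ x in a..b, R x * deriv (fun y => q y * ψ y) x = -m := by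
      rw [hqψ.integral_mul_deriv hR hρ, hm]
      congr 1
      refine intervalIntegral.integral_congr fun x hx => ?_
      have := hρq' x (hIcc x hx)
      linear_combination ψ x * this
    have h5 : ∫ x in a..b, (D x + c * R x) * deriv (fun y => q y * ψ y) x =
        (∫ x in a..b, D x * deriv (fun y => q y * ψ y) x) +
          c * ∫ x in a..b, R x * deriv (fun y => q y * ψ y) x := by
      rw [← intervalIntegral.integral_const_mul, ← intervalIntegral.integral_add
        ((hDc.fun_mul hcd).intervalIntegrable _ _)
        ((by fun_prop : Continuous fun x => c * (R x * deriv (fun y => q y * ψ y) x)).intervalIntegrable _ _)]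
      congr 1
      ext x
      ring
    rw [h5, h4]
    linarith
  -- Taking `ψ/q` in place of `ψ` removes the weight, so du Bois-Reymond applies.
  obtain ⟨k, hk⟩ := exists_eq_const_of_forall_integral_mul_deriv_eq_zero hab
    (D := fun x => D x + c * R x) (by fun_prop) fun ψ hψ => by
      have h1 := hDψ _ (hψ.div hq fun x hx => hq0 x (Ioo_subset_Icc_self hx))
      have h2 : (fun y => q y * ((q y)⁻¹ * ψ y)) = ψ := by
        ext y
        by_cases hy : y ∈ Ioo a b
        · rw [← mul_assoc, mul_inv_cancel₀ (hq0 y (Ioo_subset_Icc_self hy)), one_mul]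
        · rw [hψ.eq_zero_of_notMem hy, mul_zero, mul_zero]
      rwa [h2] at h1
  refine ⟨fun x => P x - c, (hPc.sub continuous_const).continuousOn, fun x hx => ⟨?_, ?_⟩⟩
  · have h1 : HasDerivAt (fun x => Z x - c * R x + k) (ρ x * P x - c * ρ x) x :=
      ((hZ x).sub ((hR x).const_mul c)).add_const k
    refine (h1.congr_of_eventuallyEq ?_).congr_deriv ?_
    · filter_upwards [isOpen_Ioo.mem_nhds hx] with y hy
      have h2 := hk y hy
      simp only [hDdef, hVU y (Ioo_subset_Icc_self hy)] at h2
      linarith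
    · rw [hρq x (Ioo_subset_Icc_self hx), div_eq_mul_inv, Pi.inv_apply]
      ring
  · rw [← hLK x (Ioo_subset_Icc_self hx)]
    exact (hP x).sub_const c

/-! ### Weak gradients and integration by parts in `H¹₀` -/

/-- Integrals of products pass to the limit when one factor converges in `L²`. -/
lemma tendsto_integral_smul_of_tendsto_eLpNorm {α F : Type*} {m : MeasurableSpace α}
    {μ : Measure α} [NormedAddCommGroup F] [NormedSpace ℝ F] {a : α → ℝ} {v : ℕ → α → F} {u : α → F}
    (ha : MemLp a 2 μ) (hv : ∀ n, MemLp (v n) 2 μ) (hu : MemLp u 2 μ)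
    (h : Tendsto (fun n => eLpNorm (fun x => v n x - u x) 2 μ) atTop (𝓝 0)) :
    Tendsto (fun n => ∫ x, a x • v n x ∂μ) atTop (𝓝 (∫ x, a x • u x ∂μ)) := by
  refine tendsto_integral_of_L1' (fun x => a x • u x) (ha.1.smul hu.1)
    (Eventually.of_forall fun n => memLp_one_iff_integrable.1 ((hv n).smul ha)) ?_
  have h1 : Tendsto (fun n => eLpNorm a 2 μ * eLpNorm (fun x => v n x - u x) 2 μ) atTop (𝓝 0) := by
    have := ENNReal.Tendsto.const_mul h (Or.inr ha.2.ne) (a := eLpNorm a 2 μ)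
    rwa [mul_zero] at this
  refine tendsto_of_tendsto_of_tendsto_of_le_of_le tendsto_const_nhds h1 (fun _ => zero_le) fun n => ?_
  have h2 : ((fun x => a x • v n x) - fun x => a x • u x) = a • fun x => v n x - u x := by
    ext x
    simp [smul_sub]
  simp only [h2]
  exact eLpNorm_smul_le_mul_eLpNorm ((hv n).1.sub hu.1) ha.1

lemma MeasureTheory.MemLp.integrable_smul_of_two {α F : Type*} {m : MeasurableSpace α}
    {μ : Measure α} [NormedAddCommGroup F] [NormedSpace ℝ F] {a : α → ℝ} {u : α → F}
    (ha : MemLp a 2 μ) (hu : MemLp u 2 μ) : Integrable (fun x => a x • u x) μ :=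
  memLp_one_iff_integrable.1 (hu.smul ha)

section Sobolev

variable {E : Type*} [NormedAddCommGroup E] [InnerProductSpace ℝ E]
  {Ω : Set E} {u φ : E → ℝ} {g : E → E}

namespace IsTestFunction

lemma continuous_fderiv (h : IsTestFunction Ω φ) : Continuous (fderiv ℝ φ) :=
  h.1.continuous_fderiv (by simp)

lemma hasCompactSupport_fderiv_apply (h : IsTestFunction Ω φ) (v : E) :
    HasCompactSupport fun x => fderiv ℝ φ x v :=
  (h.2.1.fderiv (𝕜 := ℝ)).comp_left (g := fun L : E →L[ℝ] ℝ => L v) (by simp)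

lemma continuous_fderiv_apply (h : IsTestFunction Ω φ) (v : E) :
    Continuous fun x => fderiv ℝ φ x v :=
  h.continuous_fderiv.clm_apply continuous_const

section Gradient

variable [CompleteSpace E]

lemma continuous_gradient (h : IsTestFunction Ω φ) : Continuous (∇ φ) :=
  (InnerProductSpace.toDual ℝ E).symm.continuous.comp h.continuous_fderiv

lemma hasCompactSupport_gradient (h : IsTestFunction Ω φ) : HasCompactSupport (∇ φ) :=
  (h.2.1.fderiv (𝕜 := ℝ)).comp_left (map_zero (InnerProductSpace.toDual ℝ E).symm)

end Gradient

variable [MeasureSpace E] [BorelSpace E] [(volume : Measure E).IsAddHaarMeasure]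

lemma memLp (h : IsTestFunction Ω φ) (s : Set E) : MemLp φ 2 (volume.restrict s) :=
  (h.1.continuous.memLp_of_hasCompactSupport h.2.1).restrict s

lemma memLp_fderiv_apply (h : IsTestFunction Ω φ) (s : Set E) (v : E) :
    MemLp (fun x => fderiv ℝ φ x v) 2 (volume.restrict s) :=
  ((h.continuous_fderiv_apply v).memLp_of_hasCompactSupport
    (h.hasCompactSupport_fderiv_apply v)).restrict s

variable [CompleteSpace E]

lemma memLp_gradient [FiniteDimensional ℝ E] (h : IsTestFunction Ω φ) (s : Set E) :
    MemLp (∇ φ) 2 (volume.restrict s) :=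
  (h.continuous_gradient.memLp_of_hasCompactSupport h.hasCompactSupport_gradient).restrict s

lemma inner_integral_smul (h : IsTestFunction Ω φ) {s : Set E}
    (hg : MemLp g 2 (volume.restrict s)) (v : E) :
    inner ℝ v (∫ x in s, φ x • g x) = ∫ x in s, φ x * inner ℝ v (g x) := by
  rw [← integral_inner ((h.memLp s).integrable_smul_of_two hg)]
  simp_rw [inner_smul_right]

variable [FiniteDimensional ℝ E]

lemma inner_integral_smul_gradient (h : IsTestFunction Ω φ) {s : Set E}
    (hu : MemLp u 2 (volume.restrict s)) (v : E) :
    inner ℝ v (∫ x in s, u x • ∇ φ x) = ∫ x in s, fderiv ℝ φ x v * u x := by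
  rw [← integral_inner (hu.integrable_smul_of_two (h.memLp_gradient s))]
  congr 1
  ext x
  rw [inner_smul_right, inner_gradient_right]
  simp [mul_comm]

/-- Integration by parts for two test functions. -/
lemma integral_smul_gradient {Ω' : Set E} {ψ : E → ℝ}
    (h : IsTestFunction Ω φ) (h' : IsTestFunction Ω' ψ) :
    ∫ x, φ x • ∇ ψ x = -∫ x, ψ x • ∇ φ x := by
  refine ext_inner_left ℝ fun v => ?_
  have h1 := h'.inner_integral_smul_gradient (u := φ) (h.memLp univ) v
  have h2 := h.inner_integral_smul_gradient (u := ψ) (h'.memLp univ) v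
  simp only [Measure.restrict_univ] at h1 h2
  rw [inner_neg_right, h1, h2]
  have h3 := integral_mul_fderiv_eq_neg_fderiv_mul_of_integrable (μ := (volume : Measure E))
    (f := φ) (g := ψ) (v := v)
    (((h.continuous_fderiv_apply v).mul h'.1.continuous).integrable_of_hasCompactSupport
      h'.2.1.mul_left)
    ((h.1.continuous.mul (h'.continuous_fderiv_apply v)).integrable_of_hasCompactSupport
      h.2.1.mul_right)
    ((h.1.continuous.mul h'.1.continuous).integrable_of_hasCompactSupport h.2.1.mul_right)
    (fun x _ => h.1.differentiable (by simp) x) (fun x _ => h'.1.differentiable (by simp) x)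
  simp_rw [mul_comm (fderiv ℝ ψ _ v)]
  exact h3

end IsTestFunction

variable [CompleteSpace E] [MeasureSpace E] [BorelSpace E] [FiniteDimensional ℝ E]
  [(volume : Measure E).IsAddHaarMeasure]

/-- The weak gradient of a test function is its gradient. -/
lemma IsTestFunction.ae_eq_gradient (hφ : IsTestFunction Ω φ) (hΩ : IsOpen Ω)
    (h : HasH1Gradient Ω φ g) : g =ᵐ[volume.restrict Ω] ∇ φ := by
  have hint : ∀ {F : E → E}, MemLp F 2 (volume.restrict Ω) → LocallyIntegrableOn F Ω := by
    intro F hF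
    refine (locallyIntegrableOn_iff hΩ.isLocallyClosed).2 fun K hK hKc => ?_
    have hF' : MemLp F 2 (volume.restrict K) := hF.mono_measure (Measure.restrict_mono_set _ hK)
    have : IsFiniteMeasure (volume.restrict K) := ⟨by simpa using hKc.measure_lt_top⟩
    exact hF'.integrable (by norm_num)
  have h1 := hΩ.ae_eq_zero_of_integral_contDiff_smul_eq_zero (μ := volume)
    (f := fun x => g x - ∇ φ x) ((hint h.memLp_grad).sub (hint (hφ.memLp_gradient Ω)))
    fun ψ hψ1 hψ2 hψ3 => by
      have hψ : IsTestFunction Ω ψ := ⟨hψ1, hψ2, hψ3⟩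
      have h2 := h.integral_eq ψ hψ
      have h3 := hφ.integral_smul_gradient hψ
      rw [setIntegral_eq_integral_of_forall_compl_eq_zero, h3] at h2
      · have h4 : ∫ x in Ω, ψ x • g x = ∫ x, ψ x • g x :=
          setIntegral_eq_integral_of_forall_compl_eq_zero fun x hx => by
            rw [image_eq_zero_of_notMem_tsupport fun h => hx (hψ3 h), zero_smul]
        have h5 : ∫ x in Ω, ψ x • ∇ φ x = ∫ x, ψ x • ∇ φ x :=
          setIntegral_eq_integral_of_forall_compl_eq_zero fun x hx => by
            rw [image_eq_zero_of_notMem_tsupport fun h => hx (hψ3 h), zero_smul]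
        have h6 : ∫ x, ψ x • (g x - ∇ φ x) = ∫ x in Ω, ψ x • (g x - ∇ φ x) :=
          (setIntegral_eq_integral_of_forall_compl_eq_zero fun x hx => by
            rw [image_eq_zero_of_notMem_tsupport fun h => hx (hψ3 h), zero_smul]).symm
        simp_rw [h6, smul_sub]
        rw [integral_sub ((hψ.memLp Ω).integrable_smul_of_two h.memLp_grad)
          ((hψ.memLp Ω).integrable_smul_of_two (hφ.memLp_gradient Ω)), h5,
          neg_injective h2, sub_self]
      · intro x hx
        rw [image_eq_zero_of_notMem_tsupport fun h => hx (hφ.2.2 h), zero_smul]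
  rw [Filter.EventuallyEq, ae_restrict_iff' hΩ.measurableSet]
  filter_upwards [h1] with x hx hxΩ
  exact sub_eq_zero.1 (hx hxΩ)

/-- A function in `H¹₀(Ω)` may be integrated by parts without boundary terms against test
functions on the whole space. -/
lemma MemH10.exists_hasH1Gradient (hΩ : IsOpen Ω) (hu : MemH10 Ω u) :
    ∃ g, HasH1Gradient Ω u g ∧ ∀ a : E → ℝ, IsTestFunction univ a →
      ∫ x in Ω, u x • ∇ a x = -∫ x in Ω, a x • g x := by
  obtain ⟨φ, hφ, G, g, hG, hg, hlim, hlimg⟩ := hu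
  refine ⟨g, hg, fun a ha => ?_⟩
  have hk : ∀ k, ∫ x in Ω, φ k x • ∇ a x = -∫ x in Ω, a x • G k x := by
    intro k
    rw [setIntegral_eq_integral_of_forall_compl_eq_zero, (hφ k).integral_smul_gradient ha]
    · congr 1
      have h1 : ∫ x in Ω, a x • G k x = ∫ x in Ω, a x • ∇ (φ k) x := by
        refine integral_congr_ae ?_
        filter_upwards [(hφ k).ae_eq_gradient hΩ (hG k)] with x hx
        rw [hx]
      rw [h1]
      refine (setIntegral_eq_integral_of_forall_compl_eq_zero fun x hx => ?_).symm
      have hx' : x ∉ tsupport (φ k) := fun h => hx ((hφ k).2.2 h)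
      have h2 : fderiv ℝ (φ k) x = 0 := image_eq_zero_of_notMem_tsupport fun h =>
        hx' (tsupport_fderiv_subset ℝ h)
      rw [gradient, h2, map_zero, smul_zero]
    · intro x hx
      rw [image_eq_zero_of_notMem_tsupport fun h => hx ((hφ k).2.2 h), zero_smul]
  -- The identity holds for each approximating `φ k`. Testing it in a fixed direction `v` reduces
  -- the gradient pairing to a scalar integral, and both sides pass to the `L²` limit.
  refine ext_inner_left ℝ fun v => ?_
  have h1 : Tendsto (fun k => inner ℝ v (∫ x in Ω, φ k x • ∇ a x)) atTop
      (𝓝 (inner ℝ v (∫ x in Ω, u x • ∇ a x))) := by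
    simp_rw [ha.inner_integral_smul_gradient hg.memLp,
      fun k => ha.inner_integral_smul_gradient (u := φ k) (hG k).memLp v]
    exact tendsto_integral_smul_of_tendsto_eLpNorm (ha.memLp_fderiv_apply Ω v)
      (fun k => (hG k).memLp) hg.memLp hlim
  have h2 : Tendsto (fun k => inner ℝ v (-∫ x in Ω, a x • G k x)) atTop
      (𝓝 (inner ℝ v (-∫ x in Ω, a x • g x))) :=
    tendsto_const_nhds.inner (tendsto_integral_smul_of_tendsto_eLpNorm (ha.memLp Ω)
      (fun k => (hG k).memLp_grad) hg.memLp_grad hlimg).neg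
  simp_rw [hk] at h1
  exact tendsto_nhds_unique h1 h2

end Sobolev

/-! ### Radial test functions and radial fields -/

section Radial

variable {E : Type*} [NormedAddCommGroup E] [InnerProductSpace ℝ E]

/-- Composition is with `‖x‖ ^ 2`, not `‖x‖`, so that smoothness at the origin needs no argument. -/
lemma IsTestFunction.comp_norm_sq [FiniteDimensional ℝ E] {s : Set ℝ} {h : ℝ → ℝ} (hh : IsTestFunction s h) :
    IsTestFunction ((fun x : E => ‖x‖ ^ 2) ⁻¹' s) (fun x : E => h (‖x‖ ^ 2)) := by
  have hts : tsupport (fun x : E => h (‖x‖ ^ 2)) ⊆ (fun x : E => ‖x‖ ^ 2) ⁻¹' tsupport h :=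
    tsupport_comp_subset_preimage h (f := fun x : E => ‖x‖ ^ 2) (by fun_prop)
  refine ⟨hh.1.comp (contDiff_norm_sq ℝ), ?_, hts.trans (preimage_mono hh.2.2)⟩
  obtain ⟨B, hB⟩ := hh.2.1.isCompact.isBounded.bddAbove
  refine Metric.isCompact_of_isClosed_isBounded (isClosed_tsupport _)
    ((Metric.isBounded_closedBall (x := (0:E)) (r := √B)).subset fun x hx => ?_)
  rw [mem_closedBall_zero_iff]
  exact Real.le_sqrt_of_sq_le (hB (hts hx))

lemma IsTestFunction.comp_norm_sq_mul_inner [FiniteDimensional ℝ E] {s : Set ℝ} {h : ℝ → ℝ} (hh : IsTestFunction s h)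
    (v : E) :
    IsTestFunction ((fun x : E => ‖x‖ ^ 2) ⁻¹' s) (fun x : E => h (‖x‖ ^ 2) * inner ℝ v x) :=
  ⟨(hh.comp_norm_sq (E := E)).1.mul (contDiff_const.inner ℝ contDiff_id),
    (hh.comp_norm_sq (E := E)).2.1.mul_right,
    tsupport_mul_subset_left.trans (hh.comp_norm_sq (E := E)).2.2⟩

lemma hasFDerivAt_comp_norm_sq {h : ℝ → ℝ} (hh : ContDiff ℝ ∞ h) (x : E) :
    HasFDerivAt (fun x : E => h (‖x‖ ^ 2)) (deriv h (‖x‖ ^ 2) • 2 • innerSL ℝ x) x :=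
  ((hh.differentiable (by simp) (‖x‖ ^ 2)).hasDerivAt.comp_hasFDerivAt x
    (hasStrictFDerivAt_norm_sq x).hasFDerivAt)

lemma gradient_comp_norm_sq [CompleteSpace E] {h : ℝ → ℝ} (hh : ContDiff ℝ ∞ h) (x y : E) :
    inner ℝ y (∇ (fun x : E => h (‖x‖ ^ 2)) x) = 2 * deriv h (‖x‖ ^ 2) * inner ℝ x y := by
  rw [inner_gradient_right, (hasFDerivAt_comp_norm_sq hh x).fderiv]
  simp
  ring

lemma fderiv_comp_norm_sq_mul_inner {h : ℝ → ℝ} (hh : ContDiff ℝ ∞ h) (x v : E) :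
    fderiv ℝ (fun x : E => h (‖x‖ ^ 2) * inner ℝ v x) x v =
      h (‖x‖ ^ 2) * ‖v‖ ^ 2 + 2 * deriv h (‖x‖ ^ 2) * inner ℝ v x ^ 2 := by
  have h1 : HasFDerivAt (fun x : E => inner ℝ v x) (innerSL ℝ v) x := (innerSL ℝ v).hasFDerivAt
  rw [((hasFDerivAt_comp_norm_sq hh x).fun_mul h1).fderiv]
  simp [real_inner_comm v x]
  ring

end Radial

/-- The weak divergence theorem for the radial field `h(|x|²) x`. -/
lemma integral_divergence_eq {N : ℕ} {Ω : Set (EuclideanSpace ℝ (Fin N))} {s : Set ℝ}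
    {u : EuclideanSpace ℝ (Fin N) → ℝ}
    {g : EuclideanSpace ℝ (Fin N) → EuclideanSpace ℝ (Fin N)} {h : ℝ → ℝ}
    (hh : IsTestFunction s h) (hu : MemLp u 2 (volume.restrict Ω))
    (hg : MemLp g 2 (volume.restrict Ω))
    (hid : ∀ v : EuclideanSpace ℝ (Fin N),
      ∫ x in Ω, u x • ∇ (fun x => h (‖x‖ ^ 2) * inner ℝ v x) x =
        -∫ x in Ω, (h (‖x‖ ^ 2) * inner ℝ v x) • g x) :
    ∫ x in Ω, (N * h (‖x‖ ^ 2) + 2 * ‖x‖ ^ 2 * deriv h (‖x‖ ^ 2)) * u x =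
      -∫ x in Ω, h (‖x‖ ^ 2) * inner ℝ x (g x) := by
  set e := EuclideanSpace.basisFun (Fin N) ℝ with he
  have ht : ∀ v : EuclideanSpace ℝ (Fin N), IsTestFunction _ fun x => h (‖x‖ ^ 2) * inner ℝ v x :=
    fun v => hh.comp_norm_sq_mul_inner v
  have h1 : ∀ i, ∫ x in Ω, (h (‖x‖ ^ 2) + 2 * deriv h (‖x‖ ^ 2) * inner ℝ (e i) x ^ 2) * u x =
      -∫ x in Ω, h (‖x‖ ^ 2) * inner ℝ (e i) x * inner ℝ (e i) (g x) := by
    intro i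
    have h2 := congrArg (inner ℝ (e i)) (hid (e i))
    rw [inner_neg_right, (ht (e i)).inner_integral_smul_gradient hu,
      (ht (e i)).inner_integral_smul hg] at h2
    simp_rw [fderiv_comp_norm_sq_mul_inner hh.1] at h2
    simpa [e.norm_eq_one] using h2
  have hi1 : ∀ i, Integrable (fun x => (h (‖x‖ ^ 2) + 2 * deriv h (‖x‖ ^ 2) * inner ℝ (e i) x ^ 2)
      * u x) (volume.restrict Ω) := by
    intro i
    have := ((ht (e i)).memLp_fderiv_apply Ω (e i)).integrable_smul_of_two hu
    simp_rw [fderiv_comp_norm_sq_mul_inner hh.1] at this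
    simpa [e.norm_eq_one] using this
  have hi2 : ∀ i, Integrable (fun x => h (‖x‖ ^ 2) * inner ℝ (e i) x * inner ℝ (e i) (g x))
      (volume.restrict Ω) := fun i =>
    ((ht (e i)).memLp Ω).integrable_smul_of_two (hg.const_inner (e i))
  -- Summing over an orthonormal basis assembles the directional derivatives of the components into
  -- the divergence of `h(|x|²) x`.
  have h3 := Finset.sum_congr rfl fun i (_ : i ∈ Finset.univ) => h1 i
  rw [Finset.sum_neg_distrib, ← integral_finsetSum _ fun i _ => hi1 i,
    ← integral_finsetSum _ fun i _ => hi2 i] at h3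
  have hin : ∀ x y : EuclideanSpace ℝ (Fin N), ∑ i, inner ℝ (e i) x * inner ℝ (e i) y =
      inner ℝ x y := fun x y => by
    rw [← e.sum_inner_mul_inner x y]
    simp_rw [real_inner_comm]
  have hsq : ∀ x : EuclideanSpace ℝ (Fin N), ∑ i, inner ℝ (e i) x ^ 2 = ‖x‖ ^ 2 := fun x => by
    simp_rw [sq, hin, real_inner_self_eq_norm_mul_norm]
  convert h3 using 1
  · congr 1
    ext x
    rw [← Finset.sum_mul, Finset.sum_add_distrib, ← Finset.mul_sum, hsq, Finset.sum_const,
      Finset.card_univ, Fintype.card_fin, nsmul_eq_mul]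
    ring
  · congr 2
    ext x
    simp_rw [mul_assoc]
    rw [← Finset.mul_sum, hin]

/-! ### The annulus in polar coordinates: radial weak equation and boundary values -/

lemma isOpen_annulus (N : ℕ) : IsOpen (annulus N) :=
  (isOpen_lt continuous_const continuous_norm).inter (isOpen_lt continuous_norm continuous_const)

lemma annulus_subset_closedBall (N : ℕ) : annulus N ⊆ Metric.closedBall 0 2 := fun x hx => by
  rw [mem_closedBall_zero_iff]
  exact hx.2.le

instance isFiniteMeasure_restrict_annulus (N : ℕ) :
    IsFiniteMeasure ((volume : Measure (EuclideanSpace ℝ (Fin N))).restrict (annulus N)) :=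
  ⟨by
    rw [Measure.restrict_apply_univ]
    exact (measure_mono (annulus_subset_closedBall N)).trans_lt measure_closedBall_lt_top⟩

lemma preimage_norm_sq_eq_annulus (N : ℕ) :
    (fun x : EuclideanSpace ℝ (Fin N) => ‖x‖ ^ 2) ⁻¹' Ioo 1 4 = annulus N := by
  ext x
  have := norm_nonneg x
  simp only [mem_preimage, mem_Ioo, annulus, mem_ofPred_eq]
  constructor
  · rintro ⟨h1, h2⟩
    constructor <;> nlinarith
  · rintro ⟨h1, h2⟩
    constructor <;> nlinarith

/-- Integration of radial functions over the annulus. -/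
lemma exists_integral_annulus_eq {N : ℕ} (hN : 1 ≤ N) :
    ∃ c : ℝ, 0 < c ∧ ∀ F : ℝ → ℝ,
      ∫ x in annulus N, F ‖x‖ = c * ∫ r in (1:ℝ)..2, r ^ (N - 1) * F r := by
  have : NeZero N := ⟨by omega⟩
  have hball : 0 < (volume : Measure (EuclideanSpace ℝ (Fin N))).real (Metric.ball 0 1) :=
    ENNReal.toReal_pos (Metric.measure_ball_pos _ _ one_pos).ne' measure_ball_lt_top.ne
  refine ⟨N * (volume : Measure (EuclideanSpace ℝ (Fin N))).real (Metric.ball 0 1),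
    mul_pos (by exact_mod_cast hN) hball, fun F => ?_⟩
  have h1 := integral_fun_norm_addHaar (volume : Measure (EuclideanSpace ℝ (Fin N)))
    ((Ioo (1:ℝ) 2).indicator F)
  rw [← integral_indicator (isOpen_annulus N).measurableSet]
  have h2 : (annulus N).indicator (fun x => F ‖x‖) = fun x => (Ioo (1:ℝ) 2).indicator F ‖x‖ := by
    ext x
    rfl
  rw [h2, h1]
  have h3 : ∫ y in Ioi (0:ℝ), y ^ (N - 1) • (Ioo (1:ℝ) 2).indicator F y =
      ∫ r in (1:ℝ)..2, r ^ (N - 1) * F r := by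
    rw [intervalIntegral.integral_of_le one_le_two, integral_Ioc_eq_integral_Ioo]
    have h4 : ∀ y : ℝ, y ^ (N - 1) • (Ioo (1:ℝ) 2).indicator F y =
        (Ioo (1:ℝ) 2).indicator (fun r => r ^ (N - 1) * F r) y := fun y => by
      by_cases hy : y ∈ Ioo (1:ℝ) 2 <;> simp [hy]
    simp_rw [h4]
    rw [setIntegral_indicator measurableSet_Ioo]
    congr 2
    exact inter_eq_right.2 fun y hy => lt_trans one_pos hy.1
  rw [finrank_euclideanSpace_fin, h3]
  simp [mul_assoc]

/-- The divergence identity for a radial function on the annulus, in the radial variable. -/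
lemma integral_profile_mul_deriv_eq {N : ℕ} {s : Set ℝ} {c : ℝ}
    (hc : ∀ F : ℝ → ℝ, ∫ x in annulus N, F ‖x‖ = c * ∫ r in (1:ℝ)..2, r ^ (N - 1) * F r)
    (hN : 1 ≤ N) {u : EuclideanSpace ℝ (Fin N) → ℝ}
    {g : EuclideanSpace ℝ (Fin N) → EuclideanSpace ℝ (Fin N)} {h U : ℝ → ℝ}
    (hh : IsTestFunction s h) (hu : HasH1Gradient (annulus N) u g) (hU : IsRadialProfile N u U)
    (hid : ∀ v : EuclideanSpace ℝ (Fin N),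
      ∫ x in annulus N, u x • ∇ (fun x => h (‖x‖ ^ 2) * inner ℝ v x) x =
        -∫ x in annulus N, (h (‖x‖ ^ 2) * inner ℝ v x) • g x) :
    c * ∫ r in (1:ℝ)..2, U r * deriv (fun r => r ^ N * h (r ^ 2)) r =
      -∫ x in annulus N, h (‖x‖ ^ 2) * inner ℝ x (g x) := by
  rw [← integral_divergence_eq hh hu.memLp hu.memLp_grad hid]
  have h1 : ∫ x in annulus N, (N * h (‖x‖ ^ 2) + 2 * ‖x‖ ^ 2 * deriv h (‖x‖ ^ 2)) * u x =
      ∫ x in annulus N, (N * h (‖x‖ ^ 2) + 2 * ‖x‖ ^ 2 * deriv h (‖x‖ ^ 2)) * U ‖x‖ := by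
    refine integral_congr_ae ?_
    filter_upwards [hU.2] with x hx
    rw [hx]
  rw [h1, hc fun r => (N * h (r ^ 2) + 2 * r ^ 2 * deriv h (r ^ 2)) * U r]
  congr 1
  refine intervalIntegral.integral_congr fun r _ => ?_
  have h2 : HasDerivAt (fun r => h (r ^ 2)) (deriv h (r ^ 2) * (2 * r)) r := by
    have h3 := (hh.1.differentiable (by simp) (r ^ 2)).hasDerivAt.comp r (hasDerivAt_pow 2 r)
    exact h3.congr_deriv (by simp)
  have h4 : HasDerivAt (fun r : ℝ => r ^ N * h (r ^ 2))
      (N * r ^ (N - 1) * h (r ^ 2) + r ^ N * (deriv h (r ^ 2) * (2 * r))) r :=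
    (hasDerivAt_pow N r).mul h2
  rw [h4.deriv]
  obtain ⟨k, rfl⟩ : ∃ k, N = k + 1 := ⟨N - 1, by omega⟩
  simp only [Nat.add_sub_cancel]
  ring

/-- Converts a test function of `r` into one of `s = r²`; the singularity of the square root at `0`
lies outside the support. -/
lemma IsTestFunction.comp_sqrt {η : ℝ → ℝ} (h : IsTestFunction (Ioo 1 2) η) :
    IsTestFunction (Ioo 1 4) (fun s => η √s) := by
  have hts : tsupport (fun s => η √s) ⊆ Real.sqrt ⁻¹' tsupport η :=
    tsupport_comp_subset_preimage η (f := Real.sqrt) Real.continuous_sqrt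
  have hsub : tsupport (fun s => η √s) ⊆ Ioo 1 4 := fun s hs => by
    obtain ⟨h1, h2⟩ := h.2.2 (hts hs)
    have h3 : 0 < s := Real.sqrt_pos.1 (one_pos.trans h1)
    have h4 := Real.sq_sqrt h3.le
    constructor <;> nlinarith
  refine ⟨contDiff_iff_contDiffAt.2 fun s => ?_,
    Metric.isCompact_of_isClosed_isBounded (isClosed_tsupport _) ((Metric.isBounded_Ioo 1 4).subset hsub),
    hsub⟩
  rcases lt_or_ge s 1 with hs | hs
  · refine (contDiffAt_const (c := (0:ℝ))).congr_of_eventuallyEq ?_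
    filter_upwards [isOpen_Iio.mem_nhds hs] with t ht
    exact image_eq_zero_of_notMem_tsupport (f := fun s => η √s) fun h' => absurd (hsub h').1 (not_lt.2 ht.le)
  · exact h.1.contDiffAt.comp s (Real.contDiffAt_sqrt (by linarith))

/-- By continuity, a negative value of the profile would make `U ‖x‖` negative on a nonempty open
set, which has positive measure. -/
lemma IsRadialProfile.nonneg {N : ℕ} (hN : 1 ≤ N) {u : EuclideanSpace ℝ (Fin N) → ℝ} {U : ℝ → ℝ}
    (hU : IsRadialProfile N u U) (hpos : ∀ᵐ x ∂(volume.restrict (annulus N)), 0 < u x) :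
    ∀ r ∈ Ioo (1:ℝ) 2, 0 ≤ U r := by
  intro r hr
  by_contra hneg
  rw [not_le] at hneg
  have hc : ContinuousOn (fun x : EuclideanSpace ℝ (Fin N) => U ‖x‖) (annulus N) :=
    hU.1.comp continuous_norm.continuousOn fun x hx => ⟨hx.1.le, hx.2.le⟩
  have ho := hc.isOpen_inter_preimage (isOpen_annulus N) (isOpen_Iio (a := (0:ℝ)))
  have h0 : volume (annulus N ∩ (fun x : EuclideanSpace ℝ (Fin N) => U ‖x‖) ⁻¹' Iio 0) = 0 := by
    have h1 : ∀ᵐ x ∂(volume.restrict (annulus N)), ¬ U ‖x‖ < 0 := by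
      filter_upwards [hU.2, hpos] with x hx hx'
      rw [← hx]
      exact not_lt.2 hx'.le
    rw [ae_iff, Measure.restrict_apply₀' (isOpen_annulus N).measurableSet.nullMeasurableSet] at h1
    simp only [not_not] at h1
    rw [inter_comm]
    exact h1
  replace h0 := (ho.measure_eq_zero_iff volume).1 h0
  have hn : ‖(EuclideanSpace.single (⟨0, by omega⟩ : Fin N) r : EuclideanSpace ℝ (Fin N))‖ = r := by
    rw [PiLp.norm_single, Real.norm_eq_abs, abs_of_pos (one_pos.trans hr.1)]
  have hmem : (EuclideanSpace.single (⟨0, by omega⟩ : Fin N) r : EuclideanSpace ℝ (Fin N)) ∈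
      annulus N ∩ (fun x : EuclideanSpace ℝ (Fin N) => U ‖x‖) ⁻¹' Iio 0 := by
    refine ⟨⟨by rw [hn]; exact hr.1, by rw [hn]; exact hr.2⟩, ?_⟩
    rw [mem_preimage, hn]
    exact hneg
  rw [h0] at hmem
  exact hmem

lemma IsRadialProfile.not_eqOn_zero {N : ℕ} (hN : 1 ≤ N) {u : EuclideanSpace ℝ (Fin N) → ℝ}
    {U : ℝ → ℝ} (hU : IsRadialProfile N u U)
    (hpos : ∀ᵐ x ∂(volume.restrict (annulus N)), 0 < u x) : ¬ ∀ r ∈ Ioo (1:ℝ) 2, U r = 0 := by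
  intro h0
  have h1 : ∀ᵐ x ∂(volume.restrict (annulus N)), False := by
    filter_upwards [hU.2, hpos, ae_restrict_mem (isOpen_annulus N).measurableSet] with x hx hx' hm
    rw [hx, h0 _ hm] at hx'
    exact lt_irrefl _ hx'
  have h2 : volume (annulus N) = 0 := by
    have : volume.restrict (annulus N) = 0 := by
      rwa [eventually_false_iff_eq_bot, ae_eq_bot] at h1
    rwa [Measure.restrict_eq_zero] at this
  replace h2 := ((isOpen_annulus N).measure_eq_zero_iff volume).1 h2
  have hn : ‖(EuclideanSpace.single (⟨0, by omega⟩ : Fin N) (3 / 2 : ℝ) :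
      EuclideanSpace ℝ (Fin N))‖ = 3 / 2 := by
    rw [PiLp.norm_single, Real.norm_eq_abs, abs_of_pos (by norm_num)]
  have hmem : (EuclideanSpace.single (⟨0, by omega⟩ : Fin N) (3 / 2 : ℝ) :
      EuclideanSpace ℝ (Fin N)) ∈ annulus N := by
    constructor <;> rw [hn] <;> norm_num
  rw [h2] at hmem
  exact hmem

lemma HasH1Gradient.integrable_inner_gradient {N : ℕ} {Ω s : Set (EuclideanSpace ℝ (Fin N))}
    {u φ : EuclideanSpace ℝ (Fin N) → ℝ}
    {g : EuclideanSpace ℝ (Fin N) → EuclideanSpace ℝ (Fin N)} (hu : HasH1Gradient Ω u g)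
    (hφ : IsTestFunction s φ) :
    Integrable (fun x => inner ℝ (g x) (∇ φ x)) (volume.restrict Ω) := by
  have h1 := hu.memLp_grad.norm.integrable_mul (hφ.memLp_gradient Ω).norm
  exact h1.mono' (hu.memLp_grad.1.inner (hφ.memLp_gradient Ω).1)
    (ae_of_all _ fun x => norm_inner_le_norm _ _)

/-- The radial profile of a weak solution solves the radial equation in the sense of
distributions. -/
lemma IsWeakSolution.integral_profile_eq {N : ℕ} (hN : 1 ≤ N) {p lam : ℝ} (hp : 2 < p)
    {u : EuclideanSpace ℝ (Fin N) → ℝ} {U : ℝ → ℝ} (hu : IsWeakSolution (annulus N) p lam u)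
    (hU : IsRadialProfile N u U) {η : ℝ → ℝ} (hη : IsTestFunction (Ioo 1 2) η) :
    ∫ r in (1:ℝ)..2, U r * deriv (fun r => r ^ (N - 1) * deriv η r) r =
      ∫ r in (1:ℝ)..2, r ^ (N - 1) * (lam * U r - |U r| ^ (p - 2) * U r) * η r := by
  obtain ⟨c, hc0, hc⟩ := exists_integral_annulus_eq hN
  obtain ⟨g, hg, hweak⟩ := hu
  have hh := hη.comp_sqrt
  set h : ℝ → ℝ := fun s => η √s with hdef
  have hφ : IsTestFunction (annulus N) fun x => h (‖x‖ ^ 2) := by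
    rw [← preimage_norm_sq_eq_annulus]
    exact hh.comp_norm_sq
  -- The gradient of `h(|x|²)` is the radial field `2 h'(|x|²) x`, so the divergence identity is
  -- applied with `2 h'` in place of `h`.
  have hk : IsTestFunction (Ioo 1 4) fun s => 2 * deriv h s := hh.deriv.mul_left contDiff_const
  have hdiv := integral_profile_mul_deriv_eq hc hN hk hg hU fun v => hg.integral_eq _ <| by
    rw [← preimage_norm_sq_eq_annulus]
    exact hk.comp_norm_sq_mul_inner v
  have hh2 : ∀ r : ℝ, 0 ≤ r → h (r ^ 2) = η r := fun r hr => by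
    simp only [hdef, Real.sqrt_sq hr]
  have hflux : ∀ r : ℝ, 0 < r → r ^ N * (2 * deriv h (r ^ 2)) = r ^ (N - 1) * deriv η r := by
    intro r hr
    have h3 := (hh.1.differentiable (by simp) (r ^ 2)).hasDerivAt.comp r (hasDerivAt_pow 2 r)
    have h4 : η =ᶠ[𝓝 r] h ∘ fun r => r ^ 2 := by
      filter_upwards [lt_mem_nhds hr] with t ht
      exact (hh2 t ht.le).symm
    rw [(h3.congr_of_eventuallyEq h4).deriv]
    obtain ⟨k, rfl⟩ : ∃ k, N = k + 1 := ⟨N - 1, by omega⟩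
    simp
    ring
  have hleft : ∫ r in (1:ℝ)..2, U r * deriv (fun r => r ^ N * (2 * deriv h (r ^ 2))) r =
      ∫ r in (1:ℝ)..2, U r * deriv (fun r => r ^ (N - 1) * deriv η r) r := by
    refine intervalIntegral.integral_congr fun r hr => ?_
    rw [uIcc_of_le one_le_two] at hr
    have : (fun r : ℝ => r ^ N * (2 * deriv h (r ^ 2))) =ᶠ[𝓝 r]
        fun r => r ^ (N - 1) * deriv η r := by
      filter_upwards [lt_mem_nhds (one_pos.trans_le hr.1)] with t ht
      exact hflux t ht
    simp only [this.deriv_eq]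
  rw [hleft] at hdiv
  have hw := hweak _ hφ
  have hi1 := hg.integrable_inner_gradient hφ
  have hi2 : Integrable (fun x => lam * u x * h (‖x‖ ^ 2)) (volume.restrict (annulus N)) := by
    have := (hg.memLp.integrable_smul_of_two (hφ.memLp (annulus N))).const_mul lam
    simpa [mul_assoc] using this
  rw [integral_add hi1 hi2] at hw
  have h1 : ∫ x in annulus N, inner ℝ (g x) (∇ (fun x => h (‖x‖ ^ 2)) x) =
      ∫ x in annulus N, 2 * deriv h (‖x‖ ^ 2) * inner ℝ x (g x) := by
    congr 1
    ext x
    rw [gradient_comp_norm_sq hh.1]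
  have h2 : ∫ x in annulus N, lam * u x * h (‖x‖ ^ 2) =
      ∫ x in annulus N, lam * U ‖x‖ * η ‖x‖ := by
    refine integral_congr_ae ?_
    filter_upwards [hU.2] with x hx
    rw [hx, hh2 _ (norm_nonneg x)]
  have h3 : ∫ x in annulus N, |u x| ^ (p - 2) * u x * h (‖x‖ ^ 2) =
      ∫ x in annulus N, |U ‖x‖| ^ (p - 2) * U ‖x‖ * η ‖x‖ := by
    refine integral_congr_ae ?_
    filter_upwards [hU.2] with x hx
    rw [hx, hh2 _ (norm_nonneg x)]
  rw [h1, h2, h3, hc fun r => lam * U r * η r, hc fun r => |U r| ^ (p - 2) * U r * η r] at hw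
  have hcU := hU.1
  have hcη := hη.1.continuous.continuousOn (s := Icc (1:ℝ) 2)
  have hcp : ContinuousOn (fun r : ℝ => r ^ (N - 1)) (Icc 1 2) := (continuous_pow _).continuousOn
  have hcA : ContinuousOn (fun r => |U r| ^ (p - 2)) (Icc 1 2) :=
    hcU.abs.rpow_const fun _ _ => Or.inr (by linarith)
  have h4 : ∫ r in (1:ℝ)..2, r ^ (N - 1) * (lam * U r - |U r| ^ (p - 2) * U r) * η r =
      (∫ r in (1:ℝ)..2, r ^ (N - 1) * (lam * U r * η r)) -
        ∫ r in (1:ℝ)..2, r ^ (N - 1) * (|U r| ^ (p - 2) * U r * η r) := by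
    rw [← intervalIntegral.integral_sub]
    · congr 1
      ext r
      ring
    · exact (hcp.mul ((continuousOn_const.mul hcU).mul hcη)).intervalIntegrable_of_Icc one_le_two
    · exact (hcp.mul ((hcA.mul hcU).mul hcη)).intervalIntegrable_of_Icc one_le_two
  rw [h4]
  have h5 : ∫ x in annulus N, 2 * deriv h (‖x‖ ^ 2) * inner ℝ x (g x) =
      -(c * ∫ r in (1:ℝ)..2, U r * deriv (fun r => r ^ (N - 1) * deriv η r) r) := by
    rw [hdiv, neg_neg]
  rw [h5] at hw
  refine mul_left_cancel₀ hc0.ne' ?_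
  linarith

/-- The profile of a radial function in `H¹₀` of the annulus vanishes at both ends, as soon as it
is `C¹` up to the boundary. -/
lemma IsRadialProfile.eq_zero_of_memH10 {N : ℕ} (hN : 1 ≤ N)
    {u : EuclideanSpace ℝ (Fin N) → ℝ} {U U₁ : ℝ → ℝ} (hu : MemH10 (annulus N) u)
    (hU : IsRadialProfile N u U) (hU₁ : ContinuousOn U₁ (Icc 1 2))
    (hd : ∀ r ∈ Ioo (1:ℝ) 2, HasDerivAt U (U₁ r) r) : U 1 = 0 ∧ U 2 = 0 := by
  obtain ⟨c, hc0, hc⟩ := exists_integral_annulus_eq hN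
  obtain ⟨g, hg, hga⟩ := hu.exists_hasH1Gradient (isOpen_annulus N)
  -- Cutoffs in `s = r²` concentrating at an end value `s₀`. For `H¹₀` functions the integration by
  -- parts has no boundary term, while the classical one for `U` has one; comparing them leaves
  -- integrals over shrinking shells, which vanish in the limit.
  set β : ContDiffBump (0:ℝ) := ⟨1, 2, one_pos, one_lt_two⟩ with hβ
  have hβ1 : β 0 = 1 := β.one_of_mem_closedBall (by simp [hβ])
  have hβ0 : ∀ x : ℝ, 2 ≤ |x| → β x = 0 := fun x hx => β.zero_of_le_dist (by simpa using hx)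
  have hβc : ContDiff ℝ ∞ β := β.contDiff
  have hβle : ∀ x : ℝ, |β x| ≤ 1 := fun x => by
    rw [abs_of_nonneg β.nonneg]; exact β.le_one
  have key : ∀ s₀ : ℝ, s₀ ∉ Ioo (1:ℝ) 4 → Tendsto (fun n : ℕ =>
      U 2 * (2 ^ N * β ((n + 1) * (4 - s₀))) - U 1 * β ((n + 1) * (1 - s₀))) atTop (𝓝 0) := by
    intro s₀ hs₀
    set h : ℕ → ℝ → ℝ := fun n s => β ((n + 1) * (s - s₀)) with hdef
    have hh : ∀ n, IsTestFunction univ (h n) := by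
      intro n
      have hn : (0:ℝ) < n + 1 := by positivity
      refine ⟨hβc.comp (by fun_prop), ?_, subset_univ _⟩
      refine HasCompactSupport.of_support_subset_isCompact
        (isCompact_closedBall s₀ (2 / ((n:ℝ) + 1))) fun s hs => ?_
      by_contra hcon
      refine hs (hβ0 _ ?_)
      rw [Metric.mem_closedBall, Real.dist_eq, not_le, div_lt_iff₀ hn] at hcon
      rw [abs_mul, abs_of_pos hn]
      linarith
    have hlim0 : ∀ s : ℝ, s ≠ s₀ → ∀ᶠ n in atTop, h n s = 0 := by
      intro s hs
      have hpos : 0 < |s - s₀| := abs_pos.2 (sub_ne_zero.2 hs)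
      have ht : Tendsto (fun n : ℕ => ((n:ℝ) + 1) * |s - s₀|) atTop atTop :=
        (tendsto_atTop_add_const_right _ 1 tendsto_natCast_atTop_atTop).atTop_mul_const hpos
      filter_upwards [ht.eventually_ge_atTop 2] with n hn
      refine hβ0 _ ?_
      rwa [abs_mul, abs_of_pos (show (0:ℝ) < n + 1 by positivity)]
    have hne : ∀ s ∈ Ioo (1:ℝ) 4, s ≠ s₀ := fun s hs hs' => hs₀ (hs' ▸ hs)
    have hparts : ∀ n : ℕ, U 2 * (2 ^ N * β ((n + 1) * (4 - s₀))) - U 1 * β ((n + 1) * (1 - s₀)) =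
        (∫ r in (1:ℝ)..2, U₁ r * (r ^ N * h n (r ^ 2))) -
          c⁻¹ * ∫ x in annulus N, h n (‖x‖ ^ 2) * inner ℝ x (g x) := by
      intro n
      have h1 := integral_profile_mul_deriv_eq hc hN (hh n) hg hU fun v => hga _ <| by
        simpa using (hh n).comp_norm_sq_mul_inner v
      have hsm : ContDiff ℝ ∞ fun r : ℝ => r ^ N * h n (r ^ 2) :=
        (contDiff_id.pow N).mul ((hh n).1.comp (contDiff_id.pow 2))
      have h2 := intervalIntegral.integral_mul_deriv_eq_deriv_mul_of_hasDerivAt (a := 1) (b := 2)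
        (u := U) (u' := U₁) (v := fun r : ℝ => r ^ N * h n (r ^ 2))
        (v' := deriv fun r : ℝ => r ^ N * h n (r ^ 2))
        (by rw [uIcc_of_le one_le_two]; exact hU.1) hsm.continuous.continuousOn
        (by rw [min_eq_left one_le_two, max_eq_right one_le_two]; exact hd)
        (fun r _ => (hsm.differentiable (by simp) r).hasDerivAt)
        (hU₁.intervalIntegrable_of_Icc one_le_two)
        ((hsm.continuous_deriv (by simp)).intervalIntegrable _ _)
      rw [h2] at h1
      have h3 : (2:ℝ) ^ 2 = 4 := by norm_num
      simp only [h3, one_pow, one_mul, hdef] at h1 ⊢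
      rw [eq_sub_iff_add_eq, ← sub_eq_zero]
      have h4 : ∫ x in annulus N, β ((n + 1) * (‖x‖ ^ 2 - s₀)) * inner ℝ x (g x) =
        -(c * (U 2 * (2 ^ N * β ((n + 1) * (4 - s₀))) - U 1 * β ((n + 1) * (1 - s₀)) -
          ∫ r in (1:ℝ)..2, U₁ r * (r ^ N * β ((n + 1) * (r ^ 2 - s₀))))) := by
        rw [h1, neg_neg]
      rw [h4]
      field_simp
      ring
    simp_rw [hparts]
    have hA : Tendsto (fun n => ∫ r in (1:ℝ)..2, U₁ r * (r ^ N * h n (r ^ 2))) atTop (𝓝 0) := by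
      have hz : (0:ℝ) = ∫ r in (1:ℝ)..2, (0:ℝ) := by simp
      rw [hz]
      refine intervalIntegral.tendsto_integral_filter_of_dominated_convergence
        (fun r => |U₁ r| * |r ^ N|) (Eventually.of_forall fun n => ?_)
        (Eventually.of_forall fun n => ae_of_all _ fun r _ => ?_) ?_ ?_
      · rw [uIoc_of_le one_le_two]
        refine ((hU₁.mono Ioc_subset_Icc_self).mul ?_).aestronglyMeasurable measurableSet_Ioc
        exact ((continuous_pow N).mul ((hh n).1.continuous.comp (continuous_pow 2))).continuousOn
      · rw [Real.norm_eq_abs, abs_mul, abs_mul]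
        gcongr
        exact mul_le_of_le_one_right (abs_nonneg _) (hβle _)
      · exact (hU₁.abs.mul (continuous_pow N).abs.continuousOn).intervalIntegrable_of_Icc one_le_two
      · have h2 : ∀ᵐ r : ℝ, r ≠ 2 := by simp [ae_iff]
        filter_upwards [h2] with r hr2 hr
        rw [uIoc_of_le one_le_two] at hr
        have hr' : r < 2 := lt_of_le_of_ne hr.2 hr2
        refine tendsto_const_nhds.congr' ?_
        filter_upwards [hlim0 (r ^ 2) (hne _ ⟨by nlinarith [hr.1], by nlinarith [hr.1]⟩)] with n hn
        rw [hn, mul_zero, mul_zero]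
    have hB : Tendsto (fun n => ∫ x in annulus N, h n (‖x‖ ^ 2) * inner ℝ x (g x)) atTop (𝓝 0) := by
      have hz : (0:ℝ) = ∫ x in annulus N, (0:ℝ) := by simp
      rw [hz]
      have hgi : Integrable g (volume.restrict (annulus N)) := hg.memLp_grad.integrable (by norm_num)
      refine tendsto_integral_of_dominated_convergence (fun x => 2 * ‖g x‖) (fun n => ?_)
        (hgi.norm.const_mul 2) (fun n => ?_) ?_
      · exact (((hh n).1.continuous.comp (by fun_prop :
          Continuous fun x : EuclideanSpace ℝ (Fin N) => ‖x‖ ^ 2)).aestronglyMeasurable).mul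
          (continuous_id.aestronglyMeasurable.inner hgi.1)
      · filter_upwards [ae_restrict_mem (isOpen_annulus N).measurableSet] with x hx
        rw [norm_mul]
        calc _ ≤ 1 * ‖inner ℝ x (g x)‖ := by gcongr; exact hβle _
          _ ≤ ‖x‖ * ‖g x‖ := by rw [one_mul]; exact norm_inner_le_norm _ _
          _ ≤ 2 * ‖g x‖ := by gcongr; exact hx.2.le
      · filter_upwards [ae_restrict_mem (isOpen_annulus N).measurableSet] with x hx
        rw [← preimage_norm_sq_eq_annulus] at hx
        refine tendsto_const_nhds.congr' ?_
        filter_upwards [hlim0 (‖x‖ ^ 2) (hne _ hx)] with n hn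
        rw [hn, zero_mul]
    simpa using hA.sub (hB.const_mul c⁻¹)
  constructor
  · have h1 := key 1 (by simp)
    -- The end values `1` and `4` are `3` apart, more than the outer radius `2` of `β`, so already
    -- for `n = 0` the cutoff at one end does not see the other.
    have h2 : ∀ n : ℕ, U 2 * (2 ^ N * β ((n + 1) * (4 - 1))) - U 1 * β ((n + 1) * (1 - 1)) = -U 1 := by
      intro n
      have hn : (0:ℝ) ≤ n := Nat.cast_nonneg n
      rw [sub_self, mul_zero, hβ1, hβ0 _ (by rw [abs_of_pos] <;> linarith)]
      ring
    simp_rw [h2] at h1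
    have := tendsto_nhds_unique tendsto_const_nhds h1
    linarith
  · have h1 := key 4 (by simp)
    have h2 : ∀ n : ℕ, U 2 * (2 ^ N * β ((n + 1) * (4 - 4))) - U 1 * β ((n + 1) * (1 - 4)) =
        U 2 * 2 ^ N := by
      intro n
      have hn : (0:ℝ) ≤ n := Nat.cast_nonneg n
      rw [sub_self, mul_zero, hβ1, hβ0 ((n + 1) * (1 - 4)) (by rw [abs_of_neg] <;> linarith)]
      ring
    simp_rw [h2] at h1
    have := tendsto_nhds_unique tendsto_const_nhds h1
    simpa using this

/-! ### From weak solutions to positive classical solutions of the radial equation -/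

/-- A nonnegative function with `|F'| ≤ C F` that vanishes somewhere vanishes identically. -/
lemma eq_zero_of_abs_deriv_le_mul {F F' : ℝ → ℝ} {a b C r₀ : ℝ} (hF : ContinuousOn F (Icc a b))
    (hd : ∀ r ∈ Ioo a b, HasDerivAt F (F' r) r) (hC : ∀ r ∈ Ioo a b, |F' r| ≤ C * F r)
    (h0 : ∀ r ∈ Icc a b, 0 ≤ F r) (hr₀ : r₀ ∈ Icc a b) (hF0 : F r₀ = 0) :
    ∀ r ∈ Icc a b, F r = 0 := by
  intro r hr
  have hexp : ∀ k r : ℝ, HasDerivAt (fun r : ℝ => Real.exp (k * r)) (Real.exp (k * r) * k) r := by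
    intro k r
    simpa using ((hasDerivAt_id r).const_mul k).exp
  refine le_antisymm ?_ (h0 r hr)
  rcases le_total r₀ r with hle | hle
  · have h1 : AntitoneOn (fun r => F r * Real.exp (-C * r)) (Icc a b) :=
      antitoneOn_Icc_of_hasDerivAt (hF.mul (by fun_prop)) (fun x hx => (hd x hx).mul (hexp _ x))
        fun x hx => by
          have := (abs_le.1 (hC x hx)).2
          have := Real.exp_pos (-C * x)
          nlinarith
    have h2 := h1 hr₀ hr hle
    simp only [hF0, zero_mul] at h2
    exact nonpos_of_mul_nonpos_left h2 (Real.exp_pos _)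
  · have h1 : MonotoneOn (fun r => F r * Real.exp (C * r)) (Icc a b) :=
      monotoneOn_Icc_of_hasDerivAt (hF.mul (by fun_prop)) (fun x hx => (hd x hx).mul (hexp _ x))
        fun x hx => by
          have := (abs_le.1 (hC x hx)).1
          have := Real.exp_pos (C * x)
          nlinarith
    have h2 := h1 hr hr₀ hle
    simp only [hF0, zero_mul] at h2
    exact nonpos_of_mul_nonpos_left h2 (Real.exp_pos _)

/-- A positive classical solution of `-U'' - ((N-1)/r) U' + lam U = U^{p-1}` on `(1, 2)` that
vanishes at both ends and is `C¹` up to the boundary, with derivative `U₁`. -/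
structure IsRadialODESolution (N : ℕ) (p lam : ℝ) (U U₁ : ℝ → ℝ) : Prop where
  continuousOn : ContinuousOn U (Icc 1 2)
  continuousOn_deriv : ContinuousOn U₁ (Icc 1 2)
  hasDerivAt : ∀ r ∈ Ioo (1:ℝ) 2, HasDerivAt U (U₁ r) r
  hasDerivAt_deriv : ∀ r ∈ Ioo (1:ℝ) 2,
    HasDerivAt U₁ (lam * U r - U r ^ (p - 1) - (N - 1) / r * U₁ r) r
  left : U 1 = 0
  right : U 2 = 0
  pos : ∀ r ∈ Ioo (1:ℝ) 2, 0 < U r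

lemma IsPositiveRadialSolution.exists_isRadialODESolution {N : ℕ} (hN : 2 ≤ N) {p lam : ℝ}
    (hp : 2 < p) {u : EuclideanSpace ℝ (Fin N) → ℝ} {U : ℝ → ℝ}
    (hu : IsPositiveRadialSolution N p lam u) (hU : IsRadialProfile N u U) :
    ∃ U₁, IsRadialODESolution N p lam U U₁ := by
  have hN1 : 1 ≤ N := by omega
  have hcU := hU.1
  have hq0 : ∀ r ∈ Icc (1:ℝ) 2, r ^ (N - 1) ≠ 0 := fun r hr =>
    pow_ne_zero _ (by linarith [hr.1])
  have hcq : ContinuousOn (fun r : ℝ => r ^ (N - 1)) (Icc 1 2) := (continuous_pow _).continuousOn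
  have hK : ContinuousOn (fun r => r ^ (N - 1) * (lam * U r - |U r| ^ (p - 2) * U r)) (Icc 1 2) :=
    hcq.mul ((continuousOn_const.mul hcU).sub
      ((hcU.abs.rpow_const fun _ _ => Or.inr (by linarith)).mul hcU))
  obtain ⟨Y, hY, hYd⟩ := exists_flux_of_forall_integral_eq one_lt_two
    (contDiff_id.pow (N - 1) : ContDiff ℝ ∞ fun r : ℝ => r ^ (N - 1)) hq0 hcU hK
    fun η hη => hu.weak.integral_profile_eq hN1 hp hU hη
  set U₁ : ℝ → ℝ := fun r => Y r / r ^ (N - 1) with hU₁def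
  have hcU₁ : ContinuousOn U₁ (Icc 1 2) := hY.div hcq hq0
  have hd : ∀ r ∈ Ioo (1:ℝ) 2, HasDerivAt U (U₁ r) r := fun r hr => (hYd r hr).1
  have hnonneg := hU.nonneg hN1 hu.pos
  have hd₁ : ∀ r ∈ Ioo (1:ℝ) 2,
      HasDerivAt U₁ (lam * U r - U r ^ (p - 1) - (N - 1) / r * U₁ r) r := by
    intro r hr
    have hr0 : 0 < r := one_pos.trans hr.1
    refine ((hYd r hr).2.div (hasDerivAt_pow (N - 1) r)
      (hq0 r (Ioo_subset_Icc_self hr))).congr_deriv ?_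
    have h1 : |U r| ^ (p - 2) * U r = U r ^ (p - 1) := by
      rcases (hnonneg r hr).eq_or_lt with h | h
      · rw [← h, mul_zero, Real.zero_rpow (by linarith)]
      · rw [abs_of_pos h, rpow_sub_one_eq_rpow_sub_two_mul h]
    rw [h1, hU₁def]
    obtain ⟨k, rfl⟩ : ∃ k, N = k + 2 := ⟨N - 2, by omega⟩
    simp only [show k + 2 - 1 = k + 1 by omega, Nat.add_sub_cancel]
    push_cast
    field_simp
    ring
  obtain ⟨hl, hr⟩ := hU.eq_zero_of_memH10 hN1 hu.memH10 hcU₁ hd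
  refine ⟨U₁, hcU, hcU₁, hd, hd₁, hl, hr, fun r₀ hr₀ => ?_⟩
  -- An interior zero is a minimum, so `U` and `U'` both vanish there. Then `U² + U'²` vanishes
  -- identically by Gronwall, contradicting positivity of `u`.
  refine lt_of_le_of_ne (hnonneg r₀ hr₀) fun hzero => ?_
  obtain ⟨M, hM⟩ := (isCompact_Icc.image_of_continuousOn hcU).bddAbove
  have hUM : ∀ r ∈ Ioo (1:ℝ) 2, U r ≤ M := fun r hr =>
    hM (mem_image_of_mem _ (Ioo_subset_Icc_self hr))
  have hM0 : 0 ≤ M := (hnonneg r₀ hr₀).trans (hUM r₀ hr₀)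
  have hU₁0 : U₁ r₀ = 0 := by
    have : IsLocalMin U r₀ := by
      filter_upwards [isOpen_Ioo.mem_nhds hr₀] with r hr
      rw [← hzero]
      exact hnonneg r hr
    exact this.hasDerivAt_eq_zero (hd r₀ hr₀)
  have hN0 : (0:ℝ) ≤ N - 1 := by
    have : (1:ℝ) ≤ N := by exact_mod_cast hN1
    linarith
  -- The derivative is `2U'(U + lam U - U^{p-1}) - 2((N-1)/r) U'^2`. The first bracket is at most
  -- `(1 + |lam| + M^{p-2}) U`, and `2|U'|U ≤ U² + U'²`; the friction contributes `2(N-1)` because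
  -- `r ≥ 1`.
  have hzeroAll := eq_zero_of_abs_deriv_le_mul (F := fun r => U r ^ 2 + U₁ r ^ 2)
    (C := (1 + |lam| + M ^ (p - 2)) + 2 * (N - 1)) (r₀ := r₀) ((hcU.pow 2).add (hcU₁.pow 2))
    (fun r hr => ((hd r hr).fun_pow 2).add ((hd₁ r hr).fun_pow 2)) ?_ (fun r _ => by positivity)
    (Ioo_subset_Icc_self hr₀) (by simp [← hzero, hU₁0])
  · refine hU.not_eqOn_zero hN1 hu.pos fun r hr => ?_
    have := hzeroAll r (Ioo_subset_Icc_self hr)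
    nlinarith [sq_nonneg (U r), sq_nonneg (U₁ r)]
  · intro r hr
    have hr0 : 0 < r := one_pos.trans hr.1
    have hUr := hnonneg r hr
    have h1 : U r ^ (p - 1) ≤ M ^ (p - 2) * U r := by
      rcases hUr.eq_or_lt with h | h
      · rw [← h, mul_zero, Real.zero_rpow (by linarith)]
      · rw [rpow_sub_one_eq_rpow_sub_two_mul h]
        exact mul_le_mul_of_nonneg_right (Real.rpow_le_rpow hUr (hUM r hr) (by linarith)) hUr
    have h2 : 0 ≤ U r ^ (p - 1) := Real.rpow_nonneg hUr _
    have h3 : ((N:ℝ) - 1) / r ≤ N - 1 := div_le_self hN0 hr.1.le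
    have h4 : 0 ≤ ((N:ℝ) - 1) / r := by positivity
    have h5 : |U r + (lam * U r - U r ^ (p - 1))| ≤ (1 + |lam| + M ^ (p - 2)) * U r := by
      rw [abs_le]
      have := mul_le_mul_of_nonneg_right (neg_abs_le lam) hUr
      have := mul_le_mul_of_nonneg_right (le_abs_self lam) hUr
      constructor <;> nlinarith
    have h6 : 2 * (|U₁ r| * U r) ≤ U r ^ 2 + U₁ r ^ 2 := by
      nlinarith [sq_nonneg (|U₁ r| - U r), sq_abs (U₁ r)]
    have hA0 : 0 ≤ 1 + |lam| + M ^ (p - 2) := by positivity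
    have h7 : |U₁ r * (U r + (lam * U r - U r ^ (p - 1)))| ≤
        (1 + |lam| + M ^ (p - 2)) * (|U₁ r| * U r) := by
      rw [abs_mul]
      calc _ ≤ |U₁ r| * ((1 + |lam| + M ^ (p - 2)) * U r) := by gcongr
        _ = _ := by ring
    have h8 : ((N:ℝ) - 1) / r * U₁ r ^ 2 ≤ (N - 1) * U₁ r ^ 2 := by gcongr
    have h9 : 0 ≤ ((N:ℝ) - 1) / r * U₁ r ^ 2 := by positivity
    have h10 := mul_le_mul_of_nonneg_left h6 hA0
    have h11 : 0 ≤ ((N:ℝ) - 1) * U r ^ 2 := by positivity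
    obtain ⟨h12, h13⟩ := abs_le.1 h7
    rw [abs_le]
    norm_num
    constructor <;> nlinarith

/-! ### Rescaled radial solutions as half bumps, and the limit of the height -/

namespace IsRadialODESolution

variable {N : ℕ} {p lam rbar : ℝ} {U U₁ : ℝ → ℝ}

/-- The derivative of the energy is `-((N-1)/r) U'^2 ≤ 0`, and at `r = 2`, where `U` vanishes, only
the kinetic part remains. -/
lemma energy_nonneg (h : IsRadialODESolution N p lam U U₁) (hN : 1 ≤ N) (hp : 2 < p) {r : ℝ}
    (hr : r ∈ Icc (1:ℝ) 2) : 0 ≤ energy p lam (U r) (U₁ r) := by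
  have hanti : AntitoneOn (fun r => energy p lam (U r) (U₁ r)) (Icc 1 2) := by
    refine antitoneOn_Icc_of_hasDerivAt (continuousOn_energy hp h.continuousOn h.continuousOn_deriv)
      (fun r hr => hasDerivAt_energy hp (h.hasDerivAt r hr) (h.hasDerivAt_deriv r hr)) ?_
    intro r hr
    have hr0 : 0 < r := one_pos.trans hr.1
    have hN0 : (0:ℝ) ≤ N - 1 := by
      have : (1:ℝ) ≤ N := by exact_mod_cast hN
      linarith
    have : 0 ≤ ((N:ℝ) - 1) / r * U₁ r ^ 2 := by positivity
    linarith
  have h1 := hanti hr (right_mem_Icc.2 one_le_two) hr.2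
  refine le_trans ?_ h1
  simp only [energy, h.right, Real.zero_rpow (show p ≠ 0 by linarith)]
  simp only [ne_eq, OfNat.ofNat_ne_zero, not_false_eq_true, zero_pow, mul_zero, zero_div, sub_zero,
    add_zero]
  positivity

lemma mem_Ioo_of_isMaxOn (h : IsRadialODESolution N p lam U U₁) (hr : rbar ∈ Icc (1:ℝ) 2)
    (hmax : IsMaxOn U (Icc 1 2) rbar) : rbar ∈ Ioo (1:ℝ) 2 := by
  have hmid : (3 / 2 : ℝ) ∈ Ioo (1:ℝ) 2 := by constructor <;> norm_num
  have hpos : 0 < U rbar := (h.pos _ hmid).trans_le (hmax (Ioo_subset_Icc_self hmid))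
  constructor
  · refine lt_of_le_of_ne hr.1 fun he => ?_
    rw [← he, h.left] at hpos
    exact lt_irrefl _ hpos
  · refine lt_of_le_of_ne hr.2 fun he => ?_
    rw [he, h.right] at hpos
    exact lt_irrefl _ hpos

lemma deriv_eq_zero_of_isMaxOn (h : IsRadialODESolution N p lam U U₁) (hr : rbar ∈ Icc (1:ℝ) 2)
    (hmax : IsMaxOn U (Icc 1 2) rbar) : U₁ rbar = 0 := by
  have hr' := h.mem_Ioo_of_isMaxOn hr hmax
  have : IsLocalMax U rbar := hmax.isLocalMax (Icc_mem_nhds hr'.1 hr'.2)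
  exact this.hasDerivAt_eq_zero (h.hasDerivAt rbar hr')

/-- Each side of the maximum point of a radial solution is a half bump, in rescaled variables;
`σ = ± 1` is the direction in which one moves away from the maximum point. -/
lemma halfBump (h : IsRadialODESolution N p lam U U₁) (hN : 1 ≤ N) (hp : 2 < p) (hlam : 0 < lam)
    (hU₁ : U₁ rbar = 0) {M κ σ l : ℝ} (hM : 0 < M) (hκ : 0 < κ) (hκM : κ ^ 2 = M ^ (p - 2))
    (hσ : σ ^ 2 = 1) (hl : 0 < l) (hmem : ∀ t ∈ Ico 0 l, rbar + σ * t ∈ Ioo (1:ℝ) 2)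
    (hend : rbar + σ * l ∈ Icc (1:ℝ) 2) (hUend : U (rbar + σ * l) = 0) :
    HalfBump p (lam / κ ^ 2) ((N - 1) / κ) (κ * l) (fun s => U (rbar + σ * (s / κ)) / M)
      (fun s => σ * U₁ (rbar + σ * (s / κ)) / (M * κ))
      (fun s => -(σ * ((N - 1) / (κ * (rbar + σ * (s / κ)))))) := by
  have hN0 : (0:ℝ) ≤ N - 1 := by
    have : (1:ℝ) ≤ N := by exact_mod_cast hN
    linarith
  have hmem' : ∀ s ∈ Ico 0 (κ * l), rbar + σ * (s / κ) ∈ Ioo (1:ℝ) 2 := fun s hs =>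
    hmem _ ⟨div_nonneg hs.1 hκ.le, by rw [div_lt_iff₀ hκ]; linarith [hs.2]⟩
  have hendκ : rbar + σ * (κ * l / κ) = rbar + σ * l := by field_simp
  have hmaps : MapsTo (fun s => rbar + σ * (s / κ)) (Icc 0 (κ * l)) (Icc 1 2) := fun s hs => by
    rcases hs.2.eq_or_lt with he | hlt
    · simp only [he, hendκ]; exact hend
    · exact Ioo_subset_Icc_self (hmem' s ⟨hs.1, hlt⟩)
  have hlin : ∀ s, HasDerivAt (fun s => rbar + σ * (s / κ)) (σ * (1 / κ)) s := fun s =>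
    (((hasDerivAt_id s).div_const κ).const_mul σ).const_add rbar
  have hcl : ContinuousOn (fun s => rbar + σ * (s / κ)) (Icc 0 (κ * l)) := fun s _ =>
    (hlin s).continuousAt.continuousWithinAt
  refine ⟨hp, by positivity, by positivity, (h.continuousOn.comp hcl hmaps).div_const M,
    (continuousOn_const.mul (h.continuousOn_deriv.comp hcl hmaps)).div_const _, ?_, ?_, ?_, ?_, ?_,
    ?_, ?_⟩
  · intro s hs
    refine (((h.hasDerivAt _ (hmem' s hs)).comp s (hlin s)).div_const M).congr_deriv ?_
    field_simp
  · intro s hs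
    have hm := hmem' s hs
    have hr0 : 0 < rbar + σ * (s / κ) := one_pos.trans hm.1
    refine ((((h.hasDerivAt_deriv _ hm).comp s (hlin s)).const_mul σ).div_const
      (M * κ)).congr_deriv ?_
    have hUr := h.pos _ hm
    -- The relation `κ² = M^{p-2}` gives the power term coefficient `1`; the direction enters only
    -- through `σ² = 1`.
    rw [Real.div_rpow hUr.le hM.le, rpow_sub_one_eq_rpow_sub_two_mul hM, ← hκM]
    generalize U (rbar + σ * (s / κ)) ^ (p - 1) = Q
    generalize U₁ (rbar + σ * (s / κ)) = Y
    generalize U (rbar + σ * (s / κ)) = X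
    generalize rbar + σ * (s / κ) = r at hr0
    field_simp
    linear_combination ((lam * X - Q) * r) * hσ
  · intro s hs
    have hm := hmem' s hs
    have hr0 : 0 < rbar + σ * (s / κ) := one_pos.trans hm.1
    have hσ1 : |σ| = 1 := by
      rwa [← sq_eq_sq₀ (abs_nonneg σ) zero_le_one, sq_abs, one_pow]
    rw [abs_neg, abs_mul, hσ1, one_mul, abs_of_nonneg (by positivity)]
    exact div_le_div_of_nonneg_left hN0 hκ (le_mul_of_one_le_right hκ.le hm.1.le)
  · simp [hU₁]
  · simp only [hendκ, hUend, zero_div]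
  · exact fun s hs => div_pos (h.pos _ (hmem' s hs)) hM
  · intro s hs
    have hm := hmem' s hs
    have hE := h.energy_nonneg hN hp (Ioo_subset_Icc_self hm)
    have hUr := h.pos _ hm
    have he : energy p (lam / κ ^ 2) (U (rbar + σ * (s / κ)) / M)
        (σ * U₁ (rbar + σ * (s / κ)) / (M * κ)) =
        energy p lam (U (rbar + σ * (s / κ))) (U₁ (rbar + σ * (s / κ))) / (M ^ 2 * κ ^ 2) := by
      unfold energy
      rw [Real.div_rpow hUr.le hM.le, rpow_eq_rpow_sub_two_mul_sq hM, ← hκM, div_pow, mul_pow, hσ]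
      have : p ≠ 0 := by linarith
      field_simp
    rw [he]
    positivity

lemma halfBump_right (h : IsRadialODESolution N p lam U U₁) (hN : 1 ≤ N) (hp : 2 < p)
    (hlam : 0 < lam) (hr : rbar ∈ Icc (1:ℝ) 2) (hmax : IsMaxOn U (Icc 1 2) rbar) {M κ : ℝ}
    (hM : 0 < M) (hκ : 0 < κ) (hκM : κ ^ 2 = M ^ (p - 2)) :
    HalfBump p (lam / κ ^ 2) ((N - 1) / κ) (κ * (2 - rbar)) (fun s => U (rbar + 1 * (s / κ)) / M)
      (fun s => 1 * U₁ (rbar + 1 * (s / κ)) / (M * κ))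
      (fun s => -(1 * ((N - 1) / (κ * (rbar + 1 * (s / κ)))))) := by
  have hr' := h.mem_Ioo_of_isMaxOn hr hmax
  refine h.halfBump hN hp hlam (h.deriv_eq_zero_of_isMaxOn hr hmax) hM hκ hκM (one_pow 2)
    (by linarith [hr'.2]) (fun t ht => ⟨?_, ?_⟩) ?_ ?_
  · linarith [ht.1, hr'.1]
  · linarith [ht.2]
  · rw [one_mul, add_sub_cancel]; exact right_mem_Icc.2 one_le_two
  · rw [one_mul, add_sub_cancel]; exact h.right

lemma halfBump_left (h : IsRadialODESolution N p lam U U₁) (hN : 1 ≤ N) (hp : 2 < p)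
    (hlam : 0 < lam) (hr : rbar ∈ Icc (1:ℝ) 2) (hmax : IsMaxOn U (Icc 1 2) rbar) {M κ : ℝ}
    (hM : 0 < M) (hκ : 0 < κ) (hκM : κ ^ 2 = M ^ (p - 2)) :
    HalfBump p (lam / κ ^ 2) ((N - 1) / κ) (κ * (rbar - 1))
      (fun s => U (rbar + (-1) * (s / κ)) / M)
      (fun s => (-1) * U₁ (rbar + (-1) * (s / κ)) / (M * κ))
      (fun s => -((-1) * ((N - 1) / (κ * (rbar + (-1) * (s / κ)))))) := by
  have hr' := h.mem_Ioo_of_isMaxOn hr hmax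
  have he : rbar + (-1) * (rbar - 1) = 1 := by ring
  refine h.halfBump hN hp hlam (h.deriv_eq_zero_of_isMaxOn hr hmax) hM hκ hκM (by norm_num)
    (by linarith [hr'.1]) (fun t ht => ⟨?_, ?_⟩) ?_ ?_
  · linarith [ht.2]
  · linarith [ht.1, hr'.2]
  · rw [he]; exact left_mem_Icc.2 one_le_two
  · rw [he]; exact h.left

/-- For large `lam` the maximum `M` of a solution satisfies `lam / M^{p-2} ≈ 2 / p`. -/
lemma exists_abs_height_le (N : ℕ) (hN : 1 ≤ N) {p δ : ℝ} (hp : 2 < p) (hδ : 0 < δ) :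
    ∃ Λ, ∀ (lam rbar : ℝ) (U U₁ : ℝ → ℝ), Λ ≤ lam → 0 < lam → IsRadialODESolution N p lam U U₁ →
      rbar ∈ Icc (1:ℝ) 2 → IsMaxOn U (Icc 1 2) rbar →
      |1 / p - lam / U rbar ^ (p - 2) / 2| < δ := by
  have hp0 : 0 < p := by linarith
  obtain ⟨L, ε₀, hε₀, hL⟩ := HalfBump.exists_length_le hp hδ ((N:ℝ) - 1)
  -- Exceeding `2L` makes the rescaled interval too long for two half bumps of length at most `L`;
  -- exceeding `(N-1)/ε₀` makes the damping admissible.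
  set k : ℝ := max (2 * L) ((N - 1) / ε₀) with hk
  refine ⟨(|k| + 1) ^ 2, fun lam rbar U U₁ hlam hlam0 h hr hmax => ?_⟩
  have hN0 : (0:ℝ) ≤ N - 1 := by
    have : (1:ℝ) ≤ N := by exact_mod_cast hN
    linarith
  have hr' := h.mem_Ioo_of_isMaxOn hr hmax
  have hM := h.pos rbar hr'
  set M := U rbar with hMdef
  set κ : ℝ := √(M ^ (p - 2)) with hκdef
  have hMp : 0 < M ^ (p - 2) := by positivity
  have hκ : 0 < κ := Real.sqrt_pos.2 hMp
  have hκM : κ ^ 2 = M ^ (p - 2) := Real.sq_sqrt hMp.le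
  have hR := h.halfBump_right hN hp hlam0 hr hmax hM hκ hκM
  have hLe := h.halfBump_left hN hp hlam0 hr hmax hM hκ hκM
  -- Nonnegative energy at the top, where the normalised height is `1`. It gives one of the two
  -- inequalities and, since `p > 2`, also `lam ≤ κ²`, so `κ` is large when `lam` is.
  have hμ : p / 2 * (lam / κ ^ 2) ≤ 1 := by
    have := hR.mu_le_of_vel_eq_zero (left_mem_Ico.2 hR.length_pos) hR.vel_zero
    simpa [← hMdef, div_self hM.ne'] using this
  have hμ' : lam / κ ^ 2 / 2 ≤ 1 / p := by
    rw [le_div_iff₀ hp0]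
    linarith
  rw [← hκM, abs_of_nonneg (by linarith)]
  by_contra hcon
  rw [not_lt] at hcon
  have hκk : k < κ := by
    have h1 : lam ≤ κ ^ 2 := by
      have h2 : lam / κ ^ 2 ≤ 1 := by
        have : 0 ≤ lam / κ ^ 2 := by positivity
        nlinarith
      rwa [div_le_one (by positivity)] at h2
    have h3 : |k| + 1 ≤ κ := abs_le_of_sq_le_sq' (hlam.trans h1) hκ.le |>.2
    linarith [le_abs_self k]
  have hε : (N - 1) / κ ≤ ε₀ := by
    rw [div_le_iff₀ hκ]
    have := (div_le_iff₀ hε₀).1 ((le_max_right (2 * L) _).trans hκk.le)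
    linarith
  -- If the gap were at least `δ`, the lengths `κ(2 - rbar)` and `κ(rbar - 1)` would each be at most
  -- `L`. Their sum is `κ > 2L`.
  have h1 := hL _ _ _ _ _ _ hR (by simp [← hMdef, div_self hM.ne'])
    (by rw [← mul_assoc, div_mul_cancel₀ _ hκ.ne']; nlinarith [hr'.1]) hε hcon
  have h2 := hL _ _ _ _ _ _ hLe (by simp [← hMdef, div_self hM.ne'])
    (by rw [← mul_assoc, div_mul_cancel₀ _ hκ.ne']; nlinarith [hr'.2]) hε hcon
  have h3 := le_max_left (2 * L) ((N - 1) / ε₀)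
  linarith

end IsRadialODESolution

/-! ### Convergence on the whole line -/

/-- Extension by zero of a `C¹` function vanishing at the end points of an interval. -/
lemma hasH1Gradient_indicator_Ioo {a b : ℝ} {f f' : ℝ → ℝ} (hab : a ≤ b)
    (hf : ContinuousOn f (Icc a b)) (hf' : ContinuousOn f' (Icc a b))
    (hd : ∀ x ∈ Ioo a b, HasDerivAt f (f' x) x) (ha : f a = 0) (hb : f b = 0) :
    HasH1Gradient (univ : Set ℝ) ((Ioo a b).indicator f) ((Ioo a b).indicator f') := by
  have hmem : ∀ {g : ℝ → ℝ}, ContinuousOn g (Icc a b) →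
      MemLp ((Ioo a b).indicator g) 2 (volume.restrict univ) := by
    intro g hg
    rw [Measure.restrict_univ, memLp_indicator_iff_restrict measurableSet_Ioo]
    refine (memLp_two_iff_integrable_sq ((hg.aestronglyMeasurable measurableSet_Icc).mono_set
      Ioo_subset_Icc_self)).2 ?_
    exact ((hg.pow 2).integrableOn_Icc).mono_set Ioo_subset_Icc_self
  refine ⟨hmem hf, hmem hf', fun φ hφ => ?_⟩
  have hφd : ∀ x, HasDerivAt φ (deriv φ x) x := fun x =>
    (hφ.1.differentiable (by simp) x).hasDerivAt
  have h1 := intervalIntegral.integral_mul_deriv_eq_deriv_mul_of_hasDerivAt (a := a) (b := b)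
    (u := f) (u' := f') (v := φ) (v' := deriv φ)
    (by rwa [uIcc_of_le hab]) hφ.1.continuous.continuousOn
    (by rwa [min_eq_left hab, max_eq_right hab]) (fun x _ => hφd x)
    (hf'.intervalIntegrable_of_Icc hab)
    ((hφ.1.continuous_deriv (by simp)).intervalIntegrable _ _)
  rw [ha, hb, zero_mul, zero_mul, sub_zero, zero_sub, intervalIntegral.integral_of_le hab,
    intervalIntegral.integral_of_le hab, integral_Ioc_eq_integral_Ioo,
    integral_Ioc_eq_integral_Ioo, ← integral_indicator measurableSet_Ioo,
    ← integral_indicator measurableSet_Ioo] at h1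
  rw [Measure.restrict_univ]
  convert h1 using 1
  · congr 1
    ext x
    by_cases hx : x ∈ Ioo a b <;> simp [hx, gradient_eq_deriv']
  · congr 2
    ext x
    by_cases hx : x ∈ Ioo a b <;> simp [hx, mul_comm]

lemma tendsto_eLpNorm_two_of_half_lines {f : ℕ → ℝ → ℝ} (hf : ∀ n, MemLp (f n) 2 volume)
    (hr : Tendsto (fun n => ∫ s in Ioi (0:ℝ), f n s ^ 2) atTop (𝓝 0))
    (hl : Tendsto (fun n => ∫ s in Ioi (0:ℝ), f n (-s) ^ 2) atTop (𝓝 0)) :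
    Tendsto (fun n => eLpNorm (f n) 2 volume) atTop (𝓝 0) := by
  have h1 : ∀ n, eLpNorm (f n) 2 volume = ENNReal.ofReal
      (((∫ s in Ioi (0:ℝ), f n s ^ 2) + ∫ s in Ioi (0:ℝ), f n (-s) ^ 2) ^ (2:ℝ)⁻¹) := by
    intro n
    rw [(hf n).eLpNorm_eq_integral_rpow_norm (by norm_num) (by norm_num)]
    have h2 : ∫ s, ‖f n s‖ ^ (2:ENNReal).toReal = ∫ s, f n s ^ 2 := by
      congr 1
      ext s
      simp
    have hi := (hf n).integrable_sq
    rw [h2, integral_comp_neg_Ioi (0:ℝ) (fun s => f n s ^ 2), neg_zero, add_comm,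
      intervalIntegral.integral_Iic_add_Ioi hi.integrableOn hi.integrableOn]
    simp
  simp_rw [h1]
  rw [← ENNReal.ofReal_zero]
  refine ENNReal.tendsto_ofReal ?_
  have h3 := (hr.add hl).rpow_const (p := (2:ℝ)⁻¹) (Or.inr (by norm_num))
  rwa [add_zero, Real.zero_rpow (by norm_num)] at h3

lemma deriv_groundState_neg {p : ℝ} (hp : 2 < p) (r : ℝ) :
    deriv (groundState p) (-r) = -deriv (groundState p) r := by
  rw [deriv_groundState hp]
  simp [groundState_neg, Real.tanh_neg]

/-- The rescaled solutions converge to the ground state. -/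
lemma tendstoH1_rescaled {N : ℕ} (hN : 1 ≤ N) {p : ℝ} (hp : 2 < p) {lam rbar : ℕ → ℝ}
    {U U₁ : ℕ → ℝ → ℝ} (hlam : Tendsto lam atTop atTop) (hpos : ∀ n, 0 < lam n)
    (h : ∀ n, IsRadialODESolution N p (lam n) (U n) (U₁ n)) (hr : ∀ n, rbar n ∈ Icc (1:ℝ) 2)
    (hmax : ∀ n, IsMaxOn (U n) (Icc 1 2) (rbar n)) :
    TendstoH1 (univ : Set ℝ) (fun n => rescaled p (lam n) (rbar n) (U n)) (groundState p) := by
  have hp2 : 0 < p - 2 := by linarith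
  -- Here the scale comes from `lam`, not from the maximum: `M^{p-2} = lam = κ²` normalises the
  -- linear coefficient to `1`, as in the limit equation.
  set M : ℕ → ℝ := fun n => lam n ^ (1 / (p - 2)) with hMdef
  have hM : ∀ n, 0 < M n := fun n => Real.rpow_pos_of_pos (hpos n) _
  have hMp : ∀ n, M n ^ (p - 2) = lam n := fun n => by
    rw [hMdef, ← Real.rpow_mul (hpos n).le, one_div_mul_cancel hp2.ne', Real.rpow_one]
  have hMinv : ∀ n, lam n ^ (1 / (2 - p)) = (M n)⁻¹ := fun n => by
    rw [hMdef, ← Real.rpow_neg (hpos n).le]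
    congr 1
    rw [show 2 - p = -(p - 2) by ring, div_neg]
  set κ : ℕ → ℝ := fun n => √(lam n) with hκdef
  have hκ : ∀ n, 0 < κ n := fun n => Real.sqrt_pos.2 (hpos n)
  have hκ2 : ∀ n, κ n ^ 2 = lam n := fun n => Real.sq_sqrt (hpos n).le
  have hr' : ∀ n, rbar n ∈ Ioo (1:ℝ) 2 := fun n => (h n).mem_Ioo_of_isMaxOn (hr n) (hmax n)
  have hN0 : (0:ℝ) ≤ N - 1 := by
    have : (1:ℝ) ≤ N := by exact_mod_cast hN
    linarith
  have hR : ∀ n, HalfBump p 1 _ _ _ _ _ := fun n => by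
    have := (h n).halfBump_right hN hp (hpos n) (hr n) (hmax n) (hM n) (hκ n)
      ((hκ2 n).trans (hMp n).symm)
    rwa [hκ2, div_self (hpos n).ne'] at this
  have hL : ∀ n, HalfBump p 1 _ _ _ _ _ := fun n => by
    have := (h n).halfBump_left hN hp (hpos n) (hr n) (hmax n) (hM n) (hκ n)
      ((hκ2 n).trans (hMp n).symm)
    rwa [hκ2, div_self (hpos n).ne'] at this
  have hκtop : Tendsto κ atTop atTop := Real.tendsto_sqrt_atTop.comp hlam
  have hε : Tendsto (fun n => ((N:ℝ) - 1) / κ n) atTop (𝓝 0) := hκtop.const_div_atTop _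
  have hUpos : ∀ n, 0 < U n (rbar n) := fun n => (h n).pos _ (hr' n)
  have hheight : Tendsto (fun n => U n (rbar n) / M n) atTop (𝓝 (groundState p 0)) := by
    have h1 : Tendsto (fun n => lam n / U n (rbar n) ^ (p - 2)) atTop (𝓝 (2 / p)) := by
      rw [Metric.tendsto_nhds]
      intro δ hδ
      obtain ⟨Λ, hΛ⟩ := IsRadialODESolution.exists_abs_height_le N hN hp
        (show 0 < δ / 2 by positivity)
      filter_upwards [hlam.eventually_ge_atTop Λ] with n hn
      have h2 := hΛ (lam n) (rbar n) (U n) (U₁ n) hn (hpos n) (h n) (hr n) (hmax n)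
      rw [Real.dist_eq, abs_sub_comm]
      rw [abs_lt] at h2 ⊢
      have h3 : (2:ℝ) / p = 2 * (1 / p) := by ring
      rw [h3]
      constructor <;> linarith [h2.1, h2.2]
    have h2 := (h1.inv₀ (by positivity)).rpow_const (p := 1 / (p - 2)) (Or.inr (by positivity))
    rw [inv_div] at h2
    rw [groundState_zero]
    refine h2.congr fun n => ?_
    rw [← hMp n, inv_div, ← Real.div_rpow (hUpos n).le (hM n).le,
      ← Real.rpow_mul (div_pos (hUpos n) (hM n)).le, mul_one_div_cancel hp2.ne', Real.rpow_one]
  obtain ⟨⟨-, hR1⟩, -, hR2⟩ := HalfBump.tendsto_groundState (c := (N:ℝ) - 1) hp hR hε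
    (fun n => by
      rw [← mul_assoc, div_mul_cancel₀ _ (hκ n).ne']
      nlinarith [(hr' n).1]) (by simpa using hheight)
  obtain ⟨⟨-, hL1⟩, -, hL2⟩ := HalfBump.tendsto_groundState (c := (N:ℝ) - 1) hp hL hε
    (fun n => by
      rw [← mul_assoc, div_mul_cancel₀ _ (hκ n).ne']
      nlinarith [(hr' n).2]) (by simpa using hheight)
  -- The weak derivative of the rescaled function. There is no boundary contribution because the
  -- profile vanishes at both ends.
  set G : ℕ → ℝ → ℝ := fun n => (Ioo (κ n * (1 - rbar n)) (κ n * (2 - rbar n))).indicator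
    fun r => (M n)⁻¹ * (U₁ n (r / κ n + rbar n) * (1 / κ n)) with hG
  have hgrad : ∀ n, HasH1Gradient (univ : Set ℝ) (rescaled p (lam n) (rbar n) (U n)) (G n) := by
    intro n
    have hκn := hκ n
    unfold rescaled
    rw [hMinv]
    have hmaps : MapsTo (fun r => r / κ n + rbar n)
        (Icc (κ n * (1 - rbar n)) (κ n * (2 - rbar n))) (Icc 1 2) := fun r hr => by
      have h1 : 1 - rbar n ≤ r / κ n := by rw [le_div_iff₀ hκn]; linarith [hr.1]
      have h2 : r / κ n ≤ 2 - rbar n := by rw [div_le_iff₀ hκn]; linarith [hr.2]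
      constructor <;> linarith
    have hcl : ContinuousOn (fun r => r / κ n + rbar n)
        (Icc (κ n * (1 - rbar n)) (κ n * (2 - rbar n))) := by fun_prop
    refine hasH1Gradient_indicator_Ioo (by nlinarith)
      (continuousOn_const.mul ((h n).continuousOn.comp hcl hmaps))
      (continuousOn_const.mul (((h n).continuousOn_deriv.comp hcl hmaps).mul continuousOn_const))
      (fun r hr => ?_) ?_ ?_
    · have h1 : 1 - rbar n < r / κ n := by rw [lt_div_iff₀ hκn]; linarith [hr.1]
      have h2 : r / κ n < 2 - rbar n := by rw [div_lt_iff₀ hκn]; linarith [hr.2]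
      have h3 := (h n).hasDerivAt (r / κ n + rbar n) ⟨by linarith, by linarith⟩
      exact (h3.comp r (((hasDerivAt_id r).div_const (κ n)).add_const (rbar n))).const_mul _
    · rw [mul_div_cancel_left₀ _ hκn.ne', sub_add_cancel, (h n).left, mul_zero]
    · rw [mul_div_cancel_left₀ _ hκn.ne', sub_add_cancel, (h n).right, mul_zero]
  have hW := groundState_hasH1Gradient hp
  refine ⟨G, deriv (groundState p), hgrad, hW, ?_, ?_⟩
  · rw [Measure.restrict_univ]
    refine tendsto_eLpNorm_two_of_half_lines
      (fun n => by
        have := (hgrad n).memLp.sub hW.memLp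
        rw [Measure.restrict_univ] at this
        exact this) ?_ ?_
    · refine hR1.congr fun n => setIntegral_congr_fun measurableSet_Ioi fun s hs => ?_
      have hs0 : 0 < s := hs
      have h1 : κ n * (1 - rbar n) < s := lt_of_le_of_lt
        (mul_nonpos_of_nonneg_of_nonpos (hκ n).le (by linarith [(hr' n).1])) hs0
      have h2 : s ∈ Ioo (κ n * (1 - rbar n)) (κ n * (2 - rbar n)) ↔ s ∈ Iio (κ n * (2 - rbar n)) :=
        ⟨fun h => h.2, fun h => ⟨h1, h⟩⟩
      simp only [rescaled, indicator_apply]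
      rw [hMinv]
      simp only [show √(lam n) = κ n from rfl, h2]
      congr 3
      rw [one_mul, add_comm, div_eq_inv_mul]
    · refine hL1.congr fun n => setIntegral_congr_fun measurableSet_Ioi fun s hs => ?_
      have hs0 : 0 < s := hs
      have h1 : -s < κ n * (2 - rbar n) := by
        have := mul_pos (hκ n) (show 0 < 2 - rbar n by linarith [(hr' n).2])
        linarith
      have h2 : -s ∈ Ioo (κ n * (1 - rbar n)) (κ n * (2 - rbar n)) ↔
          s ∈ Iio (κ n * (rbar n - 1)) :=
        ⟨fun h => by have := h.1; simp only [mem_Iio]; linarith,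
          fun h => ⟨by have : s < _ := h; linarith, h1⟩⟩
      simp only [rescaled, indicator_apply, groundState_neg]
      rw [hMinv]
      simp only [show √(lam n) = κ n from rfl, h2]
      congr 3
      rw [add_comm, div_eq_inv_mul, neg_div, neg_one_mul]
  · rw [Measure.restrict_univ]
    refine tendsto_eLpNorm_two_of_half_lines
      (fun n => by
        have := (hgrad n).memLp_grad.sub hW.memLp_grad
        rw [Measure.restrict_univ] at this
        exact this) ?_ ?_
    · refine hR2.congr fun n => setIntegral_congr_fun measurableSet_Ioi fun s hs => ?_
      have hs0 : 0 < s := hs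
      have h1 : κ n * (1 - rbar n) < s := lt_of_le_of_lt
        (mul_nonpos_of_nonneg_of_nonpos (hκ n).le (by linarith [(hr' n).1])) hs0
      have h2 : s ∈ Ioo (κ n * (1 - rbar n)) (κ n * (2 - rbar n)) ↔ s ∈ Iio (κ n * (2 - rbar n)) :=
        ⟨fun h => h.2, fun h => ⟨h1, h⟩⟩
      simp only [hG, indicator_apply, h2]
      congr 3
      rw [one_mul, one_mul, add_comm, div_eq_mul_inv, mul_inv]
      ring
    · refine hL2.congr fun n => setIntegral_congr_fun measurableSet_Ioi fun s hs => ?_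
      have hs0 : 0 < s := hs
      have h1 : -s < κ n * (2 - rbar n) := by
        have := mul_pos (hκ n) (show 0 < 2 - rbar n by linarith [(hr' n).2])
        linarith
      have h2 : -s ∈ Ioo (κ n * (1 - rbar n)) (κ n * (2 - rbar n)) ↔
          s ∈ Iio (κ n * (rbar n - 1)) :=
        ⟨fun h => by have := h.1; simp only [mem_Iio]; linarith,
          fun h => ⟨by have : s < _ := h; linarith, h1⟩⟩
      -- On the left half line the outward velocity is minus the derivative; the sign disappears on
      -- squaring because the derivative of the ground state is odd.
      simp only [hG, indicator_apply, h2, deriv_groundState_neg hp]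
      rw [← neg_sq]
      congr 1
      rw [show rbar n + -1 * (s / κ n) = -s / κ n + rbar n by ring]
      split_ifs
      · rw [div_eq_mul_inv, mul_inv]
        ring
      · ring

theorem theorem2p5 (N : ℕ) (hN : 2 ≤ N) (p : ℝ) (hp : 2 < p)
    (hp' : 3 ≤ N → p < 2 * (N : ℝ) / ((N : ℝ) - 2)) :
    ∃ W : ℝ → ℝ,
      -- `W` is the unique decaying positive solution whose maximum is at the origin,
      IsDecayingPositiveSolution p W ∧ (∀ r, W r ≤ W 0) ∧
      (∀ V : ℝ → ℝ, IsDecayingPositiveSolution p V → (∀ r, V r ≤ V 0) → V = W) ∧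
      -- every decaying positive solution is a translate of it,
      (∀ V : ℝ → ℝ, IsDecayingPositiveSolution p V → ∃ a : ℝ, ∀ r, V r = W (r - a)) ∧
      MemH1 (univ : Set ℝ) W ∧
      -- and the rescaled solutions converge to it.
      ∀ (lam : ℕ → ℝ) (u : ℕ → EuclideanSpace ℝ (Fin N) → ℝ) (U : ℕ → ℝ → ℝ) (rbar : ℕ → ℝ),
        Tendsto lam atTop atTop →
        (∀ n, IsPositiveRadialSolution N p (lam n) (u n)) →
        (∀ n, IsRadialProfile N (u n) (U n)) →
        (∀ n, rbar n ∈ Icc (1 : ℝ) 2 ∧ IsMaxOn (U n) (Icc 1 2) (rbar n)) →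
        ∃ k : ℕ → ℕ, StrictMono k ∧
          TendstoH1 (univ : Set ℝ)
            (fun n => rescaled p (lam (k n)) (rbar (k n)) (U (k n))) W := by
  refine ⟨groundState p, groundState_isDecayingPositiveSolution hp, groundState_le_apply_zero hp,
    fun V hV hmax => funext fun r => ?_, fun V hV => ?_,
    ⟨_, groundState_hasH1Gradient hp⟩, fun lam u U rbar hlam hu hU hr => ?_⟩
  · have h0 : deriv V 0 = 0 := IsLocalMax.deriv_eq_zero (Eventually.of_forall hmax)
    rw [hV.eq_groundState_sub hp h0 r, sub_zero]
  · obtain ⟨a, ha⟩ := hV.exists_deriv_eq_zero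
    exact ⟨a, hV.eq_groundState_sub hp ha⟩
  -- The subsequence only discards the initial indices, where `lam` may fail to be positive; the
  -- whole remaining sequence converges.
  · obtain ⟨n₀, hn₀⟩ := eventually_atTop.1 (hlam.eventually_gt_atTop 0)
    choose U₁ hU₁ using fun n => (hu n).exists_isRadialODESolution hN hp (hU n)
    refine ⟨fun n => n + n₀, fun a b hab => by simpa using hab, ?_⟩
    exact tendstoH1_rescaled (by omega) hp (hlam.comp (tendsto_add_atTop_nat n₀))
      (fun n => hn₀ (n + n₀) (Nat.le_add_left n₀ n)) (fun n => hU₁ (n + n₀)) (fun n => (hr (n + n₀)).1)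
      fun n => (hr (n + n₀)).2
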